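/- \textbf{Conventions.} For $A\subseteq\mathbb N$ let $\Phi_0^A,\Phi_1^A,\dots$ be the standard listing of the partial functions $\mathbb N\to\mathbb N$ that are recursive in $A$, and let $J^A(e)=\Phi_e^A(e)$ be the jump function. A $B$-c.e. trace is a sequence $(T_n)_{n\in\mathbb N}$ of finite subsets of $\mathbb N$ that is uniformly c.e. in $B$; it is $h$-bounded if $|T_n|\le h(n)$ for each $n$, and it traces a partial function $\psi$ if $\psi(n)\in T_n$ whenever $\psi(n)$ is defined. An order function is a computable, nondecreasing, unbounded function $h:\mathbb N\to\mathbb N\setminus\{0\}$. A set $B$ is jump traceable if, for some computable function $h$, the function $J^B$ has an $h$-bounded $\emptyset$-c.e. trace. We write $A\le_{SJR}B$ if for every order function $h$ the function $J^A$ has an $h$-bounded $B$-c.e. trace. A cost function is a computable function $c:\mathbb N\times\mathbb N\to\{q\in\mathbb Q: q\ge 0\}$ with $c(x+1,s)\le c(x,s)\le c(x,s+1)$ for all $x,s$. It is benign if from a rational $\varepsilon>0$ one can compute a bound on the length $\ell$ of any sequence $n_1<s_1\le n_2<s_2\le\dots\le n_\ell<s_\ell$ such that $c(n_i,s_i)\ge\varepsilon$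 for all $i\le\ell$. A $B$-computable enumeration (approximation) of a set $A$ is a sequence $(A_s)_{s\in\mathbb N}$ of finite sets, given by strong indices computable in $B$, such that $A(x)=\lim_s A_s(x)$ for each $x$ (the sequence need not be increasing). It obeys $c$ if $$\sum_{s\ge 1,\ A_s\ne A_{s-1}} c(x_s,s)<\infty,\qquad\text{where } x_s=\min\{x: A_s(x)\neq A_{s-1}(x)\}.$$ We write $A\models_B c$ if some $B$-computable enumeration of $A$ obeys $c$. \textbf{Proposition.} Let $A,B\subseteq\mathbb N$. If $A\le_{SJR}B$ and $B$ is jump traceable, then $A\models_B c$ for every benign cost function $c$. -/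

import Mathlib

namespace SJR

open Nat.Partrec (Code)

/-! ### Relative computability and the jump -/

open Classical in
/-- The characteristic function of a set of natural numbers. -/
noncomputable def chi (A : Set ℕ) (n : ℕ) : ℕ := if n ∈ A then 1 else 0

/-- The oracle `A`, in the form used by `RecursiveIn` and `ComputableIn`. -/
noncomputable def oracle (A : Set ℕ) : Set (ℕ →. ℕ) := {fun n => Part.some (chi A n)}

/-- The initial segment `A↾n`, as a string of zeros and ones of length `n`. -/
noncomputable def restrict (A : Set ℕ) (n : ℕ) : List ℕ := (List.range n).map (chi A)

/-- The Turing functional `Φ_c^A` given by a program `c` that, on input `x`, may consult longer and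
longer initial segments of the oracle: `c` is run on the inputs `⟨x, A↾m⟩`, `m = 0, 1, 2, …`, in a
dovetailed fashion (for `t` steps at stage `⟨m, t⟩`), and the output of the first run seen to halt
is `Φ_c^A(x)`. It is undefined if no run halts. For each `A` these are exactly the partial functions
that are recursive in `A`; see `recursiveIn_iff_exists_oracleEval`. -/
noncomputable def oracleEval (A : Set ℕ) (c : Code) : ℕ →. ℕ := fun x =>
  Nat.rfindOpt fun k =>
    Code.evaln k.unpair.2 c (Nat.pair x (Encodable.encode (restrict A k.unpair.1)))

/-- Initial segments of `A` extend each other. -/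
theorem restrict_prefix (A : Set ℕ) {m n : ℕ} (h : m ≤ n) : restrict A m <+: restrict A n := by
  obtain ⟨k, rfl⟩ := Nat.exists_eq_add_of_le h
  rw [restrict, restrict, List.range_add, List.map_append]
  exact List.prefix_append _ _

/-- Every partial function recursive in `A` is given by a monotone partial computable function on
initial segments of `A`. -/
theorem exists_monotone_of_recursiveIn {A : Set ℕ} {f : ℕ →. ℕ}
    (hf : Nat.RecursiveIn (oracle A) f) :
    ∃ F : ℕ × List ℕ →. ℕ, Partrec F ∧
      (∀ x σ τ y, σ <+: τ → y ∈ F (x, σ) → y ∈ F (x, τ)) ∧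
      ∀ x y, y ∈ f x ↔ ∃ n, y ∈ F (x, restrict A n) := by
  induction hf with
  | zero =>
    exact ⟨fun _ => Part.some 0, (Computable.const 0).partrec, fun _ _ _ _ _ h => h,
      fun x y => by
        change y ∈ Part.some 0 ↔ _
        simp⟩
  | succ =>
    exact ⟨fun p => Part.some (p.1 + 1), (Computable.succ.comp Computable.fst).partrec,
      fun _ _ _ _ _ h => h, fun x y => by simp⟩
  | left =>
    exact ⟨fun p => Part.some p.1.unpair.1,
      (Computable.fst.comp (Computable.unpair.comp Computable.fst)).partrec,
      fun _ _ _ _ _ h => h, fun x y => by simp⟩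
  | right =>
    exact ⟨fun p => Part.some p.1.unpair.2,
      (Computable.snd.comp (Computable.unpair.comp Computable.fst)).partrec,
      fun _ _ _ _ _ h => h, fun x y => by simp⟩
  | oracle g hg =>
    obtain rfl : g = fun n => Part.some (chi A n) := hg
    refine ⟨fun p => (p.2[p.1]? : Option ℕ), ?_, ?_, ?_⟩
    · exact (Computable.list_getElem?.comp Computable.snd Computable.fst).ofOption
    · rintro x σ τ y ⟨ρ, rfl⟩ h
      simp only [Part.mem_coe, Option.mem_def] at h ⊢
      rw [List.getElem?_append_left (List.getElem?_eq_some_iff.1 h).1, h]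
    · intro x y
      simp only [restrict, Part.mem_some_iff, Part.mem_coe, Option.mem_def, List.getElem?_map,
        Option.map_eq_some_iff]
      constructor
      · rintro rfl
        exact ⟨x + 1, x, by simp, rfl⟩
      · rintro ⟨n, a, ha, rfl⟩
        rw [List.getElem?_eq_some_iff] at ha
        obtain ⟨h, rfl⟩ := ha
        simp
  | @pair f h _ _ ihf ihh =>
    obtain ⟨F, hF, mF, eF⟩ := ihf
    obtain ⟨H, hH, mH, eH⟩ := ihh
    refine ⟨fun p => (F p).bind fun a => (H p).map fun b => Nat.pair a b, ?_, ?_, ?_⟩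
    · exact hF.bind ((hH.comp Computable.fst).map
        (Primrec₂.natPair.to_comp.comp (Computable.snd.comp Computable.fst) Computable.snd).to₂).to₂
    · intro x σ τ y hs hy
      simp only [Part.mem_bind_iff, Part.mem_map_iff] at hy ⊢
      obtain ⟨a, ha, b, hb, rfl⟩ := hy
      exact ⟨a, mF _ _ _ _ hs ha, b, mH _ _ _ _ hs hb, rfl⟩
    · intro x y
      simp only [Seq.seq, Part.map_eq_map, Part.mem_bind_iff, Part.mem_map_iff, eF, eH]
      constructor
      · rintro ⟨_, ⟨a, ⟨n, ha⟩, rfl⟩, b, ⟨m, hb⟩, rfl⟩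
        exact ⟨max n m, a, mF _ _ _ _ (restrict_prefix A (le_max_left _ _)) ha, b,
          mH _ _ _ _ (restrict_prefix A (le_max_right _ _)) hb, rfl⟩
      · rintro ⟨n, a, ha, b, hb, rfl⟩
        exact ⟨_, ⟨a, ⟨n, ha⟩, rfl⟩, b, ⟨n, hb⟩, rfl⟩
  | @comp f h _ _ ihf ihh =>
    obtain ⟨F, hF, mF, eF⟩ := ihf
    obtain ⟨H, hH, mH, eH⟩ := ihh
    refine ⟨fun p => (H p).bind fun a => F (a, p.2), ?_, ?_, ?_⟩
    · exact hH.bind (hF.comp (Computable.snd.pair (Computable.snd.comp Computable.fst))).to₂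
    · intro x σ τ y hs hy
      simp only [Part.mem_bind_iff] at hy ⊢
      obtain ⟨a, ha, hb⟩ := hy
      exact ⟨a, mH _ _ _ _ hs ha, mF _ _ _ _ hs hb⟩
    · intro x y
      change y ∈ (h x).bind (fun a => f a) ↔ ∃ n, y ∈ (H (x, restrict A n)).bind fun a => F (a, restrict A n)
      simp only [Part.mem_bind_iff, eF, eH]
      constructor
      · rintro ⟨a, ⟨n, ha⟩, m, hb⟩
        exact ⟨max n m, a, mH _ _ _ _ (restrict_prefix A (le_max_left _ _)) ha,
          mF _ _ _ _ (restrict_prefix A (le_max_right _ _)) hb⟩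
      · rintro ⟨n, a, ha, hb⟩
        exact ⟨a, ⟨n, ha⟩, n, hb⟩
  | @prec f h _ _ ihf ihh =>
    obtain ⟨F, hF, mF, eF⟩ := ihf
    obtain ⟨H, hH, mH, eH⟩ := ihh
    let R : ℕ → ℕ → List ℕ → Part ℕ := fun a n σ =>
      n.rec (F (a, σ)) fun y IH => IH.bind fun i => H (Nat.pair a (Nat.pair y i), σ)
    have mR : ∀ a n σ τ y, σ <+: τ → y ∈ R a n σ → y ∈ R a n τ := by
      intro a n σ τ y hs
      induction n generalizing y with
      | zero => exact mF _ _ _ _ hs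
      | succ n ih =>
        simp only [R, Part.mem_bind_iff] at ih ⊢
        rintro ⟨i, hi, hy⟩
        exact ⟨i, ih _ hi, mH _ _ _ _ hs hy⟩
    refine ⟨fun p => R p.1.unpair.1 p.1.unpair.2 p.2, ?_, ?_, ?_⟩
    · have h1 : Computable fun p : ℕ × List ℕ => p.1.unpair.1 :=
        Computable.fst.comp (Computable.unpair.comp Computable.fst)
      have h2 : Computable fun p : ℕ × List ℕ => p.1.unpair.2 :=
        Computable.snd.comp (Computable.unpair.comp Computable.fst)
      have h3 : Computable fun q : (ℕ × List ℕ) × ℕ × ℕ =>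
          ((Nat.pair q.1.1.unpair.1 (Nat.pair q.2.1 q.2.2), q.1.2) : ℕ × List ℕ) := ?_
      · exact Partrec.nat_rec h2 (hF.comp (h1.pair Computable.snd)) (hH.comp h3).to₂
      refine Computable.pair ?_ (Computable.snd.comp Computable.fst)
      exact Primrec₂.natPair.to_comp.comp (h1.comp Computable.fst)
        (Primrec₂.natPair.to_comp.comp (Computable.fst.comp Computable.snd)
          (Computable.snd.comp Computable.snd))
    · intro x σ τ y hs hy
      exact mR _ _ _ _ _ hs hy
    · intro x y
      change y ∈ (x.unpair.2.rec (f x.unpair.1) fun y IH => IH.bind fun i =>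
          h (Nat.pair x.unpair.1 (Nat.pair y i)) : Part ℕ) ↔
        ∃ n, y ∈ R x.unpair.1 x.unpair.2 (restrict A n)
      generalize x.unpair.1 = a
      generalize x.unpair.2 = n
      induction n generalizing y with
      | zero => exact eF a y
      | succ n ih =>
        simp only [R, Part.mem_bind_iff] at ih ⊢
        simp only [ih, eH]
        constructor
        · rintro ⟨i, ⟨k, hi⟩, m, hm⟩
          exact ⟨max k m, i, mR a n _ _ _ (restrict_prefix A (le_max_left _ _)) hi,
            mH _ _ _ _ (restrict_prefix A (le_max_right _ _)) hm⟩
        · rintro ⟨k, i, hi, hm⟩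
          exact ⟨i, ⟨k, hi⟩, k, hm⟩
  | @rfind f _ ihf =>
    obtain ⟨F, hF, mF, eF⟩ := ihf
    have rf (p : ℕ → Part Bool) (n : ℕ) :
        n ∈ Nat.rfind p ↔ true ∈ p n ∧ ∀ {m : ℕ}, m < n → false ∈ p m := Nat.mem_rfind
    refine ⟨fun p => Nat.rfind fun n => (F (Nat.pair p.1 n, p.2)).map fun m => decide (m = 0),
      ?_, ?_, ?_⟩
    · have h1 : Computable fun q : (ℕ × List ℕ) × ℕ =>
          ((Nat.pair q.1.1 q.2, q.1.2) : ℕ × List ℕ) :=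
        (Primrec₂.natPair.to_comp.comp (Computable.fst.comp Computable.fst)
          Computable.snd).pair (Computable.snd.comp Computable.fst)
      have h2 : Computable₂ fun (_ : (ℕ × List ℕ) × ℕ) (m : ℕ) => decide (m = 0) :=
        ((PrimrecRel.decide Primrec.eq).to_comp.comp Computable.snd (Computable.const 0)).to₂
      exact Partrec.rfind ((hF.comp h1).map h2).to₂
    · intro x σ τ y hs hy
      simp only [rf, Part.mem_map_iff] at hy ⊢
      exact ⟨hy.1.imp fun _ h => ⟨mF _ _ _ _ hs h.1, h.2⟩,
        fun hm => (hy.2 hm).imp fun _ h => ⟨mF _ _ _ _ hs h.1, h.2⟩⟩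
    · intro x y
      simp only [Part.map_eq_map, rf, Part.mem_map_iff, eF]
      constructor
      · rintro ⟨⟨a, ⟨n, ha⟩, h0⟩, hlt⟩
        have key : ∀ k ≤ y, ∃ N, ∀ m < k, ∃ a, a ∈ F (Nat.pair x m, restrict A N) ∧
            decide (a = 0) = false := by
          intro k
          induction k with
          | zero => exact fun _ => ⟨0, fun m hm => absurd hm (Nat.not_lt_zero _)⟩
          | succ k ih =>
            intro hk
            obtain ⟨N, hN⟩ := ih (Nat.le_of_succ_le hk)
            obtain ⟨b, ⟨M, hM⟩, hb⟩ := hlt (Nat.lt_of_succ_le hk)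
            refine ⟨max N M, fun m hm => ?_⟩
            rcases Nat.lt_succ_iff_lt_or_eq.1 hm with hm | rfl
            · obtain ⟨a, ha, h⟩ := hN m hm
              exact ⟨a, mF _ _ _ _ (restrict_prefix A (le_max_left _ _)) ha, h⟩
            · exact ⟨b, mF _ _ _ _ (restrict_prefix A (le_max_right _ _)) hM, hb⟩
        obtain ⟨N, hN⟩ := key y le_rfl
        refine ⟨max N n, ⟨a, mF _ _ _ _ (restrict_prefix A (le_max_right _ _)) ha, h0⟩,
          fun {m} hm => ?_⟩
        obtain ⟨b, hb, h⟩ := hN m hm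
        exact ⟨b, mF _ _ _ _ (restrict_prefix A (le_max_left _ _)) hb, h⟩
      · rintro ⟨n, ⟨a, ha, h0⟩, hlt⟩
        exact ⟨⟨a, ⟨n, ha⟩, h0⟩, fun hm => (hlt hm).imp fun b h => ⟨⟨n, h.1⟩, h.2⟩⟩

/-- The map `n ↦ A↾n` is computable in `A`. -/
theorem recursiveIn_encode_restrict (A : Set ℕ) :
    Nat.RecursiveIn (oracle A) fun n => Part.some (Encodable.encode (restrict A n)) := by
  let app : ℕ → ℕ := fun q =>
    Encodable.encode (((Encodable.decode (α := List ℕ) q.unpair.1).getD []) ++ [q.unpair.2])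
  have happ : Nat.RecursiveIn (oracle A) (app : ℕ →. ℕ) := by
    have : Computable app := by
      refine Computable.encode.comp (Computable.list_append.comp ?_ ?_)
      · exact Computable.option_getD
          (Computable.decode.comp (Computable.fst.comp Computable.unpair)) (Computable.const [])
      · exact Computable.list_cons.comp (Computable.snd.comp Computable.unpair)
          (Computable.const [])
    exact (Partrec.nat_iff.1 this.partrec).recursiveIn
  have hid : Nat.RecursiveIn (oracle A) fun n => Part.some n :=
    (Partrec.nat_iff.1 Computable.id.partrec).recursiveIn
  have ho : Nat.RecursiveIn (oracle A) fun n => Part.some (chi A n) := .oracle _ rfl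
  have hy : Nat.RecursiveIn (oracle A) fun p => Part.some p.unpair.2.unpair.1 :=
    (Partrec.nat_iff.1 (Computable.fst.comp (Computable.unpair.comp
      (Computable.snd.comp Computable.unpair))).partrec).recursiveIn
  have hi : Nat.RecursiveIn (oracle A) fun p => Part.some p.unpair.2.unpair.2 :=
    (Partrec.nat_iff.1 (Computable.snd.comp (Computable.unpair.comp
      (Computable.snd.comp Computable.unpair))).partrec).recursiveIn
  have h0 : Nat.RecursiveIn (oracle A) fun n => Part.some (Encodable.encode ([] : List ℕ)) :=
    (Partrec.nat_iff.1 (Computable.const _).partrec).recursiveIn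
  have hprec := Nat.RecursiveIn.prec h0 (happ.comp (hi.pair (ho.comp hy)))
  have hin := (Nat.RecursiveIn.zero (O := oracle A)).pair hid
  refine (hprec.comp hin).of_eq fun n => ?_
  have hn : (Nat.pair <$> ((fun _ => 0 : ℕ →. ℕ) n) <*> Part.some n : Part ℕ) =
      Part.some (Nat.pair 0 n) := by
    change Nat.pair <$> Part.some 0 <*> Part.some n = _
    simp [Seq.seq]
  rw [hn]
  clear hn hprec hin
  simp only [Part.bind_eq_bind, Part.bind_some, Nat.unpair_pair]
  induction n with
  | zero => rfl
  | succ n ih =>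
    simp only [ih, Part.bind_some]
    have hp : (Nat.pair <$> Part.some (Encodable.encode (restrict A n)) <*>
        Part.some (chi A n) : Part ℕ) =
          Part.some (Nat.pair (Encodable.encode (restrict A n)) (chi A n)) := by
      simp [Seq.seq]
    rw [hp]
    change (Part.some _).bind (fun q => Part.some (app q)) = _
    simp [restrict, List.range_succ, app]

/-- The functionals `Φ_c^A` are exactly the partial functions recursive in `A`. -/
theorem recursiveIn_iff_exists_oracleEval (A : Set ℕ) (f : ℕ →. ℕ) :
    Nat.RecursiveIn (oracle A) f ↔ ∃ c : Code, oracleEval A c = f := by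
  constructor
  · intro hf
    obtain ⟨F, hF, mF, eF⟩ := exists_monotone_of_recursiveIn hf
    have : Nat.Partrec fun q => (Part.ofOption (Encodable.decode (α := List ℕ) q.unpair.2)).bind
        fun σ => F (q.unpair.1, σ) := by
      have h1 : Computable fun q : ℕ × List ℕ => (q.1.unpair.1, q.2) :=
        (Computable.fst.comp (Computable.unpair.comp Computable.fst)).pair Computable.snd
      exact Partrec.nat_iff.1 (Partrec.bind
        (Computable.decode.comp (Computable.snd.comp Computable.unpair)).ofOption
        (hF.comp h1).to₂)
    obtain ⟨c, hc⟩ := Code.exists_code.1 this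
    have hcF : ∀ x σ, Code.eval c (Nat.pair x (Encodable.encode σ)) = F (x, σ) := by
      intro x σ
      rw [hc]
      simp
    refine ⟨c, funext fun x => Part.ext' ?_ ?_⟩
    · rw [oracleEval, Nat.rfindOpt_dom, Part.dom_iff_mem]
      constructor
      · rintro ⟨k, y, hy⟩
        exact ⟨y, (eF x y).2 ⟨_, by rw [← hcF]; exact Code.evaln_sound hy⟩⟩
      · rintro ⟨y, hy⟩
        obtain ⟨n, hn⟩ := (eF x y).1 hy
        rw [← hcF] at hn
        obtain ⟨t, ht⟩ := Code.evaln_complete.1 hn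
        exact ⟨Nat.pair n t, y, by simpa using ht⟩
    · intro h₁ h₂
      obtain ⟨k, hk⟩ := Nat.rfindOpt_spec (Part.get_mem h₁)
      have := Code.evaln_sound hk
      rw [hcF] at this
      exact Part.mem_unique ((eF _ _).2 ⟨_, this⟩) (Part.get_mem h₂)
  · rintro ⟨c, rfl⟩
    let st : ℕ → Option ℕ := fun z => Code.evaln z.unpair.2.unpair.2 c
      (Nat.pair z.unpair.1.unpair.1 z.unpair.1.unpair.2)
    have hst : Computable st := by
      have h1 := Computable.fst.comp Computable.unpair
      have h2 := Computable.snd.comp Computable.unpair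
      exact Code.primrec_evaln.to_comp.comp (((h2.comp h2).pair (Computable.const c)).pair
        (Primrec₂.natPair.to_comp.comp (h1.comp h1) (h2.comp h1)))
    let tst : ℕ → ℕ := fun z => cond (st z).isSome 0 1
    have htst : Nat.RecursiveIn (oracle A) (tst : ℕ →. ℕ) :=
      (Partrec.nat_iff.1 (Computable.cond (Primrec.option_isSome.to_comp.comp hst)
        (Computable.const 0) (Computable.const 1)).partrec).recursiveIn
    have hout : Nat.RecursiveIn (oracle A) fun z => (st z : Part ℕ) :=
      (Partrec.nat_iff.1 hst.ofOption).recursiveIn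
    have p1 : Nat.RecursiveIn (oracle A) fun p => Part.some p.unpair.1 := .left
    have p2 : Nat.RecursiveIn (oracle A) fun p => Part.some p.unpair.2 := .right
    let arg : ℕ → ℕ → ℕ := fun x k =>
      Nat.pair (Nat.pair x (Encodable.encode (restrict A k.unpair.1))) k
    have harg : Nat.RecursiveIn (oracle A) fun p => Part.some (arg p.unpair.1 p.unpair.2) := by
      refine ((p1.pair ((recursiveIn_encode_restrict A).comp (p1.comp p2))).pair p2).of_eq
        fun p => ?_
      simp [Seq.seq, arg]
    have hid : Nat.RecursiveIn (oracle A) fun n => Part.some n :=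
      (Partrec.nat_iff.1 Computable.id.partrec).recursiveIn
    have hr := (htst.comp harg).rfind
    refine ((hout.comp harg).comp (hid.pair hr)).of_eq fun x => ?_
    have hk : (Nat.rfind fun n => (fun m => decide (m = 0)) <$>
        (Part.some (arg (Nat.pair x n).unpair.1 (Nat.pair x n).unpair.2) >>= (tst : ℕ →. ℕ))) =
        Nat.rfind fun k => Part.some (st (arg x k)).isSome := by
      congr 1
      funext k
      change Part.map _ ((Part.some _).bind fun q => Part.some (tst q)) = _
      simp only [Nat.unpair_pair, Part.bind_some, Part.map_some, tst]
      cases (st (arg x k)).isSome <;> rfl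
    rw [hk]
    change ((((Part.some x).map Nat.pair).bind fun g => Part.map g _).bind fun p =>
      (Part.some (arg p.unpair.1 p.unpair.2)).bind fun z => (st z : Part ℕ)) = _
    simp only [Part.map_some, Part.bind_some, Part.bind_map, Nat.unpair_pair]
    simp [oracleEval, Nat.rfindOpt, st, arg]

/-- The jump function `J^A(e) = Φ_e^A(e)`, a universal partial `A`-recursive function. -/
noncomputable def jump (A : Set ℕ) : ℕ →. ℕ := fun e =>
  oracleEval A (Denumerable.ofNat Code e) e

/-- `p` is computably enumerable in `B`: it is the domain of a partial function recursive in `B`. -/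
def REPredIn {α : Type*} [Primcodable α] (B : Set ℕ) (p : α → Prop) : Prop :=
  RecursiveIn (oracle B) fun a => Part.assert (p a) fun _ => Part.some ()

/-! ### Traces -/

/-- A sequence of finite sets that is uniformly computably enumerable in `B`. -/
def IsCETrace (B : Set ℕ) (T : ℕ → Finset ℕ) : Prop :=
  REPredIn B fun p : ℕ × ℕ => p.2 ∈ T p.1

/-- `h`-boundedness of a trace. -/
def IsBoundedBy (T : ℕ → Finset ℕ) (h : ℕ → ℕ) : Prop := ∀ n, (T n).card ≤ h n

/-- `T` traces the partial function `ψ`: `ψ(n) ∈ T n` whenever `ψ(n)` is defined. -/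
def Traces (T : ℕ → Finset ℕ) (ψ : ℕ →. ℕ) : Prop := ∀ n, ∀ y ∈ ψ n, y ∈ T n

/-- Order functions: computable, nondecreasing, unbounded, with positive values. -/
structure IsOrderFunction (h : ℕ → ℕ) : Prop where
  computable : Computable h
  mono : Monotone h
  unbounded : ∀ m, ∃ n, m ≤ h n
  pos : ∀ n, 0 < h n

/-- `A` is jump traceable: `J^A` has a c.e. trace with a computable bound. -/
def JumpTraceable (A : Set ℕ) : Prop :=
  ∃ h : ℕ → ℕ, Computable h ∧
    ∃ T : ℕ → Finset ℕ, IsCETrace ∅ T ∧ IsBoundedBy T h ∧ Traces T (jump A)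

/-- `A ≤_SJR B`: for every order function `h`, `J^A` has a `B`-c.e. `h`-bounded trace. -/
def SJReducible (A B : Set ℕ) : Prop :=
  ∀ h : ℕ → ℕ, IsOrderFunction h →
    ∃ T : ℕ → Finset ℕ, IsCETrace B T ∧ IsBoundedBy T h ∧ Traces T (jump A)

/-! ### Cost functions -/

/-- A (monotone) cost function: a computable function with nonnegative rational values that is
nonincreasing in the first and nondecreasing in the second argument. Computability says that a
numerator and a denominator of the value can be computed. -/
structure IsCostFunction (c : ℕ → ℕ → ℚ) : Prop where
  computable : ∃ p q : ℕ → ℕ → ℕ, Computable₂ p ∧ Computable₂ q ∧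
    ∀ x s, q x s ≠ 0 ∧ c x s = (p x s : ℚ) / (q x s : ℚ)
  anti_left : ∀ x s, c (x + 1) s ≤ c x s
  mono_right : ∀ x s, c x s ≤ c x (s + 1)

/-- `c` is benign: from a rational `ε = p / q > 0` one can compute a bound `b p q` on the length `ℓ`
of any sequence `n₀ < s₀ ≤ n₁ < s₁ ≤ ⋯ ≤ n_{ℓ-1} < s_{ℓ-1}` with `c(nᵢ, sᵢ) ≥ ε` for all `i < ℓ`. -/
def Benign (c : ℕ → ℕ → ℚ) : Prop :=
  ∃ b : ℕ → ℕ → ℕ, Computable₂ b ∧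
    ∀ p q : ℕ, 0 < p → 0 < q → ∀ (ℓ : ℕ) (n s : ℕ → ℕ),
      (∀ i < ℓ, n i < s i ∧ (p : ℚ) / (q : ℚ) ≤ c (n i) (s i)) →
      (∀ i, i + 1 < ℓ → s i ≤ n (i + 1)) →
      ℓ ≤ b p q

/-- The canonical index (strong index) `∑_{x ∈ D} 2^x` of a finite set `D`. -/
def canonicalIndex (D : Finset ℕ) : ℕ := ∑ x ∈ D, 2 ^ x

/-- `(A_s)` is a `B`-computable enumeration (approximation) of `A`: a sequence of finite sets whose
strong indices are computable in `B`, with `A(x) = lim_s A_s(x)` for each `x`. -/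
def IsComputableApprox (B : Set ℕ) (As : ℕ → Finset ℕ) (A : Set ℕ) : Prop :=
  (ComputableIn (oracle B) fun s => canonicalIndex (As s)) ∧
    ∀ x, ∀ᶠ s in Filter.atTop, (x ∈ As s ↔ x ∈ A)

/-- The cost of the change from `A_s` to `A_{s+1}`: it is `c(x, s+1)` for the least `x` with
`A_s(x) ≠ A_{s+1}(x)`, and `0` if there is no such `x`. -/
def changeCost (c : ℕ → ℕ → ℚ) (As : ℕ → Finset ℕ) (s : ℕ) : ℚ :=
  if h : (symmDiff (As s) (As (s + 1))).Nonempty then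
    c ((symmDiff (As s) (As (s + 1))).min' h) (s + 1)
  else 0

/-- `(A_s)` obeys `c`: the total cost of all changes is finite. -/
def ObeysCost (c : ℕ → ℕ → ℚ) (As : ℕ → Finset ℕ) : Prop :=
  Summable fun s => (changeCost c As s : ℝ)

/-- `A ⊨_B c`: some `B`-computable enumeration of `A` obeys `c`. -/
def ObeysRel (A B : Set ℕ) (c : ℕ → ℕ → ℚ) : Prop :=
  ∃ As : ℕ → Finset ℕ, IsComputableApprox B As A ∧ ObeysCost c As

end SJR

/-! A change at `x` costs less than `2^(-k)` once `x` lies beyond the `k`-th marker, and benignity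
bounds computably how often that marker moves. So it suffices to approximate `A`, computably in `B`,
with only polynomially many (in `k`) changes below the `k`-th marker: apart from finitely many
stages and a geometric series, the total cost is then dominated by a series of the form `∑ k^5 /
2^k`.

Tracing `A` directly gives lists, enumerated from `B`, of candidates for the initial segments of `A`
up to the markers (`SJReducible.exists_candidates`); their sizes are computably bounded, but
possibly large. They are thinned out by tests. The strings to be tested depend on `B`; as `B` is
jump traceable, they are covered by a c.e. list of computably bounded length. Every set `S` of
positions in that list yields a greedy antichain. At most one of its members is an initial segment
of `A`, and finding it is a partial `A`-recursive function of `S`, which `A ≤_SJR B` allows to trace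
with only `Nat.pair e k + 1` values. A string is confirmed if the traces for all antichains
containing it have enumerated it. Tested initial segments of `A` are confirmed
(`exists_mem_cand_of_mem_tested`), while confirmed strings that are pairwise incomparable lie in one
such antichain, so there are few of them (`widthLE_cand`), and few places where confirmed strings
split (`WidthLE.card_split_le`).

The levels are linked: the places where confirmed strings of level `k + 1` split are tested again on
level `k`. Hence a false sibling of a long initial segment of `A` that survives on some level is
outdone by the true string on a smaller level (`exists_lt_hasExt`). Guesses are required to outdo
their own siblings in the same way. An infinite descent on levels then shows that the guesses
converge to `A` (`eventually_take_eq`), and since a string can be readopted only with a smaller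
level, changes are rare (`changeStages_finite`). -/

namespace SJR

open Nat.Partrec (Code)

/-! ### Closure properties of computable functions on lists and numbers. -/

section Toolbox
variable {α β σ : Type*} [Primcodable α] [Primcodable β] [Primcodable σ]

/-- Primitive recursion over the positions of the list; after `n` steps the value is the fold over
the first `n` entries. The computability of `flatMap`, `any` and finite sums is reduced to this. -/
theorem computable_foldl {f : α → List β} {g : α → σ} {h : α → σ → β → σ}
    (hf : Computable f) (hg : Computable g)
    (hh : Computable fun p : α × σ × β => h p.1 p.2.1 p.2.2) :
    Computable fun a => (f a).foldl (h a) (g a) := by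
  have key : Computable fun a => (Nat.rec (g a)
      (fun i s => Option.casesOn ((f a)[i]?) s (fun b => h a s b)) (f a).length : σ) := by
    refine Computable.nat_rec (Computable.list_length.comp hf) hg
      (h := fun a p => Option.casesOn ((f a)[p.1]?) p.2 (fun b => h a p.2 b)) ?_
    refine Computable.option_casesOn (o := fun p : α × ℕ × σ => (f p.1)[p.2.1]?)
      (f := fun p => p.2.2) (g := fun p b => h p.1 p.2.2 b) ?_ ?_ ?_
    · exact Computable.list_getElem?.comp (hf.comp Computable.fst)
        (Computable.fst.comp Computable.snd)
    · exact Computable.snd.comp Computable.snd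
    · exact hh.comp ((Computable.fst.comp Computable.fst).pair
        ((Computable.snd.comp (Computable.snd.comp Computable.fst)).pair Computable.snd))
  refine key.of_eq fun a => ?_
  have : ∀ n ≤ (f a).length, (Nat.rec (g a)
      (fun i s => Option.casesOn ((f a)[i]?) s (fun b => h a s b)) n : σ) =
      ((f a).take n).foldl (h a) (g a) := by
    intro n hn
    induction n with
    | zero => simp
    | succ n ih =>
      have hlt : n < (f a).length := hn
      simp only [ih hlt.le, List.getElem?_eq_getElem hlt]
      rw [List.take_succ_eq_append_getElem hlt, List.foldl_append, List.foldl_cons, List.foldl_nil]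
  rw [this _ le_rfl, List.take_length]

theorem computable_flatMap {f : α → List β} {g : α → β → List σ} (hf : Computable f)
    (hg : Computable fun p : α × β => g p.1 p.2) :
    Computable fun a => (f a).flatMap (g a) := by
  refine (computable_foldl (h := fun a (s : List σ) b => s ++ g a b) hf
    (Computable.const []) ?_).of_eq fun a => ?_
  · exact Computable.list_append.comp (Computable.fst.comp Computable.snd)
      (hg.comp (Computable.fst.pair (Computable.snd.comp Computable.snd)))
  · have : ∀ (l : List β) (s : List σ),
        l.foldl (fun s b => s ++ g a b) s = s ++ l.flatMap (g a) := by
      intro l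
      induction l with
      | nil => simp
      | cons b l ih => intro s; simp [ih]
    simp [this]

theorem computable_map {f : α → List β} {g : α → β → σ} (hf : Computable f)
    (hg : Computable fun p : α × β => g p.1 p.2) :
    Computable fun a => (f a).map (g a) := by
  refine (computable_flatMap (g := fun a b => [g a b]) hf
    (Computable.list_cons.comp hg (Computable.const []))).of_eq fun a => ?_
  exact List.flatMap_pure_eq_map (g a) (f a)

theorem computable_filter {f : α → List β} {g : α → β → Bool} (hf : Computable f)
    (hg : Computable fun p : α × β => g p.1 p.2) :
    Computable fun a => (f a).filter (g a) := by
  refine (computable_flatMap (g := fun a b => cond (g a b) [b] []) hf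
    (Computable.cond hg (Computable.list_cons.comp Computable.snd (Computable.const []))
      (Computable.const []))).of_eq fun a => ?_
  induction f a with
  | nil => rfl
  | cons b l ih =>
    simp only [List.flatMap_cons, ih, List.filter_cons]
    cases g a b <;> simp

theorem computable_any {f : α → List β} {g : α → β → Bool} (hf : Computable f)
    (hg : Computable fun p : α × β => g p.1 p.2) :
    Computable fun a => (f a).any (g a) := by
  refine (computable_foldl (h := fun a s b => s || g a b) hf (Computable.const false) ?_).of_eq
    fun a => ?_
  · exact Primrec.or.to_comp.comp (Computable.fst.comp Computable.snd)
      (hg.comp (Computable.fst.pair (Computable.snd.comp Computable.snd)))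
  · have : ∀ (l : List β) (s : Bool), l.foldl (fun s b => s || g a b) s = (s || l.any (g a)) := by
      intro l
      induction l with
      | nil => simp
      | cons b l ih => intro s; simp [ih, Bool.or_assoc]
    simp [this]

theorem computable_all {f : α → List β} {g : α → β → Bool} (hf : Computable f)
    (hg : Computable fun p : α × β => g p.1 p.2) :
    Computable fun a => (f a).all (g a) := by
  refine (Primrec.not.to_comp.comp (computable_any (g := fun a b => !g a b) hf
    (Primrec.not.to_comp.comp hg))).of_eq fun a => ?_
  simp [List.all_eq_not_any_not]

theorem computable_range {f : α → ℕ} (hf : Computable f) : Computable fun a => List.range (f a) :=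
  Primrec.list_range.to_comp.comp hf

theorem computable_sum_range {f : α → ℕ} {g : α → ℕ → ℕ} (hf : Computable f)
    (hg : Computable fun p : α × ℕ => g p.1 p.2) :
    Computable fun a => ∑ i ∈ Finset.range (f a), g a i := by
  refine (computable_foldl (h := fun a s i => s + g a i) (computable_range hf)
    (Computable.const 0) ?_).of_eq fun a => ?_
  · exact Primrec.nat_add.to_comp.comp (Computable.fst.comp Computable.snd)
      (hg.comp (Computable.fst.pair (Computable.snd.comp Computable.snd)))
  · induction f a with
    | zero => simp
    | succ n ih => simp [List.range_succ, List.foldl_append, ih, Finset.sum_range_succ]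

theorem primrec_two_pow : Primrec fun n : ℕ => 2 ^ n := by
  have := Nat.Primrec.pow
  have h : Primrec fun n : ℕ => (Nat.unpaired (fun a b => a ^ b)) (Nat.pair 2 n) :=
    (Primrec.nat_iff.2 this).comp (Primrec₂.natPair.comp (Primrec.const 2) Primrec.id)
  exact h.of_eq fun n => by simp

theorem computable_beq [DecidableEq β] {f g : α → β} (hf : Computable f) (hg : Computable g) :
    Computable fun a => decide (f a = g a) :=
  (PrimrecRel.decide Primrec.eq).to_comp.comp hf hg

theorem computable_decide_le {f g : α → ℕ} (hf : Computable f) (hg : Computable g) :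
    Computable fun a => decide (f a ≤ g a) :=
  (PrimrecRel.decide Primrec.nat_le).to_comp.comp hf hg

theorem computable_decide_lt {f g : α → ℕ} (hf : Computable f) (hg : Computable g) :
    Computable fun a => decide (f a < g a) :=
  (PrimrecRel.decide Primrec.nat_lt).to_comp.comp hf hg

theorem computable_and {f g : α → Bool} (hf : Computable f) (hg : Computable g) :
    Computable fun a => f a && g a := Primrec.and.to_comp.comp hf hg

theorem computable_or {f g : α → Bool} (hf : Computable f) (hg : Computable g) :
    Computable fun a => f a || g a := Primrec.or.to_comp.comp hf hg

theorem computable_not {f : α → Bool} (hf : Computable f) :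
    Computable fun a => !f a := Primrec.not.to_comp.comp hf

theorem computable_take {f : α → ℕ} {g : α → List β} (hf : Computable f) (hg : Computable g) :
    Computable fun a => (g a).take (f a) := Primrec.list_take.to_comp.comp hf hg

theorem computable_natPair {f g : α → ℕ} (hf : Computable f) (hg : Computable g) :
    Computable fun a => Nat.pair (f a) (g a) := Primrec₂.natPair.to_comp.comp hf hg

theorem computable_unpair_fst {f : α → ℕ} (hf : Computable f) :
    Computable fun a => (f a).unpair.1 := Computable.fst.comp (Computable.unpair.comp hf)

theorem computable_unpair_snd {f : α → ℕ} (hf : Computable f) :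
    Computable fun a => (f a).unpair.2 := Computable.snd.comp (Computable.unpair.comp hf)

theorem computable_add {f g : α → ℕ} (hf : Computable f) (hg : Computable g) :
    Computable fun a => f a + g a := Primrec.nat_add.to_comp.comp hf hg

theorem computable_mul {f g : α → ℕ} (hf : Computable f) (hg : Computable g) :
    Computable fun a => f a * g a := Primrec.nat_mul.to_comp.comp hf hg

theorem computable_mem [DecidableEq β] {f : α → β} {g : α → List β}
    [∀ a, Decidable (f a ∈ g a)] (hf : Computable f) (hg : Computable g) :
    Computable fun a => decide (f a ∈ g a) := by
  refine (computable_any (g := fun a b => decide (f a = b)) hg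
    (computable_beq (hf.comp Computable.fst) Computable.snd)).of_eq fun a => ?_
  rw [Bool.eq_iff_iff]
  simp

theorem isPrefix_iff_take (u v : List ℕ) : u <+: v ↔ v.take u.length = u :=
  List.prefix_iff_eq_take.trans eq_comm

theorem computable_isPrefix {f g : α → List ℕ} (hf : Computable f) (hg : Computable g) :
    Computable fun a => decide (f a <+: g a) := by
  refine (computable_beq (computable_take (Computable.list_length.comp hf) hg) hf).of_eq
    fun a => ?_
  simp [isPrefix_iff_take]

end Toolbox

/-! ### Stage approximations, indices and traces of functionals. -/

theorem length_restrict (X : Set ℕ) (m : ℕ) : (restrict X m).length = m := by simp [restrict]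

theorem take_restrict (X : Set ℕ) {m n : ℕ} (h : m ≤ n) :
    (restrict X n).take m = restrict X m := by
  have := restrict_prefix X h
  rw [List.prefix_iff_eq_take, length_restrict] at this
  exact this.symm

/-- Stage approximation to the `e`-th set computably enumerable in an oracle, of which `τ` is an
initial segment. -/
def enumBy (e x : ℕ) (τ : List ℕ) : Bool :=
  (List.range (τ.length + 1)).any fun k =>
    (Code.evaln k.unpair.2 (Denumerable.ofNat Code e)
      (Nat.pair x (Encodable.encode (τ.take k.unpair.1)))).isSome

/-- Run `k` reads only the first `k.unpair.1 ≤ k ≤ τ.length` entries, so a longer string repeats all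
earlier runs unchanged. -/
theorem enumBy_mono {e x : ℕ} {τ τ' : List ℕ} (h : τ <+: τ') (hU : enumBy e x τ = true) :
    enumBy e x τ' = true := by
  simp only [enumBy, List.any_eq_true, List.mem_range] at hU ⊢
  obtain ⟨k, hk, hs⟩ := hU
  refine ⟨k, by have := h.length_le; omega, ?_⟩
  have h1 : k.unpair.1 ≤ τ.length := (Nat.unpair_left_le k).trans (by omega)
  obtain ⟨ρ, rfl⟩ := h
  rwa [List.take_append_of_le_length h1]

theorem enumBy_restrict_mono {e x : ℕ} {X : Set ℕ} {m n : ℕ} (h : m ≤ n)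
    (hU : enumBy e x (restrict X m) = true) : enumBy e x (restrict X n) = true :=
  enumBy_mono (restrict_prefix X h) hU

/-- Convergence becomes a union of decidable stages, the length of the oracle segment serving also
as the bound on the runs. -/
theorem oracleEval_dom_iff (X : Set ℕ) (c : Code) (x : ℕ) :
    (oracleEval X c x).Dom ↔ ∃ m, enumBy (Encodable.encode c) x (restrict X m) = true := by
  rw [oracleEval, Nat.rfindOpt_dom]
  simp only [enumBy, List.any_eq_true, List.mem_range, length_restrict, Denumerable.ofNat_encode]
  constructor
  · rintro ⟨k, a, ha⟩
    refine ⟨k, k, by omega, ?_⟩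
    rw [take_restrict X (Nat.unpair_left_le k), Option.mem_def.1 ha]
    rfl
  · rintro ⟨m, k, hk, hs⟩
    rw [take_restrict X ((Nat.unpair_left_le k).trans (by omega))] at hs
    obtain ⟨a, ha⟩ := Option.isSome_iff_exists.1 hs
    exact ⟨k, a, ha⟩

theorem computable_enumBy : Computable fun p : ℕ × ℕ × List ℕ => enumBy p.1 p.2.1 p.2.2 := by
  refine computable_any (f := fun p : ℕ × ℕ × List ℕ => List.range (p.2.2.length + 1))
    (g := fun p k => (Code.evaln k.unpair.2 (Denumerable.ofNat Code p.1)
      (Nat.pair p.2.1 (Encodable.encode (p.2.2.take k.unpair.1)))).isSome) ?_ ?_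
  · exact computable_range (Computable.succ.comp
      (Computable.list_length.comp (Computable.snd.comp Computable.snd)))
  · have h1 : Computable fun p : (ℕ × ℕ × List ℕ) × ℕ => Denumerable.ofNat Code p.1.1 :=
      (Computable.ofNat Code).comp (Computable.fst.comp Computable.fst)
    have h2 : Computable fun p : (ℕ × ℕ × List ℕ) × ℕ =>
        Nat.pair p.1.2.1 (Encodable.encode (p.1.2.2.take p.2.unpair.1)) :=
      computable_natPair (Computable.fst.comp (Computable.snd.comp Computable.fst))
        (Computable.encode.comp (computable_take (computable_unpair_fst Computable.snd)
          (Computable.snd.comp (Computable.snd.comp Computable.fst))))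
    have h3 : Computable fun p : (ℕ × ℕ × List ℕ) × ℕ => p.2.unpair.2 :=
      computable_unpair_snd Computable.snd
    have h4 := Code.primrec_evaln.to_comp.comp ((h3.pair h1).pair h2)
    exact Primrec.option_isSome.to_comp.comp h4

theorem computable_enumBy' {α : Type*} [Primcodable α] {e x : α → ℕ} {τ : α → List ℕ}
    (he : Computable e) (hx : Computable x) (hτ : Computable τ) :
    Computable fun a => enumBy (e a) (x a) (τ a) :=
  computable_enumBy.comp (he.pair (hx.pair hτ))

theorem exists_code_of_computable {F : ℕ → List ℕ → Option ℕ}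
    (hF : Computable fun p : ℕ × List ℕ => F p.1 p.2) :
    ∃ c : Code, ∀ x τ, Code.eval c (Nat.pair x (Encodable.encode τ)) = (F x τ : Part ℕ) := by
  have : Nat.Partrec fun q =>
      ((F q.unpair.1 (Denumerable.ofNat (List ℕ) q.unpair.2) : Option ℕ) : Part ℕ) := by
    have h1 : Computable fun q : ℕ => (q.unpair.1, Denumerable.ofNat (List ℕ) q.unpair.2) :=
      (computable_unpair_fst Computable.id).pair
        ((Computable.ofNat (List ℕ)).comp (computable_unpair_snd Computable.id))
    exact Partrec.nat_iff.1 (Computable.ofOption (hF.comp h1))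
  obtain ⟨c, hc⟩ := Code.exists_code.1 this
  exact ⟨c, fun x τ => by rw [hc]; simp⟩

theorem mem_oracleEval {X : Set ℕ} {c : Code} {x y : ℕ} (h : y ∈ oracleEval X c x) :
    ∃ m, y ∈ Code.eval c (Nat.pair x (Encodable.encode (restrict X m))) := by
  obtain ⟨k, hk⟩ := Nat.rfindOpt_spec h
  exact ⟨_, Code.evaln_sound hk⟩

theorem oracleEval_dom_of_mem {X : Set ℕ} {c : Code} {x y m : ℕ}
    (h : y ∈ Code.eval c (Nat.pair x (Encodable.encode (restrict X m)))) :
    (oracleEval X c x).Dom := by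
  obtain ⟨t, ht⟩ := Code.evaln_complete.1 h
  exact Nat.rfindOpt_dom.2 ⟨Nat.pair m t, y, by simpa using ht⟩

/-- An index of every set computably enumerable in an oracle. -/
theorem exists_index_of_REPredIn {X : Set ℕ} {p : ℕ × ℕ → Prop} (h : REPredIn X p) :
    ∃ e, ∀ n y, p (n, y) ↔ ∃ m, enumBy e (Nat.pair n y) (restrict X m) = true := by
  obtain ⟨c, hc⟩ := (recursiveIn_iff_exists_oracleEval X _).1 h
  refine ⟨Encodable.encode c, fun n y => ?_⟩
  rw [← oracleEval_dom_iff, hc]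
  have : (Encodable.decode (α := ℕ × ℕ) (Nat.pair n y)) = some (n, y) := by
    rw [← Encodable.encode_nat n, ← Encodable.encode_nat y, ← Encodable.encode_prod_val]
    exact Encodable.encodek _
  change _ ↔ Part.Dom (Part.bind (Encodable.decode (α := ℕ × ℕ) (Nat.pair n y) : Part (ℕ × ℕ)) _)
  rw [this]
  simp [Part.assert]

/-- The index works for all oracles. The test `q` need not be monotone, since the dovetailed search
tries every initial segment. -/
theorem exists_index_of_computable {q : ℕ → List ℕ → Bool}
    (hq : Computable fun p : ℕ × List ℕ => q p.1 p.2) :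
    ∃ e, ∀ (X : Set ℕ) x, (∃ m, q x (restrict X m) = true) ↔
      ∃ m, enumBy e x (restrict X m) = true := by
  obtain ⟨c, hc⟩ := exists_code_of_computable
    (F := fun x τ => cond (q x τ) (some 0) none)
    (Computable.cond hq (Computable.const _) (Computable.const _))
  refine ⟨Encodable.encode c, fun X x => ?_⟩
  rw [← oracleEval_dom_iff]
  constructor
  · rintro ⟨m, hm⟩
    refine oracleEval_dom_of_mem (y := 0) (m := m) ?_
    rw [hc, hm]
    simp
  · intro h
    obtain ⟨m, hm⟩ := mem_oracleEval (Part.get_mem h)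
    refine ⟨m, ?_⟩
    rw [hc] at hm
    cases hq : q x (restrict X m)
    · simp [hq] at hm
    · rfl

/-- The program `d` with its first argument fixed to be `x`, as an argument of the jump function. -/
def jumpIndex (d x : ℕ) : ℕ :=
  Encodable.encode ((Code.curry (Denumerable.ofNat Code d) x).comp Code.right)

theorem computable_jumpIndex : Computable₂ jumpIndex := by
  refine Computable.encode.comp (Primrec.to_comp ?_)
  exact Code.primrec₂_comp.comp (Code.primrec₂_curry.comp
    ((Primrec.ofNat Code).comp Primrec.fst) Primrec.snd) (Primrec.const Code.right)

/-- The jump feeds a program its own index `w`. Composition with `Code.right` discards it, and the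
`x` stored in the program takes its place. -/
theorem eval_jumpIndex (c : Code) (x w z : ℕ) :
    Code.eval (Denumerable.ofNat Code (jumpIndex (Encodable.encode c) x)) (Nat.pair w z) =
      Code.eval c (Nat.pair x z) := by
  simp only [jumpIndex, Denumerable.ofNat_encode, Code.eval]
  refine (Part.bind_some _ _).trans ((Code.eval_curry _ _ _).trans ?_)
  simp only [Nat.unpair_pair]

/-- Different initial segments may give `F` different values. The trace catches the value found
first by the dovetailing, which need not be `y₀`; hence only some stage with a traced value is
promised. -/
theorem Traces.of_computable {X : Set ℕ} {T : ℕ → Finset ℕ} (hT : Traces T (jump X))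
    {F : ℕ → List ℕ → Option ℕ} {c : Code}
    (hc : ∀ x τ, Code.eval c (Nat.pair x (Encodable.encode τ)) = (F x τ : Part ℕ)) {x m₀ y₀ : ℕ}
    (h : F x (restrict X m₀) = some y₀) :
    ∃ m y, F x (restrict X m) = some y ∧ y ∈ T (jumpIndex (Encodable.encode c) x) := by
  have hd : (jump X (jumpIndex (Encodable.encode c) x)).Dom := by
    refine oracleEval_dom_of_mem (y := y₀) (m := m₀) ?_
    rw [eval_jumpIndex, hc, h]
    simp
  obtain ⟨m, hm⟩ := mem_oracleEval (Part.get_mem hd)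
  rw [eval_jumpIndex, hc] at hm
  exact ⟨m, _, by simpa using hm, hT _ _ (Part.get_mem hd)⟩

/-- The order function inverts a strictly increasing computable majorant `G'` of `G`: up to the
summand `1`, it counts the `n` with `G' n < y`. -/
theorem exists_orderFunction {G : ℕ → ℕ} (hG : Computable G) :
    ∃ h, IsOrderFunction h ∧ ∀ n y, y ≤ G n → h y ≤ n + 1 := by
  let G' : ℕ → ℕ := fun n => ∑ i ∈ Finset.range (n + 1), (G i + 1)
  have hG' : Computable G' := computable_sum_range Computable.succ
    (Computable.succ.comp (hG.comp Computable.snd))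
  have mG' : StrictMono G' := strictMono_nat_of_lt_succ fun n => by
    simp only [G']
    rw [Finset.sum_range_succ _ (n + 1)]
    omega
  have leG' : ∀ n, G n < G' n := fun n => by
    simp only [G']
    rw [Finset.sum_range_succ]
    omega
  let h : ℕ → ℕ := fun y => ((List.range y).filter fun n => decide (G' n < y)).length + 1
  have hle : ∀ n y, y ≤ G' n → h y ≤ n + 1 := by
    intro n y hy
    simp only [h, Nat.add_le_add_iff_right]
    calc ((List.range y).filter fun i => decide (G' i < y)).length
        ≤ (List.range n).length := by
          refine List.Subperm.length_le (List.subperm_of_subset (List.nodup_range.filter _) ?_)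
          intro i hi
          simp only [List.mem_filter, List.mem_range, decide_eq_true_eq] at hi ⊢
          exact mG'.lt_iff_lt.1 (hi.2.trans_le hy)
      _ = n := List.length_range
  refine ⟨h, ⟨?_, ?_, ?_, fun n => Nat.succ_pos _⟩, fun n y hy => hle n y (hy.trans (leG' n).le)⟩
  · refine Computable.succ.comp (Computable.list_length.comp
      (computable_filter (computable_range Computable.id) ?_))
    exact computable_decide_lt (hG'.comp Computable.snd) Computable.fst
  · intro a b hab
    simp only [h, Nat.add_le_add_iff_right]
    refine List.Subperm.length_le (List.subperm_of_subset (List.nodup_range.filter _) ?_)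
    intro i hi
    simp only [List.mem_filter, List.mem_range, decide_eq_true_eq] at hi ⊢
    exact ⟨hi.1.trans_le hab, hi.2.trans_le hab⟩
  · intro m
    refine ⟨G' m + 1, ?_⟩
    simp only [h]
    refine Nat.le_succ_of_le ?_
    calc m = (List.range m).length := List.length_range.symm
      _ ≤ _ := by
        refine List.Subperm.length_le (List.subperm_of_subset List.nodup_range ?_)
        intro i hi
        simp only [List.mem_filter, List.mem_range, decide_eq_true_eq] at hi ⊢
        have := mG' hi
        have := mG'.id_le i
        simp only [id] at this
        omega

/-- Every functional on `A` has a `B`-c.e. trace with prescribed slowly growing bounds. -/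
theorem SJReducible.exists_trace {A B : Set ℕ} (h : SJReducible A B) {G : ℕ → ℕ}
    (hG : Computable G) {F : ℕ → List ℕ → Option ℕ}
    (hF : Computable fun p : ℕ × List ℕ => F p.1 p.2) :
    ∃ (e : ℕ) (T : ℕ → Finset ℕ),
      (∀ x y, y ∈ T x ↔ ∃ m, enumBy e (Nat.pair x y) (restrict B m) = true) ∧
      (∀ n x, x ≤ G n → (T x).card ≤ n + 1) ∧
      ∀ x m₀ y₀, F x (restrict A m₀) = some y₀ →
        ∃ m y, F x (restrict A m) = some y ∧ y ∈ T x := by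
  obtain ⟨c, hc⟩ := exists_code_of_computable hF
  set p : ℕ → ℕ := jumpIndex (Encodable.encode c) with hp
  have cp : Computable p := computable_jumpIndex.comp (Computable.const _) Computable.id
  -- The trace is evaluated at the jump arguments `p x`, so the order function has to be slow with
  -- respect to these; the sum bounds `p x` for all `x ≤ G n`.
  obtain ⟨o, ho, ho'⟩ := exists_orderFunction
    (G := fun n => ∑ x ∈ Finset.range (G n + 1), p x)
    (computable_sum_range (Computable.succ.comp hG) (cp.comp Computable.snd))
  obtain ⟨T, hT, bT, tT⟩ := h o ho
  obtain ⟨e₀, he₀⟩ := exists_index_of_REPredIn hT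
  obtain ⟨e, he⟩ := exists_index_of_computable
    (q := fun z τ => enumBy e₀ (Nat.pair (p z.unpair.1) z.unpair.2) τ)
    (computable_enumBy' (Computable.const _)
      (computable_natPair (cp.comp (computable_unpair_fst Computable.fst))
        (computable_unpair_snd Computable.fst)) Computable.snd)
  refine ⟨e, fun x => T (p x), fun x y => ?_, fun n x hx => ?_, fun x m₀ y₀ hy => ?_⟩
  · rw [← he]
    simp only [Nat.unpair_pair]
    exact he₀ (p x) y
  · exact (bT _).trans (ho' n _ (Finset.single_le_sum (f := p) (fun _ _ => Nat.zero_le _)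
      (Finset.mem_range.2 (Nat.lt_succ_of_le hx))))
  · exact tT.of_computable hc hy

/-- Every functional on `B` has a c.e. trace with computable bounds, uniformly in its index. -/
theorem JumpTraceable.exists_trace {B : Set ℕ} (h : JumpTraceable B) :
    ∃ (g : ℕ → ℕ → ℕ) (Q : ℕ → ℕ → ℕ → ℕ → Bool) (V : ℕ → ℕ → Finset ℕ), Computable₂ g ∧
      (Computable fun p : ℕ × ℕ × ℕ × ℕ => Q p.1 p.2.1 p.2.2.1 p.2.2.2) ∧
      (∀ d x y, y ∈ V d x ↔ ∃ m, Q d x y m = true) ∧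
      (∀ d x y m n, m ≤ n → Q d x y m = true → Q d x y n = true) ∧
      (∀ d x, (V d x).card ≤ g d x) ∧
      ∀ F : ℕ → List ℕ → Option ℕ, (Computable fun p : ℕ × List ℕ => F p.1 p.2) →
        ∃ d, ∀ x m₀ y₀, F x (restrict B m₀) = some y₀ →
          ∃ m y, F x (restrict B m) = some y ∧ y ∈ V d x := by
  obtain ⟨o, ho, T, hT, bT, tT⟩ := h
  obtain ⟨e, he⟩ := exists_index_of_REPredIn hT
  -- Initial segments of the empty oracle are strings of zeros, so the stages of a trace that is
  -- c.e. in `∅` are computable.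
  have h0 : Computable fun m : ℕ => (List.range m).map fun _ => (0 : ℕ) :=
    computable_map (computable_range Computable.id) (Computable.const 0)
  have h0' : ∀ m, restrict ∅ m = (List.range m).map fun _ => (0 : ℕ) := fun m => by
    exact List.map_congr_left fun x _ => by simp [chi]
  refine ⟨fun d x => o (jumpIndex d x),
    fun d x y m => enumBy e (Nat.pair (jumpIndex d x) y) ((List.range m).map fun _ => 0),
    fun d x => T (jumpIndex d x), ho.comp computable_jumpIndex, ?_, fun d x y => ?_,
    fun d x y m n hmn hm => ?_, fun d x => bT _, fun F hF => ?_⟩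
  · exact computable_enumBy' (Computable.const e)
      (computable_natPair (computable_jumpIndex.comp Computable.fst
        (Computable.fst.comp Computable.snd))
        (Computable.fst.comp (Computable.snd.comp Computable.snd)))
      (h0.comp (Computable.snd.comp (Computable.snd.comp Computable.snd)))
  · rw [he]
    simp only [h0']
  · simp only [← h0'] at hm ⊢
    exact enumBy_restrict_mono hmn hm
  · obtain ⟨c, hc⟩ := exists_code_of_computable hF
    exact ⟨Encodable.encode c, fun x m₀ y₀ hy => tT.of_computable hc hy⟩

/-- A total function is computable in `B` if it is given by a computable function of initial
segments of `B`. -/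
theorem computableIn_of_computable {B : Set ℕ} {f : ℕ → ℕ} {F : ℕ → List ℕ → Option ℕ}
    (hF : Computable fun p : ℕ × List ℕ => F p.1 p.2)
    (h₁ : ∀ s m y, F s (restrict B m) = some y → y = f s)
    (h₂ : ∀ s, ∃ m, F s (restrict B m) = some (f s)) : ComputableIn (oracle B) f := by
  obtain ⟨c, hc⟩ := exists_code_of_computable hF
  refine RecursiveIn.iff_nat.2 ((recursiveIn_iff_exists_oracleEval B _).2 ⟨c, funext fun s => ?_⟩)
  obtain ⟨m, hm⟩ := h₂ s
  have hd : (oracleEval B c s).Dom := oracleEval_dom_of_mem (y := f s) (m := m) (by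
    rw [hc, hm]; simp)
  obtain ⟨m', hm'⟩ := mem_oracleEval (Part.get_mem hd)
  rw [hc] at hm'
  have := h₁ s m' _ (by simpa using hm')
  rw [Part.eq_some_iff, ← this]
  exact Part.get_mem hd

/-! ### Enumerations without repetition -/

section Enumeration
variable {β : Type*} [DecidableEq β]

/-- Append `y` to `L` unless it is a member already. -/
def appendNew (L : List β) (y : β) : List β := if y ∈ L then L else L ++ [y]

/-- The members of `f 0`, …, `f (n - 1)`, in order of appearance and without repetition. -/
def enumList (f : ℕ → List β) : ℕ → List β
  | 0 => []
  | n + 1 => (f n).foldl appendNew (enumList f n)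

theorem prefix_appendNew (L : List β) (y : β) : L <+: appendNew L y := by
  unfold appendNew
  split_ifs
  exacts [List.prefix_rfl, List.prefix_append _ _]

theorem mem_appendNew {L : List β} {x y : β} : x ∈ appendNew L y ↔ x ∈ L ∨ x = y := by
  unfold appendNew
  split_ifs with h
  · exact ⟨Or.inl, fun h' => h'.elim id fun e => e ▸ h⟩
  · simp

theorem nodup_appendNew {L : List β} {y : β} (h : L.Nodup) : (appendNew L y).Nodup := by
  unfold appendNew
  split_ifs with hy
  · exact h
  · rw [List.nodup_append]
    refine ⟨h, List.nodup_singleton _, ?_⟩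
    rintro a ha b hb rfl
    exact hy (List.mem_singleton.1 hb ▸ ha)

theorem prefix_foldl_appendNew (l L : List β) : L <+: l.foldl appendNew L := by
  induction l generalizing L with
  | nil => exact List.prefix_rfl
  | cons y l ih => exact (prefix_appendNew L y).trans (ih _)

theorem mem_foldl_appendNew {l L : List β} {x : β} :
    x ∈ l.foldl appendNew L ↔ x ∈ L ∨ x ∈ l := by
  induction l generalizing L with
  | nil => simp
  | cons y l ih => simp [ih, mem_appendNew, or_assoc]

theorem nodup_foldl_appendNew {l L : List β} (h : L.Nodup) : (l.foldl appendNew L).Nodup := by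
  induction l generalizing L with
  | nil => exact h
  | cons y l ih => exact ih (nodup_appendNew h)

/-- A position, once filled, never changes. This makes "the `i`-th member" a single-valued
functional that can be traced. -/
theorem enumList_prefix (f : ℕ → List β) {m n : ℕ} (h : m ≤ n) :
    enumList f m <+: enumList f n := by
  induction n, h using Nat.le_induction with
  | base => exact List.prefix_rfl
  | succ n _ ih => exact ih.trans (prefix_foldl_appendNew _ _)

theorem mem_enumList {f : ℕ → List β} {n : ℕ} {x : β} :
    x ∈ enumList f n ↔ ∃ m < n, x ∈ f m := by
  induction n with
  | zero => simp [enumList]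
  | succ n ih =>
    rw [enumList, mem_foldl_appendNew, ih]
    constructor
    · rintro (⟨m, hm, h⟩ | h)
      exacts [⟨m, by omega, h⟩, ⟨n, by omega, h⟩]
    · rintro ⟨m, hm, h⟩
      rcases Nat.lt_succ_iff_lt_or_eq.1 hm with hm | rfl
      exacts [Or.inl ⟨m, hm, h⟩, Or.inr h]

theorem nodup_enumList (f : ℕ → List β) (n : ℕ) : (enumList f n).Nodup := by
  induction n with
  | zero => exact List.nodup_nil
  | succ n ih => exact nodup_foldl_appendNew ih

theorem enumList_congr {f g : ℕ → List β} {n : ℕ} (h : ∀ m < n, f m = g m) :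
    enumList f n = enumList g n := by
  induction n with
  | zero => rfl
  | succ n ih => rw [enumList, enumList, h n (by omega), ih fun m hm => h m (by omega)]

theorem computable_enumList {α : Type*} [Primcodable α] [Primcodable β] {f : α → ℕ → List β}
    {n : α → ℕ} (hf : Computable fun p : α × ℕ => f p.1 p.2) (hn : Computable n) :
    Computable fun a => enumList (f a) (n a) := by
  have h1 : Computable fun p : List β × List β => p.1.foldl appendNew p.2 := by
    refine computable_foldl (h := fun _ L y => appendNew L y) Computable.fst Computable.snd ?_
    refine (Computable.cond (computable_mem (Computable.snd.comp Computable.snd)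
      (Computable.fst.comp Computable.snd)) (Computable.fst.comp Computable.snd)
      (Computable.list_concat.comp (Computable.fst.comp Computable.snd)
        (Computable.snd.comp Computable.snd))).of_eq fun a => ?_
    simp [appendNew, cond_eq_ite]
  have h2 : Computable fun p : α × ℕ × List β => (f p.1 p.2.1).foldl appendNew p.2.2 :=
    h1.comp ((hf.comp (Computable.fst.pair (Computable.fst.comp Computable.snd))).pair
      (Computable.snd.comp Computable.snd))
  refine (Computable.nat_rec hn (Computable.const []) h2.to₂).of_eq fun a => ?_
  induction n a with
  | zero => rfl
  | succ n ih => simp only [enumList, ih]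

end Enumeration

/-! ### Strings -/

/-- `u` and `v` are distinct immediate successors of the same string. -/
def Sibling (u v : List ℕ) : Prop := u.length = v.length ∧ u.dropLast = v.dropLast ∧ u ≠ v

instance : DecidableRel Sibling := fun u v => by unfold Sibling; infer_instance

theorem Sibling.symm {u v : List ℕ} (h : Sibling u v) : Sibling v u :=
  ⟨h.1.symm, h.2.1.symm, h.2.2.symm⟩

/-- Some member of `C` extends `u`. -/
def HasExt (C : Set (List ℕ)) (u : List ℕ) : Prop := ∃ x ∈ C, u <+: x

/-- Every antichain contained in `C` has at most `w` elements. -/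
def WidthLE (C : Set (List ℕ)) (w : ℕ) : Prop :=
  ∀ W : Finset (List ℕ), (∀ x ∈ W, x ∈ C) → (∀ x ∈ W, ∀ y ∈ W, x <+: y → x = y) → W.card ≤ w

theorem prefix_dropLast_of_lt {u v : List ℕ} (h : u <+: v) (hl : u.length < v.length) :
    u <+: v.dropLast := by
  refine List.prefix_of_prefix_length_le h (List.dropLast_prefix v) ?_
  rw [List.length_dropLast]
  omega

/-- If the pair `u'`, `v'` were the deeper one, then `u` would be a prefix of the common parent of
`u'` and `v'`, hence of `y`, and would coincide with `v`. By symmetry, two strings diverge at only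
one length. -/
theorem Sibling.length_le {u v u' v' x y : List ℕ} (h : Sibling u v) (h' : Sibling u' v')
    (hu' : u' <+: x) (hv' : v' <+: y) (hu : u <+: x) (hv : v <+: y) : u'.length ≤ u.length := by
  by_contra hlt
  push Not at hlt
  have h1 : u <+: u' := List.prefix_of_prefix_length_le hu hu' hlt.le
  have h2 : u <+: v' := by
    have := prefix_dropLast_of_lt h1 hlt
    rw [h'.2.1] at this
    exact this.trans (List.dropLast_prefix _)
  exact h.2.2 ((List.prefix_of_prefix_length_le (h2.trans hv') hv h.1.le).eq_of_length h.1)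

theorem exists_maximal_ext {C : Set (List ℕ)} (hC : C.Finite) {x : List ℕ} (hx : x ∈ C) :
    ∃ y ∈ C, x <+: y ∧ ∀ z ∈ C, y <+: z → y = z := by
  obtain ⟨y, hy, hmax⟩ := Set.exists_max_image {z ∈ C | x <+: z} List.length
    (hC.subset fun _ h => h.1) ⟨x, hx, List.prefix_rfl⟩
  refine ⟨y, hy.1, hy.2, fun z hz hyz => hyz.eq_of_length (le_antisymm hyz.length_le ?_)⟩
  exact hmax z ⟨hz, hy.2.trans hyz⟩

/-- A finite set of strings has few places where it splits. -/
theorem WidthLE.card_split_le {C : Set (List ℕ)} {w : ℕ} (hw : WidthLE C w) (hC : C.Finite)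
    (W : Finset (List ℕ)) (hW : ∀ u ∈ W, HasExt C u ∧ ∃ v, Sibling u v ∧ HasExt C v) :
    W.card ≤ w * w := by
  classical
  -- The maximal members of `C` form an antichain, so there are at most `w` of them, and every
  -- member of `C` lies below one of them.
  let M : Finset (List ℕ) := hC.toFinset.filter fun y => ∀ z ∈ C, y <+: z → y = z
  have hM : M.card ≤ w := by
    refine hw M (fun x hx => ?_) fun x hx y hy hxy => ?_
    · simpa using (Finset.mem_filter.1 hx).1
    · exact (Finset.mem_filter.1 hx).2 y (by simpa using (Finset.mem_filter.1 hy).1) hxy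
  have ex : ∀ u, HasExt C u → ∃ y ∈ M, u <+: y := by
    rintro u ⟨x, hx, hux⟩
    obtain ⟨y, hy, hxy, hm⟩ := exists_maximal_ext hC hx
    exact ⟨y, Finset.mem_filter.2 ⟨by simpa using hy, hm⟩, hux.trans hxy⟩
  have ch : ∀ u : List ℕ, ∃ p : List ℕ × List ℕ, u ∈ W →
      p.1 ∈ M ∧ p.2 ∈ M ∧ u <+: p.1 ∧ ∃ v, Sibling u v ∧ v <+: p.2 := by
    intro u
    by_cases hu : u ∈ W
    · obtain ⟨h1, v, hv, h2⟩ := hW u hu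
      obtain ⟨x, hx, hux⟩ := ex u h1
      obtain ⟨y, hy, hvy⟩ := ex v h2
      exact ⟨(x, y), fun _ => ⟨hx, hy, hux, v, hv, hvy⟩⟩
    · exact ⟨([], []), fun h => absurd h hu⟩
  choose p hp using ch
  -- The string `u` is sent to a maximal extension of itself together with one of a sibling. Such a
  -- pair diverges at only one place, which determines `u`.
  calc W.card ≤ (M ×ˢ M).card := by
        refine Finset.card_le_card_of_injOn p (fun u hu => ?_) fun u hu u' hu' hpp => ?_
        · exact Finset.mem_coe.2 (Finset.mem_product.2 ⟨(hp u hu).1, (hp u hu).2.1⟩)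
        · obtain ⟨-, -, h1, v, hv, h2⟩ := hp u hu
          obtain ⟨-, -, h1', v', hv', h2'⟩ := hp u' hu'
          rw [← hpp] at h1' h2'
          exact (List.prefix_of_prefix_length_le h1 h1'
            (hv'.length_le hv h1 h2 h1' h2')).eq_of_length
            (le_antisymm (hv'.length_le hv h1 h2 h1' h2') (hv.length_le hv' h1' h2' h1 h2))
    _ ≤ w * w := by
        rw [Finset.card_product]
        exact Nat.mul_le_mul hM hM

/-- The initial segments of `x` that have a sibling which is an initial segment of `y`. -/
def splitsOf (x y : List ℕ) : List (List ℕ) :=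
  ((List.range (x.length + 1)).filter fun n => decide (Sibling (x.take n) (y.take n))).map
    fun n => x.take n

/-- The strings `u` such that `u` and one of its siblings have extensions in `C`. -/
def splits (C : List (List ℕ)) : List (List ℕ) :=
  C.flatMap fun x => C.flatMap fun y => splitsOf x y

theorem mem_splits {C : List (List ℕ)} {u : List ℕ} :
    u ∈ splits C ↔ HasExt {x | x ∈ C} u ∧ ∃ v, Sibling u v ∧ HasExt {x | x ∈ C} v := by
  simp only [splits, splitsOf, List.mem_flatMap, List.mem_map, List.mem_filter, List.mem_range,
    decide_eq_true_eq]
  constructor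
  · rintro ⟨x, hx, y, hy, n, ⟨-, hs⟩, rfl⟩
    exact ⟨⟨x, hx, List.take_prefix _ _⟩, _, hs, y, hy, List.take_prefix _ _⟩
  · rintro ⟨⟨x, hx, hux⟩, v, hs, y, hy, hvy⟩
    have h1 := (isPrefix_iff_take _ _).1 hux
    have h2 := (isPrefix_iff_take _ _).1 hvy
    rw [← hs.1] at h2
    exact ⟨x, hx, y, hy, u.length, ⟨by have := hux.length_le; omega, by rwa [h1, h2]⟩, h1⟩

theorem computable_dropLast {α : Type*} [Primcodable α] {f : α → List ℕ} (hf : Computable f) :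
    Computable fun a => (f a).dropLast :=
  (computable_take (Computable.pred.comp (Computable.list_length.comp hf)) hf).of_eq fun a => by
    rw [List.dropLast_eq_take]; rfl

theorem computable_sibling {α : Type*} [Primcodable α] {f g : α → List ℕ} (hf : Computable f)
    (hg : Computable g) : Computable fun a => decide (Sibling (f a) (g a)) := by
  refine (computable_and (computable_and
    (computable_beq (Computable.list_length.comp hf) (Computable.list_length.comp hg))
    (computable_beq (computable_dropLast hf) (computable_dropLast hg)))
    (computable_not (computable_beq hf hg))).of_eq fun a => ?_
  rw [Bool.eq_iff_iff]
  simp only [Bool.and_eq_true, Bool.not_eq_true', decide_eq_true_eq, decide_eq_false_iff_not,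
    Sibling, and_assoc, ne_eq]
  exact decide_eq_true_iff.symm

theorem computable_splitsOf {α : Type*} [Primcodable α] {f g : α → List ℕ} (hf : Computable f)
    (hg : Computable g) : Computable fun a => splitsOf (f a) (g a) := by
  have h1 : Computable fun p : α × ℕ => (f p.1).take p.2 :=
    computable_take Computable.snd (hf.comp Computable.fst)
  have h2 : Computable fun p : α × ℕ => decide (Sibling ((f p.1).take p.2) ((g p.1).take p.2)) :=
    computable_sibling h1 (computable_take Computable.snd (hg.comp Computable.fst))
  have h3 : Computable fun a => List.range ((f a).length + 1) :=
    computable_range (Computable.succ.comp (Computable.list_length.comp hf))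
  exact computable_map (computable_filter (g := fun a n =>
    decide (Sibling ((f a).take n) ((g a).take n))) h3 h2) h1

theorem computable_splits {α : Type*} [Primcodable α] {f : α → List (List ℕ)}
    (hf : Computable f) : Computable fun a => splits (f a) := by
  have h0 : Computable fun p : α × List ℕ => f p.1 := hf.comp Computable.fst
  have h1 : Computable fun p : (α × List ℕ) × List ℕ => splitsOf p.1.2 p.2 :=
    computable_splitsOf (Computable.snd.comp Computable.fst) Computable.snd
  have h2 : Computable fun p : α × List ℕ => (f p.1).flatMap fun y => splitsOf p.2 y :=
    computable_flatMap (f := fun p : α × List ℕ => f p.1) (g := fun p y => splitsOf p.2 y) h0 h1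
  exact computable_flatMap (f := f) (g := fun a x => (f a).flatMap fun y => splitsOf x y) hf h2

/-! ### Greedy antichains -/

/-- One step in the computation of `antichain`. -/
def antichainStep (s : ℕ × List (List ℕ)) (v : List ℕ) : ℕ × List (List ℕ) :=
  (s.1 / 2, if s.1 % 2 = 1 ∧ ∀ x ∈ s.2, ¬ x <+: v ∧ ¬ v <+: x then s.2 ++ [v] else s.2)

/-- The antichain obtained from `l` by selecting greedily among those members whose positions are
given by the binary expansion of `S`. -/
def antichain (S : ℕ) (l : List (List ℕ)) : List (List ℕ) := (l.foldl antichainStep (S, [])).2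

theorem antichainStep_prefix (s : ℕ × List (List ℕ)) (v : List ℕ) :
    s.2 <+: (antichainStep s v).2 := by
  unfold antichainStep
  split_ifs
  exacts [List.prefix_append _ _, List.prefix_rfl]

theorem foldl_antichainStep_prefix (l : List (List ℕ)) (s : ℕ × List (List ℕ)) :
    s.2 <+: (l.foldl antichainStep s).2 := by
  induction l generalizing s with
  | nil => exact List.prefix_rfl
  | cons v l ih => exact (antichainStep_prefix s v).trans (ih _)

theorem mem_foldl_antichainStep {l : List (List ℕ)} {s : ℕ × List (List ℕ)} {x : List ℕ}
    (h : x ∈ (l.foldl antichainStep s).2) : x ∈ s.2 ∨ x ∈ l := by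
  induction l generalizing s with
  | nil => exact Or.inl h
  | cons v l ih =>
    rcases ih h with h | h
    · unfold antichainStep at h
      split_ifs at h
      · rcases List.mem_append.1 h with h | h
        · exact Or.inl h
        · exact Or.inr (List.mem_cons.2 (Or.inl (List.mem_singleton.1 h)))
      · exact Or.inl h
    · exact Or.inr (List.mem_cons_of_mem _ h)

theorem antichain_isAntichain {S : ℕ} {l : List (List ℕ)} {x y : List ℕ}
    (hx : x ∈ antichain S l) (hy : y ∈ antichain S l) (h : x <+: y) : x = y := by
  have key : ∀ (l : List (List ℕ)) (s : ℕ × List (List ℕ)),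
      (∀ x ∈ s.2, ∀ y ∈ s.2, x <+: y → x = y) →
      ∀ x ∈ (l.foldl antichainStep s).2, ∀ y ∈ (l.foldl antichainStep s).2, x <+: y → x = y := by
    intro l
    induction l with
    | nil => exact fun s h => h
    | cons v l ih =>
      intro s hs
      refine ih _ ?_
      unfold antichainStep
      split_ifs with hc
      · intro x hx y hy hxy
        simp only [List.mem_append, List.mem_singleton] at hx hy
        rcases hx with hx | rfl <;> rcases hy with hy | rfl
        · exact hs x hx y hy hxy
        · exact absurd hxy (hc.2 x hx).1
        · exact absurd hxy (hc.2 y hy).2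
        · rfl
      · exact hs
  exact key l (S, []) (by simp) x hx y hy h

theorem antichain_append_prefix (S : ℕ) {l l' : List (List ℕ)} (h : l <+: l') :
    antichain S l <+: antichain S l' := by
  obtain ⟨r, rfl⟩ := h
  rw [antichain, antichain, List.foldl_append]
  exact foldl_antichainStep_prefix _ _

/-- The selection of `x` is decided when `x` is processed; as the list has no repetitions, later
entries cannot bring it in. -/
theorem mem_antichain_of_prefix {S : ℕ} {l l' : List (List ℕ)} (h : l <+: l') (hn : l'.Nodup)
    {x : List ℕ} (hx : x ∈ l) (hx' : x ∈ antichain S l') : x ∈ antichain S l := by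
  obtain ⟨r, rfl⟩ := h
  rw [antichain, List.foldl_append] at hx'
  refine (mem_foldl_antichainStep hx').resolve_right fun hr => ?_
  exact (List.nodup_append.1 hn).2.2 x hx x hr rfl

/-- The binary digits of `S` mark exactly the members of `l` that satisfy `C`. As these are pairwise
incomparable, the greedy rule rejects none of them. -/
theorem exists_antichain (l : List (List ℕ)) {C : List ℕ → Prop}
    (hC : ∀ x y, C x → C y → x <+: y → x = y) (hl : l.Nodup) :
    ∃ S < 2 ^ l.length, ∀ x ∈ l, C x → x ∈ antichain S l := by
  classical
  have key : ∀ (l acc : List (List ℕ)), l.Nodup → (∀ x ∈ acc, C x ∧ x ∉ l) →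
      ∃ S < 2 ^ l.length, ∀ x ∈ l, C x → x ∈ (l.foldl antichainStep (S, acc)).2 := by
    intro l
    induction l with
    | nil => exact fun _ _ _ => ⟨0, by simp, by simp⟩
    | cons v l ih =>
      intro acc hn hacc
      rw [List.nodup_cons] at hn
      by_cases hv : C v
      · obtain ⟨S, hS, h⟩ := ih (acc ++ [v]) hn.2 (by
          intro x hx
          rcases List.mem_append.1 hx with hx | hx
          · exact ⟨(hacc x hx).1, fun h => (hacc x hx).2 (List.mem_cons_of_mem _ h)⟩
          · rw [List.mem_singleton.1 hx]
            exact ⟨hv, hn.1⟩)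
        have hstep : antichainStep (2 * S + 1, acc) v = (S, acc ++ [v]) := by
          unfold antichainStep
          rw [if_pos]
          · simp only [Prod.mk.injEq, and_true]
            omega
          · refine ⟨by simp, fun x hx => ⟨fun hp => ?_, fun hp => ?_⟩⟩
            · exact (hacc x hx).2 (hC _ _ (hacc x hx).1 hv hp ▸ List.mem_cons_self)
            · exact (hacc x hx).2 (hC _ _ hv (hacc x hx).1 hp ▸ List.mem_cons_self)
        refine ⟨2 * S + 1, by rw [List.length_cons, pow_succ]; omega, fun x hx hCx => ?_⟩
        rw [List.foldl_cons, hstep]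
        rcases List.mem_cons.1 hx with rfl | hx
        · exact (foldl_antichainStep_prefix l (S, acc ++ [x])).subset (by simp)
        · exact h x hx hCx
      · obtain ⟨S, hS, h⟩ := ih acc hn.2 fun x hx =>
          ⟨(hacc x hx).1, fun h => (hacc x hx).2 (List.mem_cons_of_mem _ h)⟩
        have hstep : antichainStep (2 * S, acc) v = (S, acc) := by
          unfold antichainStep
          rw [if_neg (by simp)]
          simp
        refine ⟨2 * S, by rw [List.length_cons, pow_succ]; omega, fun x hx hCx => ?_⟩
        rw [List.foldl_cons, hstep]
        rcases List.mem_cons.1 hx with rfl | hx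
        · exact absurd hCx hv
        · exact h x hx hCx
  exact key l [] hl (by simp)

theorem computable_antichain {α : Type*} [Primcodable α] {f : α → ℕ} {g : α → List (List ℕ)}
    (hf : Computable f) (hg : Computable g) : Computable fun a => antichain (f a) (g a) := by
  have hs : Computable fun p : (ℕ × List (List ℕ)) × List ℕ => p.1.1 :=
    Computable.fst.comp Computable.fst
  have ha : Computable fun p : (ℕ × List (List ℕ)) × List ℕ => p.1.2 :=
    Computable.snd.comp Computable.fst
  have hv : Computable fun p : (ℕ × List (List ℕ)) × List ℕ => p.2 := Computable.snd
  have h1 : Computable fun p : (ℕ × List (List ℕ)) × List ℕ => p.1.1 / 2 :=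
    Primrec.nat_div.to_comp.comp hs (Computable.const 2)
  have h2 : Computable fun p : (ℕ × List (List ℕ)) × List ℕ => decide (p.1.1 % 2 = 1) :=
    computable_beq (Primrec.nat_mod.to_comp.comp hs (Computable.const 2)) (Computable.const 1)
  have h3 : Computable fun p : (ℕ × List (List ℕ)) × List ℕ =>
      p.1.2.all fun x => !decide (x <+: p.2) && !decide (p.2 <+: x) :=
    computable_all ha (computable_and
      (computable_not (computable_isPrefix Computable.snd (hv.comp Computable.fst)))
      (computable_not (computable_isPrefix (hv.comp Computable.fst) Computable.snd)))
  have h4 : Computable fun p : (ℕ × List (List ℕ)) × List ℕ => antichainStep p.1 p.2 := by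
    refine (Computable.pair h1 (Computable.cond (computable_and h2 h3)
      (Computable.list_concat.comp ha hv) ha)).of_eq fun p => ?_
    simp only [antichainStep, cond_eq_ite, Bool.and_eq_true, decide_eq_true_eq, List.all_eq_true,
      Bool.not_eq_true', decide_eq_false_iff_not]
  have h5 : Computable fun a => (g a).foldl antichainStep (f a, []) :=
    computable_foldl (h := fun _ s v => antichainStep s v) hg
      (hf.pair (Computable.const [])) (h4.comp Computable.snd)
  exact Computable.snd.comp h5

/-! ### Markers -/

section Markers
variable {c : ℕ → ℕ → ℚ} {b : ℕ → ℕ → ℕ}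

open Classical in
/-- A number `x` such that `c(x, s + 1) < 2 ^ (-k)`, which changes rarely as `s` grows. Here `b` is
a bound as in the definition of benign cost functions. -/
noncomputable def marker (c : ℕ → ℕ → ℚ) (b : ℕ → ℕ → ℕ) (k : ℕ) : ℕ → ℕ
  | 0 => k + 1 + b 1 (2 ^ k)
  | s + 1 => if c (marker c b k s) (s + 2) < ((1 : ℕ) : ℚ) / ((2 ^ k : ℕ) : ℚ) then marker c b k s
      -- The summand `s + 2` separates consecutive failures of the marker, so that they form a
      -- sequence as in the definition of benign; the summand `b 1 (2 ^ k)` makes the cost at the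
      -- new marker small, by `IsBenignBound.lt`.
      else marker c b k s + s + 2 + b 1 (2 ^ k)

theorem IsCostFunction.antitone (hc : IsCostFunction c) (s : ℕ) : Antitone fun x => c x s :=
  antitone_nat_of_succ_le fun x => hc.anti_left x s

theorem IsCostFunction.monotone (hc : IsCostFunction c) (x : ℕ) : Monotone (c x) :=
  monotone_nat_of_le_succ fun s => hc.mono_right x s

/-- `b` is a bound as in the definition of benign cost functions. -/
def IsBenignBound (c : ℕ → ℕ → ℚ) (b : ℕ → ℕ → ℕ) : Prop :=
  ∀ p q : ℕ, 0 < p → 0 < q → ∀ (ℓ : ℕ) (n s : ℕ → ℕ),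
    (∀ i < ℓ, n i < s i ∧ (p : ℚ) / (q : ℚ) ≤ c (n i) (s i)) →
    (∀ i, i + 1 < ℓ → s i ≤ n (i + 1)) → ℓ ≤ b p q

/-- Otherwise, by monotonicity of the cost, all pairs `(y + i, y + i + 1)` with `i ≤ b 1 (2 ^ k)`
cost at least `2^(-k)`, which is one pair more than benignity permits. -/
theorem IsBenignBound.lt (hb : IsBenignBound c b) (hc : IsCostFunction c) (k : ℕ) {x y t : ℕ}
    (hx : y + b 1 (2 ^ k) ≤ x) (ht : t ≤ y + 1) :
    c x t < ((1 : ℕ) : ℚ) / ((2 ^ k : ℕ) : ℚ) := by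
  by_contra hlt
  push Not at hlt
  have := hb 1 (2 ^ k) one_pos (pow_pos two_pos k) (b 1 (2 ^ k) + 1) (fun i => y + i)
    (fun i => y + i + 1) (fun i hi => ⟨by omega, hlt.trans ?_⟩) (fun i _ => by omega)
  · omega
  · calc c x t ≤ c (y + i) t := hc.antitone t (by omega)
      _ ≤ c (y + i) (y + i + 1) := hc.monotone _ (by omega)

theorem cost_marker_lt (hb : IsBenignBound c b) (hc : IsCostFunction c) (k s : ℕ) :
    c (marker c b k s) (s + 1) < ((1 : ℕ) : ℚ) / ((2 ^ k : ℕ) : ℚ) := by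
  cases s with
  | zero => exact hb.lt hc k le_rfl (by omega)
  | succ s =>
    rw [marker]
    split_ifs with h
    · exact h
    · exact hb.lt hc k le_rfl (by omega)

theorem cost_lt_of_marker_le (hb : IsBenignBound c b) (hc : IsCostFunction c) {k s x : ℕ}
    (hx : marker c b k s ≤ x) : c x (s + 1) < 1 / 2 ^ k := by
  have := (hc.antitone (s + 1) hx).trans_lt (cost_marker_lt hb hc k s)
  simpa using this

theorem monotone_marker (c : ℕ → ℕ → ℚ) (b : ℕ → ℕ → ℕ) (k : ℕ) : Monotone (marker c b k) := by
  refine monotone_nat_of_le_succ fun s => ?_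
  rw [marker]
  split_ifs <;> omega

theorem le_marker (c : ℕ → ℕ → ℚ) (b : ℕ → ℕ → ℕ) (k s : ℕ) : k ≤ marker c b k s := by
  refine le_trans ?_ (monotone_marker c b k (Nat.zero_le s))
  rw [marker]
  omega

/-- A marker `x` that moves at step `s` contributes the pair `(x, x + s + 2)` to a sequence as in
the definition of benign. The third clause of the invariant lets the sequence be prolonged; the
initial value accounts for the summand `1`. -/
theorem length_enumList_marker_le (hb : IsBenignBound c b) (hc : IsCostFunction c) (k s : ℕ) :
    (enumList (fun s => [marker c b k s]) s).length ≤ b 1 (2 ^ k) + 1 := by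
  have key : ∀ s, ∃ (ℓ : ℕ) (n t : ℕ → ℕ),
      (∀ i < ℓ, n i < t i ∧ ((1 : ℕ) : ℚ) / ((2 ^ k : ℕ) : ℚ) ≤ c (n i) (t i)) ∧
      (∀ i, i + 1 < ℓ → t i ≤ n (i + 1)) ∧ (∀ i, i + 1 = ℓ → t i ≤ marker c b k s) ∧
      (enumList (fun s => [marker c b k s]) (s + 1)).length ≤ ℓ + 1 := by
    intro s
    induction s with
    | zero => exact ⟨0, id, id, by simp, by simp, by simp, by simp [enumList, appendNew]⟩
    | succ s ih =>
      obtain ⟨ℓ, n, t, h1, h2, h3, h4⟩ := ih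
      by_cases h : c (marker c b k s) (s + 2) < ((1 : ℕ) : ℚ) / ((2 ^ k : ℕ) : ℚ)
      · have he : marker c b k (s + 1) = marker c b k s := by rw [marker, if_pos h]
        refine ⟨ℓ, n, t, h1, h2, by rwa [he], ?_⟩
        have : enumList (fun s => [marker c b k s]) (s + 1 + 1) =
            enumList (fun s => [marker c b k s]) (s + 1) := by
          rw [enumList, List.foldl_cons, List.foldl_nil, appendNew, if_pos]
          rw [mem_enumList]
          exact ⟨s, by omega, by simp [he]⟩
        rwa [this]
      · have he : marker c b k (s + 1) = marker c b k s + s + 2 + b 1 (2 ^ k) := by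
          rw [marker, if_neg h]
        push Not at h
        refine ⟨ℓ + 1, fun i => if i < ℓ then n i else marker c b k s,
          fun i => if i < ℓ then t i else marker c b k s + s + 2, ?_, ?_, ?_, ?_⟩
        · intro i hi
          by_cases hi' : i < ℓ
          · simpa only [if_pos hi'] using h1 i hi'
          · simp only [if_neg hi']
            exact ⟨by omega, h.trans (hc.monotone _ (by omega))⟩
        · intro i hi
          have hi' : i < ℓ := by omega
          simp only [if_pos hi']
          by_cases hi2 : i + 1 < ℓ
          · simpa only [if_pos hi2] using h2 i hi2
          · simp only [if_neg hi2]
            exact h3 i (by omega)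
        · intro i hi
          have hi' : ¬ i < ℓ := by omega
          simp only [if_neg hi', he]
          omega
        · rw [enumList, List.foldl_cons, List.foldl_nil, appendNew]
          split_ifs
          · omega
          · rw [List.length_append, List.length_singleton]
            omega
  obtain ⟨ℓ, n, t, h1, h2, -, h4⟩ := key s
  have := hb 1 (2 ^ k) one_pos (pow_pos two_pos k) ℓ n t h1 h2
  have := (enumList_prefix (fun s => [marker c b k s]) (show s ≤ s + 1 by omega)).length_le
  omega

theorem computable_marker (hc : IsCostFunction c) (hb : Computable₂ b) :
    Computable₂ (marker c b) := by
  obtain ⟨p, q, hp, hq, hpq⟩ := hc.computable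
  have hB : Computable fun k : ℕ => b 1 (2 ^ k) :=
    hb.comp (Computable.const 1) primrec_two_pow.to_comp
  have h0 : Computable fun a : ℕ × ℕ => a.1 + 1 + b 1 (2 ^ a.1) :=
    computable_add (Computable.succ.comp Computable.fst) (hB.comp Computable.fst)
  have hk : Computable fun a : (ℕ × ℕ) × ℕ × ℕ => a.1.1 := Computable.fst.comp Computable.fst
  have hs : Computable fun a : (ℕ × ℕ) × ℕ × ℕ => a.2.1 := Computable.fst.comp Computable.snd
  have hl : Computable fun a : (ℕ × ℕ) × ℕ × ℕ => a.2.2 := Computable.snd.comp Computable.snd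
  have hs2 : Computable fun a : (ℕ × ℕ) × ℕ × ℕ => a.2.1 + 2 :=
    Computable.succ.comp (Computable.succ.comp hs)
  -- This is `p / q < 1 / 2 ^ k` with denominators cleared.
  have h1 : Computable fun a : (ℕ × ℕ) × ℕ × ℕ =>
      decide (p a.2.2 (a.2.1 + 2) * 2 ^ a.1.1 < q a.2.2 (a.2.1 + 2)) :=
    computable_decide_lt (computable_mul (hp.comp hl hs2) (primrec_two_pow.to_comp.comp hk))
      (hq.comp hl hs2)
  have h2 : Computable fun a : (ℕ × ℕ) × ℕ × ℕ => a.2.2 + a.2.1 + 2 + b 1 (2 ^ a.1.1) :=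
    computable_add (Computable.succ.comp (Computable.succ.comp (computable_add hl hs)))
      (hB.comp hk)
  have h3 := (Computable.cond h1 hl h2).to₂
  refine (Computable.nat_rec Computable.snd h0 h3).of_eq fun a => ?_
  obtain ⟨k, s⟩ := a
  simp only
  induction s with
  | zero => rfl
  | succ s ih =>
    simp only [ih]
    simp only [marker, cond_eq_ite, decide_eq_true_eq]
    have hq0 : (0 : ℚ) < (q (marker c b k s) (s + 2) : ℚ) :=
      Nat.cast_pos.2 (Nat.pos_of_ne_zero (hpq _ _).1)
    congr 1
    rw [(hpq _ _).2, div_lt_div_iff₀ hq0 (by positivity), eq_iff_iff, Nat.cast_one, one_mul]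
    exact_mod_cast Iff.rfl

end Markers

/-! ### Basic candidates for the initial segments of `A` up to the markers. -/

/-- Lists, computable in `B`, of candidates for the initial segments of `A` whose lengths are
enumerated by the functions `l k`. -/
theorem SJReducible.exists_candidates {A B : Set ℕ} (h : SJReducible A B) {l : ℕ → ℕ → ℕ}
    (hl : Computable₂ l) {N : ℕ → ℕ} (hN : Computable N)
    (hlN : ∀ k s, (enumList (fun s => [l k s]) s).length ≤ N k) :
    ∃ (P : ℕ → List ℕ → List (List ℕ)) (b : ℕ → ℕ),
      (Computable fun p : ℕ × List ℕ => P p.1 p.2) ∧ Computable b ∧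
      (∀ k m n, m ≤ n → P k (restrict B m) ⊆ P k (restrict B n)) ∧
      (∀ k m, (P k (restrict B m)).toFinset.card ≤ b k) ∧
      (∀ k s, ∃ m, restrict A (l k s) ∈ P k (restrict B m)) ∧
      ∀ k m, ∀ x ∈ P k (restrict B m), ∃ s, x.length = l k s := by
  have cE {α : Type} [Primcodable α] {f g : α → ℕ} (hf : Computable f) (hg : Computable g) :
      Computable fun a => enumList (fun s => [l (f a) s]) (g a) :=
    computable_enumList (Computable.list_cons.comp
      (hl.comp (hf.comp Computable.fst) Computable.snd) (Computable.const [])) hg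
  -- On input `⟨k, i⟩`, the initial segment of `A` whose length is the `i`-th distinct value of `l
  -- k`. Indexing by `i` instead of `s` leaves only `N k` inputs on level `k`.
  let F : ℕ → List ℕ → Option ℕ := fun x τ =>
    (enumList (fun s => [l x.unpair.1 s]) τ.length)[x.unpair.2]?.bind fun m =>
      cond (decide (m ≤ τ.length)) (some (Encodable.encode (τ.take m))) none
  have hF : Computable fun p : ℕ × List ℕ => F p.1 p.2 := by
    have h1 : Computable fun p : ℕ × List ℕ =>
        (enumList (fun s => [l p.1.unpair.1 s]) p.2.length)[p.1.unpair.2]? :=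
      Computable.list_getElem?.comp (cE (computable_unpair_fst Computable.fst)
        (Computable.list_length.comp Computable.snd)) (computable_unpair_snd Computable.fst)
    have h2 : Computable fun p : (ℕ × List ℕ) × ℕ => p.1.2 := Computable.snd.comp Computable.fst
    have h3 : Computable fun p : (ℕ × List ℕ) × ℕ => cond (decide (p.2 ≤ p.1.2.length))
        (some (Encodable.encode (p.1.2.take p.2))) none :=
      Computable.cond (computable_decide_le Computable.snd (Computable.list_length.comp h2))
        (Computable.option_some.comp (Computable.encode.comp (computable_take Computable.snd h2)))
        (Computable.const none)
    exact Computable.option_bind h1 h3.to₂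
  -- Slow growth is not needed here; any computable bound on the trace would do.
  obtain ⟨e, T, hT, bT, tT⟩ := h.exists_trace (G := id) Computable.id hF
  -- Traced strings are kept only if their length is a value of the marker. Then a basic candidate
  -- always has an initial segment of `A` of the same length as its rival.
  let P : ℕ → List ℕ → List (List ℕ) := fun k τ => (List.range (N k)).flatMap fun i =>
    ((List.range (τ.length + 1)).filter fun y =>
      enumBy e (Nat.pair (Nat.pair k i) y) τ &&
        decide ((Denumerable.ofNat (List ℕ) y).length ∈
          enumList (fun s => [l k s]) τ.length)).map (Denumerable.ofNat (List ℕ))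
  have memP : ∀ k m x, x ∈ P k (restrict B m) ↔ ∃ i < N k, Encodable.encode x ≤ m ∧
      enumBy e (Nat.pair (Nat.pair k i) (Encodable.encode x)) (restrict B m) = true ∧
      ∃ s < m, x.length = l k s := by
    intro k m x
    simp only [P, List.mem_flatMap, List.mem_map, List.mem_filter, List.mem_range,
      length_restrict, Bool.and_eq_true, decide_eq_true_eq, mem_enumList, List.mem_singleton]
    constructor
    · rintro ⟨i, hi, y, ⟨hy, hU, s, hs, hl⟩, rfl⟩
      exact ⟨i, hi, by simpa using Nat.lt_succ_iff.1 hy, by simpa using hU, s, hs, hl⟩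
    · rintro ⟨i, hi, hy, hU, s, hs, hl⟩
      exact ⟨i, hi, Encodable.encode x, ⟨Nat.lt_succ_iff.2 hy, hU, s, hs, by simpa using hl⟩,
        by simp⟩
  refine ⟨P, fun k => ∑ i ∈ Finset.range (N k), (Nat.pair k i + 1), ?_, ?_, ?_, ?_, ?_, ?_⟩
  · have h1 : Computable fun p : ((ℕ × List ℕ) × ℕ) × ℕ => p.1.1.1 :=
      Computable.fst.comp (Computable.fst.comp Computable.fst)
    have h2 : Computable fun p : ((ℕ × List ℕ) × ℕ) × ℕ => p.1.1.2 :=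
      Computable.snd.comp (Computable.fst.comp Computable.fst)
    have h3 : Computable fun p : ((ℕ × List ℕ) × ℕ) × ℕ => p.1.2 :=
      Computable.snd.comp Computable.fst
    have h4 : Computable fun p : ((ℕ × List ℕ) × ℕ) × ℕ => p.2 := Computable.snd
    have h5 : Computable fun p : ((ℕ × List ℕ) × ℕ) × ℕ => Denumerable.ofNat (List ℕ) p.2 :=
      (Computable.ofNat (List ℕ)).comp h4
    have h6 : Computable fun p : ((ℕ × List ℕ) × ℕ) × ℕ =>
        enumBy e (Nat.pair (Nat.pair p.1.1.1 p.1.2) p.2) p.1.1.2 &&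
          decide ((Denumerable.ofNat (List ℕ) p.2).length ∈
            enumList (fun s => [l p.1.1.1 s]) p.1.1.2.length) :=
      computable_and (computable_enumBy' (Computable.const e)
        (computable_natPair (computable_natPair h1 h3) h4) h2)
        (computable_mem (Computable.list_length.comp h5) (cE h1 (Computable.list_length.comp h2)))
    have h7 : Computable fun p : (ℕ × List ℕ) × ℕ => List.range (p.1.2.length + 1) :=
      computable_range (Computable.succ.comp
        (Computable.list_length.comp (Computable.snd.comp Computable.fst)))
    have h8 := computable_filter (g := fun (p : (ℕ × List ℕ) × ℕ) y =>
        enumBy e (Nat.pair (Nat.pair p.1.1 p.2) y) p.1.2 &&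
          decide ((Denumerable.ofNat (List ℕ) y).length ∈
            enumList (fun s => [l p.1.1 s]) p.1.2.length)) h7 h6
    have h9 := computable_map (g := fun (_ : (ℕ × List ℕ) × ℕ) y => Denumerable.ofNat (List ℕ) y)
      h8 h5
    have h10 : Computable fun p : ℕ × List ℕ => List.range (N p.1) :=
      computable_range (hN.comp Computable.fst)
    exact computable_flatMap (g := fun (p : ℕ × List ℕ) i =>
      ((List.range (p.2.length + 1)).filter fun y =>
      enumBy e (Nat.pair (Nat.pair p.1 i) y) p.2 &&
        decide ((Denumerable.ofNat (List ℕ) y).length ∈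
          enumList (fun s => [l p.1 s]) p.2.length)).map (Denumerable.ofNat (List ℕ))) h10 h9
  · exact computable_sum_range hN (Computable.succ.comp (computable_natPair Computable.fst
      Computable.snd))
  · intro k m n hmn x hx
    rw [memP] at hx ⊢
    obtain ⟨i, hi, hy, hU, s, hs, hl⟩ := hx
    exact ⟨i, hi, hy.trans hmn, enumBy_restrict_mono hmn hU, s, hs.trans_le hmn, hl⟩
  · intro k m
    calc (P k (restrict B m)).toFinset.card
        ≤ (((Finset.range (N k)).biUnion fun i => T (Nat.pair k i)).image
            (Denumerable.ofNat (List ℕ))).card := by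
          refine Finset.card_le_card fun x hx => ?_
          rw [List.mem_toFinset, memP] at hx
          obtain ⟨i, hi, -, hU, -⟩ := hx
          refine Finset.mem_image.2 ⟨Encodable.encode x, Finset.mem_biUnion.2
            ⟨i, Finset.mem_range.2 hi, (hT _ _).2 ⟨m, hU⟩⟩, by simp⟩
      _ ≤ _ := Finset.card_image_le
      _ ≤ _ := Finset.card_biUnion_le
      _ ≤ _ := Finset.sum_le_sum fun i _ => bT _ _ le_rfl
  · intro k s
    have hmem : l k s ∈ enumList (fun s => [l k s]) (s + 1) :=
      mem_enumList.2 ⟨s, Nat.lt_succ_self s, by simp⟩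
    obtain ⟨i, hi, hi'⟩ := List.mem_iff_getElem.1 hmem
    have hget : ∀ m, i < (enumList (fun s => [l k s]) m).length →
        (enumList (fun s => [l k s]) m)[i]? = some (l k s) := by
      intro m hm
      rcases le_total m (s + 1) with h | h
      · obtain ⟨r, hr⟩ := enumList_prefix (fun s => [l k s]) h
        rw [← hi', ← List.getElem?_eq_getElem hi, ← hr, List.getElem?_append_left hm]
      · obtain ⟨r, hr⟩ := enumList_prefix (fun s => [l k s]) h
        rw [← hr, List.getElem?_append_left hi, List.getElem?_eq_getElem hi, hi']
    -- All values of `F` on this input agree, so the traced one is the intended string.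
    have hFv : ∀ m y, F (Nat.pair k i) (restrict A m) = some y →
        y = Encodable.encode (restrict A (l k s)) := by
      intro m y hy
      simp only [F, Nat.unpair_pair, length_restrict] at hy
      rw [Option.bind_eq_some_iff] at hy
      obtain ⟨v, hv, hy⟩ := hy
      have hm : i < (enumList (fun s => [l k s]) m).length := (List.getElem?_eq_some_iff.1 hv).1
      rw [hget m hm, Option.some.injEq] at hv
      subst hv
      by_cases hle : l k s ≤ m
      · simpa [hle, take_restrict A hle, eq_comm] using hy
      · simp [hle] at hy
    have hF0 : F (Nat.pair k i) (restrict A (max (s + 1) (l k s))) =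
        some (Encodable.encode (restrict A (l k s))) := by
      simp only [F, Nat.unpair_pair, length_restrict]
      rw [hget _ (hi.trans_le (enumList_prefix _ (le_max_left _ _)).length_le)]
      simp [take_restrict A (le_max_right (s + 1) (l k s))]
    obtain ⟨m, y, hy, hyT⟩ := tT _ _ _ hF0
    rw [hFv m y hy] at hyT
    obtain ⟨m', hm'⟩ := (hT _ _).1 hyT
    refine ⟨max m' (max (s + 1) (Encodable.encode (restrict A (l k s)))), (memP _ _ _).2
      ⟨i, hi.trans_le (hlN k (s + 1)), ?_, enumBy_restrict_mono (le_max_left _ _) hm', s, ?_,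
        length_restrict _ _⟩⟩
    · exact (le_max_right _ _).trans (le_max_right _ _)
    · exact (Nat.lt_succ_self s).trans_le ((le_max_left _ _).trans (le_max_right _ _))
  · intro k m x hx
    obtain ⟨-, -, -, -, s, -, hs⟩ := (memP _ _ _).1 hx
    exact ⟨s, hs⟩

/-! ### Guessing along a system of candidates -/

theorem HasExt.mono {C C' : Set (List ℕ)} (h : C ⊆ C') {u : List ℕ} (hu : HasExt C u) :
    HasExt C' u := hu.imp fun _ h' => ⟨h h'.1, h'.2⟩

theorem HasExt.of_prefix {C : Set (List ℕ)} {u v : List ℕ} (hv : HasExt C v) (h : u <+: v) :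
    HasExt C u := hv.imp fun _ h' => ⟨h'.1, h.trans h'.2⟩

/-- An increasing system of finite sets `C k t` of candidates for initial segments of `A` of length
`l k s`, such that a string that is not an initial segment of `A` and longer than `L` is always
outdone, on a smaller level, by its sibling if that is an initial segment of `A`. -/
structure CandidateSystem (A : Set ℕ) (l : ℕ → ℕ → ℕ) (C : ℕ → ℕ → Set (List ℕ)) (w : ℕ → ℕ)
    (L : ℕ) : Prop where
  mono : ∀ k, Monotone (C k)
  finite : ∀ k, (⋃ t, C k t).Finite
  width : ∀ k, WidthLE (⋃ t, C k t) (w k)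
  mem : ∀ k s, ∃ t, restrict A (l k s) ∈ C k t
  split : ∀ m, L < m → ∀ v, Sibling (restrict A m) v → ∀ k, HasExt (⋃ t, C k t) v →
    ∃ j < k, HasExt (⋃ t, C j t) (restrict A m)

/-- A string that is a suitable guess for an initial segment of `A` at stage `s`, judging from the
candidates known at stage `t`. -/
structure GoodGuess (A : Set ℕ) (l : ℕ → ℕ → ℕ) (C : ℕ → ℕ → Set (List ℕ)) (L s t : ℕ)
    (α : List ℕ) : Prop where
  start : restrict A L <+: α
  le_length : s ≤ α.length
  candidate : ∀ k ≤ s, l k s ≤ α.length ∧ α.take (l k s) ∈ C k t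
  split : ∀ n ≤ α.length, L < n → ∀ k ≤ s, ∀ v, Sibling (α.take n) v → HasExt (C k t) v →
    ∃ j < k, HasExt (C j t) (α.take n)

theorem hasExt_iUnion {C : ℕ → Set (List ℕ)} {u : List ℕ} :
    HasExt (⋃ t, C t) u ↔ ∃ t, HasExt (C t) u := by
  simp only [HasExt, Set.mem_iUnion]
  constructor
  · rintro ⟨x, ⟨t, h⟩, h'⟩
    exact ⟨t, x, h, h'⟩
  · rintro ⟨t, x, h, h'⟩
    exact ⟨x, ⟨t, h⟩, h'⟩

section Guess
variable {A : Set ℕ} {l : ℕ → ℕ → ℕ} {C : ℕ → ℕ → Set (List ℕ)} {w : ℕ → ℕ} {L : ℕ}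

theorem CandidateSystem.exists_stage (h : CandidateSystem A l C w L) (n s : ℕ) :
    ∃ t, (∀ k ≤ s, restrict A (l k s) ∈ C k t) ∧
      ∀ m ≤ n, ∀ j ≤ s, HasExt (⋃ t, C j t) (restrict A m) → HasExt (C j t) (restrict A m) := by
  choose f hf using fun k => h.mem k s
  have : ∀ m j, ∃ t, HasExt (⋃ t, C j t) (restrict A m) → HasExt (C j t) (restrict A m) := by
    intro m j
    by_cases hx : HasExt (⋃ t, C j t) (restrict A m)
    · exact (hasExt_iUnion.1 hx).imp fun _ h' _ => h'
    · exact ⟨0, fun h' => absurd h' hx⟩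
  choose g hg using this
  refine ⟨(Finset.range (s + 1)).sup f +
    (Finset.range (n + 1) ×ˢ Finset.range (s + 1)).sup fun p => g p.1 p.2, fun k hk => ?_,
    fun m hm j hj hx => ?_⟩
  · refine h.mono k ?_ (hf k)
    exact (Finset.le_sup (f := f) (Finset.mem_range.2 (Nat.lt_succ_of_le hk))).trans
      (Nat.le_add_right _ _)
  · refine (hg m j hx).mono (h.mono j ?_)
    exact (Finset.le_sup (f := fun p : ℕ × ℕ => g p.1 p.2) (b := (m, j)) (Finset.mem_product.2
      ⟨Finset.mem_range.2 (Nat.lt_succ_of_le hm), Finset.mem_range.2 (Nat.lt_succ_of_le hj)⟩)).trans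
      (Nat.le_add_left _ _)

/-- A long initial segment of `A` is itself a good guess at late stages: the condition on splits is
the one satisfied by `A` in the candidate system, for finitely many strings and levels. -/
theorem CandidateSystem.exists_goodGuess (h : CandidateSystem A l C w L) (s t₀ : ℕ) :
    ∃ t ≥ t₀, ∃ α, GoodGuess A l C L s t α := by
  let n := L + s + (Finset.range (s + 1)).sup fun k => l k s
  obtain ⟨t, ht1, ht2⟩ := h.exists_stage n s
  have hle : ∀ k ≤ s, l k s ≤ n := fun k hk =>
    (Finset.le_sup (f := fun k => l k s) (Finset.mem_range.2 (Nat.lt_succ_of_le hk))).trans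
      (Nat.le_add_left _ _)
  refine ⟨max t₀ t, le_max_left _ _, restrict A n, restrict_prefix A (by omega), ?_, ?_, ?_⟩
  · rw [length_restrict]
    omega
  · intro k hk
    rw [length_restrict, take_restrict A (hle k hk)]
    exact ⟨hle k hk, h.mono k (le_max_right _ _) (ht1 k hk)⟩
  · intro m hm hL k hk v hv hx
    rw [length_restrict] at hm
    rw [take_restrict A hm] at hv ⊢
    obtain ⟨j, hj, hx'⟩ := h.split m hL v hv k (hx.mono (Set.subset_iUnion (C k) _))
    exact ⟨j, hj, (ht2 m hm j (hj.le.trans hk) hx').mono (h.mono j (le_max_right _ _))⟩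

variable {α : ℕ → List ℕ} {t : ℕ → ℕ}

theorem take_succ_eq_append {u : List ℕ} {n : ℕ} (hn : n < u.length) :
    (u.take (n + 1)).dropLast = u.take n := by
  rw [List.take_succ_eq_append_getElem hn, List.dropLast_concat]

/-- Strings that differ split somewhere. -/
theorem exists_sibling {u v : List ℕ} {n : ℕ} (hu : n ≤ u.length) (hv : n ≤ v.length)
    (h : u.take n ≠ v.take n) :
    ∃ m < n, u.take m = v.take m ∧ Sibling (u.take (m + 1)) (v.take (m + 1)) := by
  classical
  have hex : ∃ m, u.take m ≠ v.take m := ⟨n, h⟩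
  have hle : Nat.find hex ≤ n := Nat.find_min' hex h
  have hpos : Nat.find hex ≠ 0 := fun h0 => Nat.find_spec hex (by simp [h0])
  obtain ⟨m, hm⟩ := Nat.exists_eq_succ_of_ne_zero hpos
  have hm' : u.take m = v.take m := not_not.1 (Nat.find_min hex (m := m) (by omega))
  refine ⟨m, by omega, hm', ?_, ?_, ?_⟩
  · simp only [List.length_take]
    omega
  · rw [take_succ_eq_append (by omega), take_succ_eq_append (by omega), hm']
  · have := Nat.find_spec hex
    rwa [hm] at this

/-- Descent on levels. If the guess first differs from `A` at length `m + 1`, consider the least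
level on which its initial segment of that length has an extension. The true sibling has one on a
smaller level by `CandidateSystem.split`, and then the guess has one on a still smaller level by
`GoodGuess.split`. -/
theorem CandidateSystem.eventually_take_eq (h : CandidateSystem A l C w L)
    (hlk : ∀ k s, k ≤ l k s) (ht : ∀ s, s ≤ t s) (hα : ∀ s, GoodGuess A l C L s (t s) (α s))
    (n : ℕ) : ∀ᶠ s in Filter.atTop, (α s).take n = restrict A n := by
  obtain ⟨t₀, -, ht₀⟩ := h.exists_stage n n
  filter_upwards [Filter.eventually_ge_atTop (max n t₀)] with s hs
  by_contra hne
  have hns : n ≤ s := (le_max_left _ _).trans hs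
  have hlen : n ≤ (α s).length := hns.trans (hα s).le_length
  rw [← take_restrict A (le_refl n)] at hne
  obtain ⟨m, hm, hm', hsib⟩ := exists_sibling hlen (length_restrict A n).ge hne
  rw [take_restrict A (show m + 1 ≤ n by omega)] at hsib
  have hLm : L < m + 1 := by
    by_contra hL
    refine hsib.2.2 ?_
    have := (isPrefix_iff_take _ _).1 (hα s).start
    rw [length_restrict] at this
    have h2 : ((α s).take L).take (m + 1) = (α s).take (m + 1) := by
      rw [List.take_take, min_eq_left (by omega)]
    rw [← h2, this, take_restrict A (by omega)]
  -- Level `n` will do: `l n s ≥ n ≥ m + 1`, so the candidate that the guess follows on level `n`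
  -- extends this string.
  have hext : ∃ k, HasExt (C k (t s)) ((α s).take (m + 1)) := by
    refine ⟨n, _, ((hα s).candidate n hns).2, ?_⟩
    exact List.take_prefix_take_left (by have := hlk n s; omega)
  classical
  have hk := Nat.find_spec hext
  have hkn : Nat.find hext ≤ n := Nat.find_min' hext
    ⟨_, ((hα s).candidate n hns).2, List.take_prefix_take_left (by have := hlk n s; omega)⟩
  obtain ⟨j, hj, hx⟩ := h.split (m + 1) hLm _ hsib.symm _
    (hk.mono (Set.subset_iUnion (C (Nat.find hext)) _))
  have hx' : HasExt (C j (t s)) (restrict A (m + 1)) :=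
    (ht₀ (m + 1) (by omega) j (by omega) hx).mono
      (h.mono j (((le_max_right _ _).trans hs).trans (ht s)))
  obtain ⟨i, hi, hxi⟩ := (hα s).split (m + 1) (by omega) hLm j (by omega) _ hsib hx'
  exact Nat.find_min hext (hi.trans hj) hxi

/-- The stages at which the guess changes below the `k`-th marker. -/
def changeStages (l : ℕ → ℕ → ℕ) (L : ℕ) (α : ℕ → List ℕ) (k : ℕ) : Set ℕ :=
  {s | k ≤ s ∧ ∃ n ≤ l k s, L < n ∧ n ≤ (α s).length ∧ n ≤ (α (s + 1)).length ∧
    Sibling ((α (s + 1)).take n) ((α s).take n)}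

/-- A change is charged to the newly adopted string together with the least level on which it has an
extension. The string is a place where level `k` splits and the level is at most `k`, so there are
at most `w k * w k * (k + 1)` charges. None is repeated, as the level drops with every readoption
(`hdec`). -/
theorem CandidateSystem.changeStages_finite (h : CandidateSystem A l C w L)
    (hl : ∀ k, Monotone (l k)) (ht : Monotone t) (hα : ∀ s, GoodGuess A l C L s (t s) (α s))
    (k : ℕ) : ∃ Z : Finset ℕ, ↑Z = changeStages l L α k ∧ Z.card ≤ w k * w k * (k + 1) := by
  classical
  let D := (h.finite k).toFinset.toList
  have hD : {x | x ∈ D} = ⋃ t, C k t := by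
    ext x
    simp [D]
  let W := (splits D).toFinset
  have hW : W.card ≤ w k * w k := by
    refine (h.width k).card_split_le (h.finite k) W fun u hu => ?_
    rw [← hD]
    exact mem_splits.1 (List.mem_toFinset.1 hu)
  have hch : ∀ s, ∃ n, s ∈ changeStages l L α k → n ≤ l k s ∧ L < n ∧ n ≤ (α s).length ∧
      n ≤ (α (s + 1)).length ∧ Sibling ((α (s + 1)).take n) ((α s).take n) := by
    intro s
    by_cases hs : s ∈ changeStages l L α k
    · obtain ⟨-, n, hn⟩ := hs
      exact ⟨n, fun _ => hn⟩
    · exact ⟨0, fun h => absurd h hs⟩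
  choose n hn using hch
  have hv : ∀ s ∈ changeStages l L α k, HasExt (C k (t s)) ((α s).take (n s)) := fun s hs =>
    ⟨_, ((hα s).candidate k hs.1).2, List.take_prefix_take_left (hn s hs).1⟩
  have hu : ∀ s ∈ changeStages l L α k,
      HasExt (C k (t (s + 1))) ((α (s + 1)).take (n s)) := fun s hs =>
    ⟨_, ((hα (s + 1)).candidate k (hs.1.trans (Nat.le_succ s))).2,
      List.take_prefix_take_left ((hn s hs).1.trans (hl k (Nat.le_succ s)))⟩
  -- The default `0` is never used: at a change stage, level `k` has an extension by `hu`.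
  let lev : ℕ → ℕ := fun s => if hex : ∃ j, HasExt (C j (t (s + 1))) ((α (s + 1)).take (n s))
    then Nat.find hex else 0
  have hlev : ∀ s ∈ changeStages l L α k, lev s ≤ k ∧
      HasExt (C (lev s) (t (s + 1))) ((α (s + 1)).take (n s)) ∧
      ∀ j, HasExt (C j (t (s + 1))) ((α (s + 1)).take (n s)) → lev s ≤ j := by
    intro s hs
    have hex : ∃ j, HasExt (C j (t (s + 1))) ((α (s + 1)).take (n s)) := ⟨k, hu s hs⟩
    simp only [lev, dif_pos hex]
    exact ⟨Nat.find_min' hex (hu s hs), Nat.find_spec hex, fun j hj => Nat.find_min' hex hj⟩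
  let φ : ℕ → List ℕ × ℕ := fun s => ((α (s + 1)).take (n s), lev s)
  have hmaps : ∀ s ∈ changeStages l L α k, φ s ∈ W ×ˢ Finset.range (k + 1) := by
    intro s hs
    refine Finset.mem_product.2 ⟨List.mem_toFinset.2 (mem_splits.2 ?_),
      Finset.mem_range.2 (Nat.lt_succ_of_le (hlev s hs).1)⟩
    rw [hD]
    exact ⟨(hu s hs).mono (Set.subset_iUnion (C k) _), _, (hn s hs).2.2.2.2,
      (hv s hs).mono (Set.subset_iUnion (C k) _)⟩
  -- At stage `r` the guess follows the sibling, which must therefore have an extension on some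
  -- level `j < lev s`. At stage `r + 1` it follows the string again, which must then have one on a
  -- level below `j`.
  have hdec : ∀ s ∈ changeStages l L α k, ∀ r ∈ changeStages l L α k, s < r →
      (α (s + 1)).take (n s) = (α (r + 1)).take (n r) → lev r < lev s := by
    intro s hs r hr hsr he
    have h1 := (hlev s hs).2.1
    rw [he] at h1
    have h2 : HasExt (C (lev s) (t r)) ((α (r + 1)).take (n r)) :=
      h1.mono (h.mono _ (ht (Nat.succ_le_of_lt hsr)))
    obtain ⟨j, hj, h3⟩ := (hα r).split (n r) (hn r hr).2.2.1 (hn r hr).2.1 (lev s)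
      ((hlev s hs).1.trans hr.1) _ (hn r hr).2.2.2.2.symm h2
    have h4 : HasExt (C j (t (r + 1))) ((α r).take (n r)) :=
      h3.mono (h.mono _ (ht (Nat.le_succ r)))
    obtain ⟨i, hi, h5⟩ := (hα (r + 1)).split (n r) (hn r hr).2.2.2.1 (hn r hr).2.1 j
      ((hj.le.trans ((hlev s hs).1.trans hr.1)).trans (Nat.le_succ r)) _
      (hn r hr).2.2.2.2 h4
    exact ((hlev r hr).2.2 i h5).trans_lt (hi.trans hj)
  have hinj : Set.InjOn φ (changeStages l L α k) := by
    intro s hs r hr he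
    simp only [φ, Prod.mk.injEq] at he
    rcases lt_trichotomy s r with hlt | heq | hlt
    · exact absurd he.2 (hdec s hs r hr hlt he.1).ne'
    · exact heq
    · exact absurd he.2 (hdec r hr s hs hlt he.1.symm).ne
  have hfin : (changeStages l L α k).Finite :=
    Set.Finite.of_injOn (t := ↑(W ×ˢ Finset.range (k + 1))) (fun s hs => hmaps s hs) hinj
      (Finset.finite_toSet _)
  refine ⟨hfin.toFinset, hfin.coe_toFinset, ?_⟩
  calc hfin.toFinset.card ≤ (W ×ˢ Finset.range (k + 1)).card := by
        refine Finset.card_le_card_of_injOn φ (fun s hs => ?_) ?_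
        · exact hmaps s (by simpa using hs)
        · rwa [hfin.coe_toFinset]
    _ ≤ _ := by
        rw [Finset.card_product, Finset.card_range]
        exact Nat.mul_le_mul_right _ hW

/-! ### The enumeration given by the guesses, and its cost. -/

/-- The finite set with characteristic function (of zeros and ones) `α`. -/
def stringSet (α : List ℕ) : Finset ℕ := (Finset.range α.length).filter fun x => α[x]? = some 1

theorem mem_stringSet {α : List ℕ} {x : ℕ} : x ∈ stringSet α ↔ α[x]? = some 1 := by
  simp only [stringSet, Finset.mem_filter, Finset.mem_range, and_iff_right_iff_imp]
  exact fun h => (List.getElem?_eq_some_iff.1 h).1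

theorem mem_stringSet_iff_of_take_eq {u v : List ℕ} {n x : ℕ} (h : u.take n = v.take n)
    (hx : x < n) : x ∈ stringSet u ↔ x ∈ stringSet v := by
  rw [mem_stringSet, mem_stringSet, ← List.getElem?_take_of_lt hx, h, List.getElem?_take_of_lt hx]

theorem IsCostFunction.nonneg {c : ℕ → ℕ → ℚ} (hc : IsCostFunction c) (x s : ℕ) : 0 ≤ c x s := by
  obtain ⟨p, q, -, -, h⟩ := hc.computable
  rw [(h x s).2]
  positivity

theorem changeCost_nonneg {c : ℕ → ℕ → ℚ} (hc : IsCostFunction c) (As : ℕ → Finset ℕ) (s : ℕ) :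
    0 ≤ changeCost c As s := by
  unfold changeCost
  split_ifs
  exacts [hc.nonneg _ _, le_rfl]

/-- Let the two guesses agree up to length `m` and differ at the next entry, so that `m ≤ x`. If `k
+ 1` is the least level whose marker exceeds `m`, then `x` is not below the `k`-th marker and the
cost is less than `1 / 2 ^ k = 2 / 2 ^ (k + 1)`. On level `0` nothing bounds the cost, but such
stages are finitely many. If no level up to `s` qualifies, the `s`-th marker bounds the cost. -/
theorem changeCost_le {c : ℕ → ℕ → ℚ}
    (hcost : ∀ k s x, l k s ≤ x → c x (s + 1) < 1 / 2 ^ k) (hl : ∀ k, Monotone (l k))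
    (hα : ∀ s, GoodGuess A l C L s (t s) (α s)) (s : ℕ) :
    changeCost c (fun s => stringSet (α s)) s ≤ 1 / 2 ^ s ∨
    s ∈ changeStages l L α 0 ∨ ∃ k, s ∈ changeStages l L α k ∧
      changeCost c (fun s => stringSet (α s)) s ≤ 2 / 2 ^ k := by
  classical
  unfold changeCost
  split_ifs with hne
  swap
  · exact Or.inl (by positivity)
  set x := (symmDiff (stringSet (α s)) (stringSet (α (s + 1)))).min' hne with hx
  have hxm : x ∈ symmDiff (stringSet (α s)) (stringSet (α (s + 1))) := Finset.min'_mem _ _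
  have hnot : ∀ m, (α (s + 1)).take m = (α s).take m → m ≤ x := by
    intro m hm
    by_contra hlt
    push Not at hlt
    have := mem_stringSet_iff_of_take_eq hm hlt
    rw [Finset.mem_symmDiff] at hxm
    tauto
  let M := min (α s).length (α (s + 1)).length
  by_cases hM : (α (s + 1)).take M = (α s).take M
  -- One guess extends the other, and both have length at least `l s s`, so the change lies beyond
  -- the `s`-th marker.
  · refine Or.inl (hcost s s x ((le_min ?_ ?_).trans (hnot M hM))).le
    · exact ((hα s).candidate s le_rfl).1
    · exact (hl s (Nat.le_succ s)).trans ((hα (s + 1)).candidate s (Nat.le_succ s)).1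
  obtain ⟨m, hmM, hm, hsib⟩ := exists_sibling (min_le_right _ _) (min_le_left _ _) hM
  have hLm : L < m + 1 := by
    by_contra hL
    refine hsib.2.2 ?_
    have h1 := (isPrefix_iff_take _ _).1 (hα s).start
    have h2 := (isPrefix_iff_take _ _).1 (hα (s + 1)).start
    rw [length_restrict] at h1 h2
    have h3 := congrArg (List.take (m + 1)) (h2.trans h1.symm)
    rwa [List.take_take, List.take_take, min_eq_left (by omega)] at h3
  have hmx : m ≤ x := hnot m hm
  have key : ∀ k ≤ s, m < l k s → s ∈ changeStages l L α k := fun k hk hlt =>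
    ⟨hk, m + 1, hlt, hLm, hmM.trans_le (min_le_left _ _), hmM.trans_le (min_le_right _ _), hsib⟩
  by_cases hex : ∃ k, k ≤ s ∧ m < l k s
  · right
    obtain ⟨hk1, hk2⟩ := Nat.find_spec hex
    cases hk : Nat.find hex with
    | zero =>
      rw [hk] at hk1 hk2
      exact Or.inl (key 0 hk1 hk2)
    | succ k =>
      refine Or.inr ⟨k + 1, ?_, ?_⟩
      · rw [hk] at hk1 hk2
        exact key _ hk1 hk2
      · have h1 := Nat.find_min hex (m := k) (by omega)
        push Not at h1
        have h2 := hcost k s x ((h1 (by omega)).trans hmx)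
        refine h2.le.trans (le_of_eq ?_)
        rw [pow_succ]
        field_simp
  · push Not at hex
    exact Or.inl (hcost s s x ((hex s le_rfl).trans hmx)).le

/-- The cost is dominated by three summable series: a geometric one, a finite one over `Z 0`, and
the restriction of the double series `g`, with weight `2 / 2 ^ k` at each `s ∈ Z k`, to the
injective family `s ↦ (κ s, s)`. -/
theorem CandidateSystem.obeysCost (h : CandidateSystem A l C w L) {c : ℕ → ℕ → ℚ}
    (hc : IsCostFunction c) (hcost : ∀ k s x, l k s ≤ x → c x (s + 1) < 1 / 2 ^ k)
    (hl : ∀ k, Monotone (l k)) (ht : Monotone t) (hα : ∀ s, GoodGuess A l C L s (t s) (α s))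
    (hw : Summable fun k => ((w k * w k * (k + 1) : ℕ) : ℝ) * (2 / 2 ^ k)) :
    ObeysCost c fun s => stringSet (α s) := by
  classical
  choose Z hZ hZc using h.changeStages_finite hl ht hα
  let f : ℕ → ℝ := fun s => (changeCost c (fun s => stringSet (α s)) s : ℝ)
  have hf : ∀ s, 0 ≤ f s := fun s => Rat.cast_nonneg.2 (changeCost_nonneg hc _ s)
  let g : ℕ × ℕ → ℝ := fun p => if p.2 ∈ Z p.1 then 2 / 2 ^ p.1 else 0
  have hg : ∀ p, 0 ≤ g p := fun p => by
    simp only [g]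
    split_ifs <;> positivity
  have hgs : Summable g := by
    rw [summable_prod_of_nonneg hg]
    have h1 : ∀ k, HasSum (fun s => g (k, s)) ((Z k).card * (2 / 2 ^ k)) := by
      intro k
      have : ∑ s ∈ Z k, g (k, s) = (Z k).card * (2 / 2 ^ k) := by
        have h0 : ∀ s ∈ Z k, g (k, s) = 2 / 2 ^ k := fun s hs => if_pos hs
        rw [Finset.sum_congr rfl h0, Finset.sum_const, nsmul_eq_mul]
      rw [← this]
      exact hasSum_sum_of_ne_finset_zero fun s hs => if_neg hs
    refine ⟨fun k => (h1 k).summable, ?_⟩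
    refine Summable.of_nonneg_of_le (fun k => tsum_nonneg fun s => hg _) (fun k => ?_) hw
    rw [(h1 k).tsum_eq]
    have : ((Z k).card : ℝ) ≤ ((w k * w k * (k + 1) : ℕ) : ℝ) := by exact_mod_cast hZc k
    gcongr
  have hcase : ∀ s, ∃ k, f s ≤ (1 / 2) ^ s + (if s ∈ Z 0 then f s else 0) + g (k, s) := by
    intro s
    have h0 : (0 : ℝ) ≤ if s ∈ Z 0 then f s else 0 := by
      split_ifs
      exacts [hf s, le_rfl]
    have hp : (0 : ℝ) ≤ (1 / 2) ^ s := by positivity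
    rcases changeCost_le hcost hl hα s with h1 | h1 | ⟨k, h1, h2⟩
    · refine ⟨0, ?_⟩
      have h3 : f s ≤ (1 / 2) ^ s := by
        rw [one_div_pow]
        have := (Rat.cast_le (K := ℝ)).2 h1
        push_cast at this
        exact this
      have := hg (0, s)
      linarith
    · refine ⟨0, ?_⟩
      rw [← hZ 0, Finset.mem_coe] at h1
      have := hg (0, s)
      rw [if_pos h1]
      linarith
    · refine ⟨k, ?_⟩
      rw [← hZ k, Finset.mem_coe] at h1
      have h3 : f s ≤ g (k, s) := by
        simp only [g, if_pos h1]
        have := (Rat.cast_le (K := ℝ)).2 h2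
        push_cast at this
        exact this
      linarith
  choose κ hκ using hcase
  have hs1 : Summable fun s : ℕ => ((1 : ℝ) / 2) ^ s := summable_geometric_two
  have hs2 : Summable fun s => if s ∈ Z 0 then f s else 0 :=
    summable_of_ne_finset_zero (s := Z 0) fun s hs => if_neg hs
  have hs3 : Summable fun s => g (κ s, s) :=
    hgs.comp_injective (i := fun s => (κ s, s)) fun a b hab => (Prod.mk.inj hab).2
  exact Summable.of_nonneg_of_le hf hκ ((hs1.add hs2).add hs3)

end Guess

/-- First, the true string has an extension on level `k`. If not, the extension of `v` is not basic,
as the initial segment of `A` of the same length would extend the true string; so `v` has an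
extension on level `k + 1`, where by `h₃` the true string still has none. Repeating this contradicts
`l (k + m) 0 ≥ m`. Now `h₃` brings the true string down to level `k - 1`; the case `k = 0` is
excluded by `L < m`. -/
theorem exists_lt_hasExt {A : Set ℕ} {l : ℕ → ℕ → ℕ} {C : ℕ → Set (List ℕ)} {L : ℕ}
    (hl : ∀ k s, k ≤ l k s) (h₁ : ∀ k s, restrict A (l k s) ∈ C k)
    (h₂ : ∀ k, ∀ x ∈ C k, (∃ s, x.length = l k s) ∨ HasExt (C (k + 1)) x)
    (h₃ : ∀ k m v, Sibling (restrict A m) v → HasExt (C (k + 1)) (restrict A m) →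
      HasExt (C (k + 1)) v → HasExt (C k) (restrict A m))
    (h₄ : ∀ x ∈ C 0, x.length ≤ L) {m : ℕ} (hm : L < m) {v : List ℕ}
    (hv : Sibling (restrict A m) v) {k : ℕ} (hk : HasExt (C k) v) :
    ∃ j < k, HasExt (C j) (restrict A m) := by
  have hlen : v.length = m := by rw [← hv.1, length_restrict]
  have up : ∀ k, HasExt (C k) v → ¬ HasExt (C k) (restrict A m) → HasExt (C (k + 1)) v := by
    rintro k ⟨x, hx, hvx⟩ hn
    rcases h₂ k x hx with ⟨s, hs⟩ | hx'
    · refine absurd ⟨_, h₁ k s, restrict_prefix A ?_⟩ hn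
      rw [← hs, ← hlen]
      exact hvx.length_le
    · exact hx'.of_prefix hvx
  have hu : HasExt (C k) (restrict A m) := by
    by_contra hn
    have : ∀ i, HasExt (C (k + i)) v ∧ ¬ HasExt (C (k + i)) (restrict A m) := by
      intro i
      induction i with
      | zero => exact ⟨hk, hn⟩
      | succ i ih => exact ⟨up _ ih.1 ih.2, fun h => ih.2 (h₃ _ _ _ hv h (up _ ih.1 ih.2))⟩
    exact (this m).2 ⟨_, h₁ (k + m) 0, restrict_prefix A (by have := hl (k + m) 0; omega)⟩
  cases k with
  | zero =>
    obtain ⟨x, hx, hvx⟩ := hk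
    have := h₄ x hx
    have := hvx.length_le
    omega
  | succ k => exact ⟨k, Nat.lt_succ_self k, h₃ k m v hv hu hk⟩

/-! ### Candidates computed by tests. -/

/-- The data from which a system of candidates is computed: lists of basic candidates,
approximations to a universal trace, and bounds on the numbers of strings to be tested. -/
structure TestData where
  /-- The basic candidates on a level. -/
  basic : ℕ → List ℕ → List (List ℕ)
  /-- Stage approximations to a universal trace. -/
  trace : ℕ → ℕ → ℕ → ℕ → Bool
  /-- A bound on the number of candidates. -/
  size : ℕ → ℕ
  /-- A bound on the number of potential candidates. -/
  bound : ℕ → ℕ → ℕ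

/-- The functions that make up the data are computable. -/
structure TestData.IsComputable (Δ : TestData) : Prop where
  basic : Computable fun p : ℕ × List ℕ => Δ.basic p.1 p.2
  trace : Computable fun p : ℕ × ℕ × ℕ × ℕ => Δ.trace p.1 p.2.1 p.2.2.1 p.2.2.2
  size : Computable Δ.size
  bound : Computable₂ Δ.bound

namespace TestData
variable (Δ : TestData)

/-- The potential candidates appearing at stage `m`. -/
def potentialAt (d z m : ℕ) : List (List ℕ) :=
  (List.range (Δ.size z)).flatMap fun j =>
    ((List.range (m + 1)).filter fun y => Δ.trace d (Nat.pair d (Nat.pair z j)) y m).map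
      (Denumerable.ofNat (List ℕ))

/-- The potential candidates found before stage `t`. -/
def potential (d z t : ℕ) : List (List ℕ) := enumList (Δ.potentialAt d z) t

/-- The string `σ` has passed all tests. -/
def confirmed (d e k : ℕ) (τ σ : List ℕ) : Bool :=
  decide (σ ∈ Δ.potential d (Nat.pair e k) τ.length) &&
    (List.range (2 ^ Δ.bound d (Nat.pair e k))).all fun S =>
      !decide (σ ∈ antichain S (Δ.potential d (Nat.pair e k) τ.length)) ||
        enumBy e (Nat.pair (Nat.pair (Nat.pair e k) S) (Encodable.encode σ)) τ

/-- The confirmed strings on level `k` which are basic candidates or places where the confirmed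
strings on level `k + 1` split; only `n` levels are taken into account. -/
def cand (d e : ℕ) (τ : List ℕ) : ℕ → ℕ → List (List ℕ)
  | 0, _ => []
  | n + 1, k => (Δ.basic k τ ++ splits (cand d e τ n (k + 1))).filter (Δ.confirmed d e k τ)

/-- The strings to be tested on level `k`. -/
def tested (d e k : ℕ) (τ : List ℕ) : List (List ℕ) :=
  Δ.basic k τ ++ splits (Δ.cand d e τ τ.length (k + 1))

/-- The functional listing the strings to be tested. -/
def testedFun (x : ℕ) (τ : List ℕ) : Option ℕ :=
  ((enumList (fun m => Δ.tested x.unpair.1 x.unpair.2.unpair.1.unpair.1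
    x.unpair.2.unpair.1.unpair.2 (τ.take m)) (τ.length + 1))[x.unpair.2.unpair.2]?).map
      Encodable.encode

/-- The functional that is to be traced in order to carry out the tests. -/
def testFun (d x : ℕ) (τ : List ℕ) : Option ℕ :=
  (((antichain x.unpair.2 (Δ.potential d x.unpair.1 τ.length)).filter
    fun σ => decide (σ <+: τ))[0]?).map Encodable.encode

variable {Δ}

/-! ### Computability of the tests. -/

section Computability
variable {α : Type*} [Primcodable α] {d e k z t n x : α → ℕ} {τ σ : α → List ℕ}

theorem IsComputable.potentialAt (h : Δ.IsComputable) (hd : Computable d) (hz : Computable z)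
    (ht : Computable t) : Computable fun a => Δ.potentialAt (d a) (z a) (t a) := by
  have h0 : Computable fun p : α × ℕ => Nat.pair (d p.1) (Nat.pair (z p.1) p.2) :=
    computable_natPair (hd.comp Computable.fst)
      (computable_natPair (hz.comp Computable.fst) Computable.snd)
  have h1 : Computable fun p : (α × ℕ) × ℕ =>
      Δ.trace (d p.1.1) (Nat.pair (d p.1.1) (Nat.pair (z p.1.1) p.1.2)) p.2 (t p.1.1) :=
    h.trace.comp ((hd.comp (Computable.fst.comp Computable.fst)).pair
      ((h0.comp Computable.fst).pair (Computable.snd.pair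
        (ht.comp (Computable.fst.comp Computable.fst)))))
  have h2 : Computable fun p : α × ℕ => List.range (t p.1 + 1) :=
    computable_range (Computable.succ.comp (ht.comp Computable.fst))
  have h3 := computable_filter (g := fun (p : α × ℕ) y =>
    Δ.trace (d p.1) (Nat.pair (d p.1) (Nat.pair (z p.1) p.2)) y (t p.1)) h2 h1
  have h4 : Computable fun p : (α × ℕ) × ℕ => Denumerable.ofNat (List ℕ) p.2 :=
    (Computable.ofNat (List ℕ)).comp Computable.snd
  have h5 := computable_map (g := fun (_ : α × ℕ) y => Denumerable.ofNat (List ℕ) y) h3 h4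
  have h6 : Computable fun a => List.range (Δ.size (z a)) :=
    computable_range (h.size.comp hz)
  exact computable_flatMap (g := fun a j => ((List.range (t a + 1)).filter fun y =>
    Δ.trace (d a) (Nat.pair (d a) (Nat.pair (z a) j)) y (t a)).map
      (Denumerable.ofNat (List ℕ))) h6 h5

theorem IsComputable.potential (h : Δ.IsComputable) (hd : Computable d) (hz : Computable z)
    (ht : Computable t) : Computable fun a => Δ.potential (d a) (z a) (t a) :=
  computable_enumList (f := fun a => Δ.potentialAt (d a) (z a))
    (h.potentialAt (hd.comp Computable.fst) (hz.comp Computable.fst) Computable.snd) ht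

theorem IsComputable.confirmed (h : Δ.IsComputable) (hd : Computable d) (he : Computable e)
    (hk : Computable k) (hτ : Computable τ) (hσ : Computable σ) :
    Computable fun a => Δ.confirmed (d a) (e a) (k a) (τ a) (σ a) := by
  have hz : Computable fun a => Nat.pair (e a) (k a) := computable_natPair he hk
  have h1 : Computable fun a => Δ.potential (d a) (Nat.pair (e a) (k a)) (τ a).length :=
    h.potential hd hz (Computable.list_length.comp hτ)
  have h2 : Computable fun p : α × ℕ => decide (σ p.1 ∈ antichain p.2
      (Δ.potential (d p.1) (Nat.pair (e p.1) (k p.1)) (τ p.1).length)) :=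
    computable_mem (hσ.comp Computable.fst)
      (computable_antichain Computable.snd (h1.comp Computable.fst))
  have h3 : Computable fun p : α × ℕ => enumBy (e p.1)
      (Nat.pair (Nat.pair (Nat.pair (e p.1) (k p.1)) p.2) (Encodable.encode (σ p.1))) (τ p.1) :=
    computable_enumBy' (he.comp Computable.fst)
      (computable_natPair (computable_natPair (hz.comp Computable.fst) Computable.snd)
        (Computable.encode.comp (hσ.comp Computable.fst))) (hτ.comp Computable.fst)
  have h4 := computable_or (computable_not h2) h3
  have h5 : Computable fun a => List.range (2 ^ Δ.bound (d a) (Nat.pair (e a) (k a))) :=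
    computable_range (primrec_two_pow.to_comp.comp (h.bound.comp hd hz))
  have h6 := computable_all (g := fun a S =>
    !decide (σ a ∈ antichain S (Δ.potential (d a) (Nat.pair (e a) (k a)) (τ a).length)) ||
    enumBy (e a) (Nat.pair (Nat.pair (Nat.pair (e a) (k a)) S) (Encodable.encode (σ a))) (τ a))
    h5 h4
  exact computable_and (computable_mem hσ h1) h6

/-- The definition recurses on `n` while `k` varies. Counted from the top, step `j` always treats
level `k + n - (j + 1)`, which is a recursion with fixed parameters. -/
theorem IsComputable.cand (h : Δ.IsComputable) (hd : Computable d) (he : Computable e)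
    (hτ : Computable τ) (hn : Computable n) (hk : Computable k) :
    Computable fun a => Δ.cand (d a) (e a) (τ a) (n a) (k a) := by
  have hs : Computable fun p : α × ℕ × List (List ℕ) => p.2.2 := Computable.snd.comp Computable.snd
  have hj : Computable fun p : α × ℕ × List (List ℕ) => k p.1 + n p.1 - (p.2.1 + 1) :=
    Primrec.nat_sub.to_comp.comp
      (computable_add (hk.comp Computable.fst) (hn.comp Computable.fst))
      (Computable.succ.comp (Computable.fst.comp Computable.snd))
  have h1 : Computable fun p : α × ℕ × List (List ℕ) =>
      Δ.basic (k p.1 + n p.1 - (p.2.1 + 1)) (τ p.1) ++ splits p.2.2 :=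
    Computable.list_append.comp (h.basic.comp (hj.pair (hτ.comp Computable.fst)))
      (computable_splits hs)
  have h2 : Computable fun p : (α × ℕ × List (List ℕ)) × List ℕ =>
      Δ.confirmed (d p.1.1) (e p.1.1) (k p.1.1 + n p.1.1 - (p.1.2.1 + 1)) (τ p.1.1) p.2 := by
    have hf : Computable fun p : (α × ℕ × List (List ℕ)) × List ℕ => p.1.1 :=
      Computable.fst.comp Computable.fst
    exact h.confirmed (hd.comp hf) (he.comp hf) (hj.comp Computable.fst) (hτ.comp hf)
      Computable.snd
  have h3 : Computable fun p : α × ℕ × List (List ℕ) =>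
      (Δ.basic (k p.1 + n p.1 - (p.2.1 + 1)) (τ p.1) ++ splits p.2.2).filter
        (Δ.confirmed (d p.1) (e p.1) (k p.1 + n p.1 - (p.2.1 + 1)) (τ p.1)) :=
    computable_filter (g := fun (p : α × ℕ × List (List ℕ)) σ =>
      Δ.confirmed (d p.1) (e p.1) (k p.1 + n p.1 - (p.2.1 + 1)) (τ p.1) σ) h1 h2
  refine (Computable.nat_rec hn (Computable.const []) h3.to₂).of_eq fun a => ?_
  have : ∀ j ≤ n a, (Nat.rec [] (fun j s => (Δ.basic (k a + n a - (j + 1)) (τ a) ++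
      splits s).filter (Δ.confirmed (d a) (e a) (k a + n a - (j + 1)) (τ a))) j :
      List (List ℕ)) = Δ.cand (d a) (e a) (τ a) j (k a + n a - j) := by
    intro j hj
    induction j with
    | zero => rfl
    | succ j ih =>
      simp only [ih (by omega), TestData.cand]
      rw [show k a + n a - (j + 1) + 1 = k a + n a - j by omega]
  simpa using this (n a) le_rfl

theorem IsComputable.tested (h : Δ.IsComputable) (hd : Computable d) (he : Computable e)
    (hk : Computable k) (hτ : Computable τ) :
    Computable fun a => Δ.tested (d a) (e a) (k a) (τ a) :=
  Computable.list_append.comp (h.basic.comp (hk.pair hτ)) (computable_splits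
    (h.cand hd he hτ (Computable.list_length.comp hτ) (Computable.succ.comp hk)))

theorem IsComputable.testedFun (h : Δ.IsComputable) :
    Computable fun p : ℕ × List ℕ => Δ.testedFun p.1 p.2 := by
  have hx : Computable fun p : (ℕ × List ℕ) × ℕ => p.1.1 := Computable.fst.comp Computable.fst
  have h1 : Computable fun p : (ℕ × List ℕ) × ℕ => Δ.tested p.1.1.unpair.1
      p.1.1.unpair.2.unpair.1.unpair.1 p.1.1.unpair.2.unpair.1.unpair.2 (p.1.2.take p.2) :=
    h.tested (computable_unpair_fst hx)
      (computable_unpair_fst (computable_unpair_fst (computable_unpair_snd hx)))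
      (computable_unpair_snd (computable_unpair_fst (computable_unpair_snd hx)))
      (computable_take Computable.snd (Computable.snd.comp Computable.fst))
  have h2 : Computable fun p : ℕ × List ℕ => p.2.length + 1 :=
    Computable.succ.comp (Computable.list_length.comp Computable.snd)
  have h3 := computable_enumList (f := fun (p : ℕ × List ℕ) m => Δ.tested p.1.unpair.1
      p.1.unpair.2.unpair.1.unpair.1 p.1.unpair.2.unpair.1.unpair.2 (p.2.take m)) h1 h2
  have h4 : Computable fun p : ℕ × List ℕ => p.1.unpair.2.unpair.2 :=
    computable_unpair_snd (computable_unpair_snd Computable.fst)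
  have h5 := Computable.list_getElem?.comp h3 h4
  exact Computable.option_map h5 (Computable.encode.comp Computable.snd).to₂

theorem IsComputable.testFun (h : Δ.IsComputable) (d : ℕ) :
    Computable fun p : ℕ × List ℕ => Δ.testFun d p.1 p.2 := by
  have h1 : Computable fun p : ℕ × List ℕ =>
      antichain p.1.unpair.2 (Δ.potential d p.1.unpair.1 p.2.length) :=
    computable_antichain (computable_unpair_snd Computable.fst)
      (h.potential (Computable.const d) (computable_unpair_fst Computable.fst)
        (Computable.list_length.comp Computable.snd))
  have h2 : Computable fun p : (ℕ × List ℕ) × List ℕ => decide (p.2 <+: p.1.2) :=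
    computable_isPrefix Computable.snd (Computable.snd.comp Computable.fst)
  have h3 := computable_filter (g := fun (p : ℕ × List ℕ) σ => decide (σ <+: p.2)) h1 h2
  have h4 := Computable.list_getElem?.comp h3 (Computable.const 0)
  exact Computable.option_map h4 (Computable.encode.comp Computable.snd).to₂

end Computability
end TestData

/-! ### What the tests achieve. -/

theorem splits_mono {C D : List (List ℕ)} (h : C ⊆ D) : splits C ⊆ splits D := by
  intro u hu
  rw [mem_splits] at hu ⊢
  have h' : {x | x ∈ C} ⊆ {x | x ∈ D} := fun x hx => h hx
  exact ⟨hu.1.mono h', hu.2.imp fun v hv => ⟨hv.1, hv.2.mono h'⟩⟩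

namespace TestData

/-- The tests carried out with the help of traces for the functionals `testedFun` and `testFun`. -/
structure Tests (Δ : TestData) (A B : Set ℕ) (l : ℕ → ℕ → ℕ) (V T : ℕ → Finset ℕ) (d e : ℕ) :
    Prop where
  basic_mono : ∀ k m n, m ≤ n → Δ.basic k (restrict B m) ⊆ Δ.basic k (restrict B n)
  basic_mem : ∀ k s, ∃ m, restrict A (l k s) ∈ Δ.basic k (restrict B m)
  basic_length : ∀ k m, ∀ x ∈ Δ.basic k (restrict B m), ∃ s, x.length = l k s
  basic_card : ∀ k m, (Δ.basic k (restrict B m)).toFinset.card +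
    (Nat.pair e (k + 1) + 1) * (Nat.pair e (k + 1) + 1) ≤ Δ.size (Nat.pair e k)
  mem_V : ∀ x y, y ∈ V x ↔ ∃ m, Δ.trace d x y m = true
  trace_mono : ∀ x y m n, m ≤ n → Δ.trace d x y m = true → Δ.trace d x y n = true
  card_V : ∀ z, ∑ j ∈ Finset.range (Δ.size z), (V (Nat.pair d (Nat.pair z j))).card ≤ Δ.bound d z
  traces_V : ∀ x m₀ y₀, Δ.testedFun x (restrict B m₀) = some y₀ →
    ∃ m y, Δ.testedFun x (restrict B m) = some y ∧ y ∈ V x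
  mem_T : ∀ x y, y ∈ T x ↔ ∃ m, enumBy e (Nat.pair x y) (restrict B m) = true
  card_T : ∀ z S, S < 2 ^ Δ.bound d z → (T (Nat.pair z S)).card ≤ z + 1
  traces_T : ∀ x m₀ y₀, Δ.testFun d x (restrict A m₀) = some y₀ →
    ∃ m y, Δ.testFun d x (restrict A m) = some y ∧ y ∈ T x

variable {Δ : TestData} {A B : Set ℕ} {l : ℕ → ℕ → ℕ} {V T : ℕ → Finset ℕ} {d e : ℕ}

theorem potential_prefix (d z : ℕ) {m n : ℕ} (h : m ≤ n) :
    Δ.potential d z m <+: Δ.potential d z n := enumList_prefix _ h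

theorem nodup_potential (d z t : ℕ) : (Δ.potential d z t).Nodup := nodup_enumList _ _

namespace Tests

theorem mem_V_of_mem_potential (h : Δ.Tests A B l V T d e) {z t : ℕ} {x : List ℕ}
    (hx : x ∈ Δ.potential d z t) :
    ∃ j < Δ.size z, Encodable.encode x ∈ V (Nat.pair d (Nat.pair z j)) := by
  obtain ⟨m, -, hm⟩ := mem_enumList.1 hx
  simp only [potentialAt, List.mem_flatMap, List.mem_map, List.mem_filter, List.mem_range] at hm
  obtain ⟨j, hj, y, ⟨-, hy⟩, rfl⟩ := hm
  exact ⟨j, hj, by simpa using (h.mem_V _ _).2 ⟨m, hy⟩⟩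

theorem exists_mem_potential (h : Δ.Tests A B l V T d e) {z j : ℕ} (hj : j < Δ.size z) {x : List ℕ}
    (hx : Encodable.encode x ∈ V (Nat.pair d (Nat.pair z j))) : ∃ t, x ∈ Δ.potential d z t := by
  obtain ⟨m, hm⟩ := (h.mem_V _ _).1 hx
  refine ⟨max m (Encodable.encode x) + 1, mem_enumList.2 ⟨_, Nat.lt_succ_self _, ?_⟩⟩
  simp only [potentialAt, List.mem_flatMap, List.mem_map, List.mem_filter, List.mem_range]
  exact ⟨j, hj, Encodable.encode x, ⟨Nat.lt_succ_of_le (le_max_right _ _),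
    h.trace_mono _ _ _ _ (le_max_left _ _) hm⟩, by simp⟩

theorem length_potential_le (h : Δ.Tests A B l V T d e) (z t : ℕ) :
    (Δ.potential d z t).length ≤ Δ.bound d z := by
  rw [← List.toFinset_card_of_nodup (nodup_potential d z t)]
  calc _ ≤ (((Finset.range (Δ.size z)).biUnion fun j => V (Nat.pair d (Nat.pair z j))).image
        (Denumerable.ofNat (List ℕ))).card := by
        refine Finset.card_le_card fun x hx => ?_
        obtain ⟨j, hj, hV⟩ := h.mem_V_of_mem_potential (List.mem_toFinset.1 hx)
        exact Finset.mem_image.2 ⟨_, Finset.mem_biUnion.2 ⟨j, Finset.mem_range.2 hj, hV⟩, by simp⟩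
    _ ≤ _ := Finset.card_image_le
    _ ≤ _ := Finset.card_biUnion_le
    _ ≤ _ := h.card_V z

theorem confirmed_iff {k m : ℕ} {σ : List ℕ} : Δ.confirmed d e k (restrict B m) σ = true ↔
    σ ∈ Δ.potential d (Nat.pair e k) m ∧ ∀ S < 2 ^ Δ.bound d (Nat.pair e k),
      σ ∈ antichain S (Δ.potential d (Nat.pair e k) m) →
        enumBy e (Nat.pair (Nat.pair (Nat.pair e k) S) (Encodable.encode σ)) (restrict B m) =
          true := by
  simp only [confirmed, length_restrict, Bool.and_eq_true, decide_eq_true_eq, List.all_eq_true,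
    List.mem_range, Bool.or_eq_true, Bool.not_eq_true', decide_eq_false_iff_not, imp_iff_not_or]

/-- Once `σ` has appeared, the antichains that contain it are settled, so later stages pose no new
tests. -/
theorem confirmed_mono {k m n : ℕ} (hmn : m ≤ n) {σ : List ℕ}
    (hσ : Δ.confirmed d e k (restrict B m) σ = true) :
    Δ.confirmed d e k (restrict B n) σ = true := by
  rw [confirmed_iff] at hσ ⊢
  have hp := potential_prefix (Δ := Δ) d (Nat.pair e k) hmn
  exact ⟨hp.subset hσ.1, fun S hS hσS => enumBy_restrict_mono hmn
    (hσ.2 S hS (mem_antichain_of_prefix hp (nodup_potential _ _ _) hσ.1 hσS))⟩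

theorem cand_mono (h : Δ.Tests A B l V T d e) {i j m n k : ℕ} (hij : i ≤ j) (hmn : m ≤ n) :
    Δ.cand d e (restrict B m) i k ⊆ Δ.cand d e (restrict B n) j k := by
  induction i generalizing j k with
  | zero => exact List.nil_subset _
  | succ i ih =>
    cases j with
    | zero => omega
    | succ j =>
      intro x hx
      simp only [cand, List.mem_filter, List.mem_append] at hx ⊢
      exact ⟨hx.1.imp (fun hb => h.basic_mono k m n hmn hb)
        fun hs => splits_mono (ih (Nat.le_of_succ_le_succ hij)) hs, confirmed_mono hmn hx.2⟩

theorem tested_mono (h : Δ.Tests A B l V T d e) {m n k : ℕ} (hmn : m ≤ n) :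
    Δ.tested d e k (restrict B m) ⊆ Δ.tested d e k (restrict B n) := by
  intro x hx
  simp only [tested, List.mem_append, length_restrict] at hx ⊢
  exact hx.imp (fun hb => h.basic_mono k m n hmn hb) fun hs => splits_mono (h.cand_mono hmn hmn) hs

theorem mem_cand_succ {k m : ℕ} {x : List ℕ} : x ∈ Δ.cand d e (restrict B m) (m + 1) k ↔
    x ∈ Δ.tested d e k (restrict B m) ∧ Δ.confirmed d e k (restrict B m) x = true := by
  simp only [cand, tested, List.mem_filter, length_restrict]

theorem mem_potential_of_mem_cand {i k m : ℕ} {x : List ℕ}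
    (hx : x ∈ Δ.cand d e (restrict B m) i k) : x ∈ Δ.potential d (Nat.pair e k) m := by
  cases i with
  | zero => exact absurd hx List.not_mem_nil
  | succ i => exact (confirmed_iff.1 (List.mem_filter.1 hx).2).1

theorem finite_cand (h : Δ.Tests A B l V T d e) (k : ℕ) :
    (⋃ t, {x | x ∈ Δ.cand d e (restrict B t) (t + 1) k}).Finite := by
  refine Set.Finite.subset (((Finset.range (Δ.size (Nat.pair e k))).biUnion fun j =>
    V (Nat.pair d (Nat.pair (Nat.pair e k) j))).image (Denumerable.ofNat (List ℕ))).finite_toSet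
    fun x hx => ?_
  obtain ⟨t, ht⟩ := Set.mem_iUnion.1 hx
  obtain ⟨j, hj, hV⟩ := h.mem_V_of_mem_potential (mem_potential_of_mem_cand ht)
  exact Finset.mem_coe.2 (Finset.mem_image.2 ⟨_, Finset.mem_biUnion.2
    ⟨j, Finset.mem_range.2 hj, hV⟩, by simp⟩)

theorem monotone_cand (h : Δ.Tests A B l V T d e) (k : ℕ) :
    Monotone fun t => {x | x ∈ Δ.cand d e (restrict B t) (t + 1) k} :=
  fun _ _ hst _ hx => h.cand_mono (Nat.succ_le_succ hst) hst hx

/-- A finite antichain of candidates is present at a single stage and contained in `antichain S` for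
some `S`. Being confirmed, its members all lie in one set of the trace `T`, which is small. -/
theorem widthLE_cand (h : Δ.Tests A B l V T d e) (k : ℕ) :
    WidthLE (⋃ t, {x | x ∈ Δ.cand d e (restrict B t) (t + 1) k}) (Nat.pair e k + 1) := by
  intro W hW hanti
  have : ∃ t, ∀ x ∈ W, x ∈ Δ.cand d e (restrict B t) (t + 1) k := by
    choose! f hf using fun x hx => Set.mem_iUnion.1 (hW x hx)
    exact ⟨W.sup f, fun x hx => h.monotone_cand k (Finset.le_sup hx) (hf x hx)⟩
  obtain ⟨t, ht⟩ := this
  obtain ⟨S, hS, hSW⟩ := exists_antichain (Δ.potential d (Nat.pair e k) t) (C := fun x => x ∈ W)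
    (fun x y hx hy => hanti x hx y hy) (nodup_potential _ _ _)
  have hS' := hS.trans_le (Nat.pow_le_pow_right two_pos (h.length_potential_le _ t))
  refine le_trans ?_ (h.card_T _ S hS')
  refine Finset.card_le_card_of_injOn Encodable.encode (fun x hx => ?_)
    Encodable.encode_injective.injOn
  have hc := confirmed_iff.1 (mem_cand_succ.1 (ht x hx)).2
  exact (h.mem_T _ _).2 ⟨t, hc.2 S hS' (hSW x hc.1 hx)⟩

/-- The width of level `k + 1` is bounded regardless of how many strings are tested there. So the
dependence of each level on the next one is not circular, and the number of splits is at most the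
square of that width. -/
theorem card_tested_le (h : Δ.Tests A B l V T d e) (k m : ℕ) :
    (Δ.tested d e k (restrict B m)).toFinset.card ≤ Δ.size (Nat.pair e k) := by
  rw [tested, List.toFinset_append]
  refine (Finset.card_union_le _ _).trans (le_trans (Nat.add_le_add_left ?_ _) (h.basic_card k m))
  refine (h.widthLE_cand (k + 1)).card_split_le (h.finite_cand (k + 1)) _ fun u hu => ?_
  rw [List.mem_toFinset, mem_splits, length_restrict] at hu
  have hsub : {x | x ∈ Δ.cand d e (restrict B m) m (k + 1)} ⊆
      ⋃ t, {x | x ∈ Δ.cand d e (restrict B t) (t + 1) (k + 1)} := fun x hx =>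
    Set.mem_iUnion.2 ⟨m, h.cand_mono (Nat.le_succ m) le_rfl hx⟩
  exact ⟨hu.1.mono hsub, hu.2.imp fun v hv => ⟨hv.1, hv.2.mono hsub⟩⟩

/-- The `j`-th tested string is a functional of `B` with a unique value, as positions are stable,
and `j` stays below the size bound. So the trace for `B` contains it. -/
theorem exists_mem_potential_of_mem_tested (h : Δ.Tests A B l V T d e) {k m : ℕ} {σ : List ℕ}
    (hσ : σ ∈ Δ.tested d e k (restrict B m)) : ∃ t, σ ∈ Δ.potential d (Nat.pair e k) t := by
  set f : ℕ → List (List ℕ) := fun i => Δ.tested d e k (restrict B i) with hf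
  have hval : ∀ j n, Δ.testedFun (Nat.pair d (Nat.pair (Nat.pair e k) j)) (restrict B n) =
      ((enumList f (n + 1))[j]?).map Encodable.encode := by
    intro j n
    simp only [testedFun, Nat.unpair_pair, length_restrict]
    rw [enumList_congr (g := f) fun i hi => by
      rw [hf, take_restrict B (Nat.lt_succ_iff.1 hi)]]
  have hlen : (enumList f (m + 1)).length ≤ Δ.size (Nat.pair e k) := by
    rw [← List.toFinset_card_of_nodup (nodup_enumList f _)]
    refine (Finset.card_le_card fun x hx => ?_).trans (h.card_tested_le k m)
    obtain ⟨i, hi, hx⟩ := mem_enumList.1 (List.mem_toFinset.1 hx)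
    exact List.mem_toFinset.2 (h.tested_mono (Nat.lt_succ_iff.1 hi) hx)
  obtain ⟨j, hj, hjσ⟩ := List.mem_iff_getElem.1
    (mem_enumList.2 ⟨m, Nat.lt_succ_self m, hσ⟩ : σ ∈ enumList f (m + 1))
  have hjσ' : (enumList f (m + 1))[j]? = some σ := by rw [List.getElem?_eq_getElem hj, hjσ]
  obtain ⟨n, y, hy, hyV⟩ := h.traces_V (Nat.pair d (Nat.pair (Nat.pair e k) j)) m
    (Encodable.encode σ) (by rw [hval, hjσ']; rfl)
  rw [hval, Option.map_eq_some_iff] at hy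
  obtain ⟨ρ, hρ, rfl⟩ := hy
  have up : ∀ {a b : ℕ} {x : List ℕ}, a ≤ b → (enumList f a)[j]? = some x →
      (enumList f b)[j]? = some x := by
    intro a b x hab hx
    obtain ⟨r, hr⟩ := enumList_prefix f hab
    rw [← hr, List.getElem?_append_left (List.getElem?_eq_some_iff.1 hx).1, hx]
  have := (up (Nat.succ_le_succ (le_max_left m n)) hjσ').symm.trans
    (up (Nat.succ_le_succ (le_max_right m n)) hρ)
  rw [Option.some.injEq] at this
  subst this
  exact h.exists_mem_potential (hj.trans_le hlen) hyV

/-- In an antichain containing `restrict A n`, no other member is an initial segment of `A`, so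
`testFun` can have no other value and the trace must enumerate this string. Only finitely many `S`
matter, so a single stage confirms it. -/
theorem exists_mem_cand_of_mem_tested (h : Δ.Tests A B l V T d e) {k m n : ℕ}
    (hσ : restrict A n ∈ Δ.tested d e k (restrict B m)) :
    ∃ t, restrict A n ∈ Δ.cand d e (restrict B t) (t + 1) k := by
  obtain ⟨t₁, ht₁⟩ := h.exists_mem_potential_of_mem_tested hσ
  set z := Nat.pair e k with hz
  have key : ∀ S, ∃ r, restrict A n ∈ antichain S (Δ.potential d z t₁) →
      enumBy e (Nat.pair (Nat.pair z S) (Encodable.encode (restrict A n))) (restrict B r) =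
        true := by
    intro S
    by_cases hS : restrict A n ∈ antichain S (Δ.potential d z t₁)
    swap
    · exact ⟨0, fun h' => absurd h' hS⟩
    have hval : ∀ i, Δ.testFun d (Nat.pair z S) (restrict A i) =
        (((antichain S (Δ.potential d z i)).filter
          fun σ => decide (σ <+: restrict A i))[0]?).map Encodable.encode := fun i => by
      simp only [testFun, Nat.unpair_pair, length_restrict]
    have hmem : restrict A n ∈ (antichain S (Δ.potential d z (max t₁ n))).filter
        fun σ => decide (σ <+: restrict A (max t₁ n)) := by
      rw [List.mem_filter, decide_eq_true_eq]
      exact ⟨(antichain_append_prefix S (potential_prefix d z (le_max_left _ _))).subset hS,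
        restrict_prefix A (le_max_right _ _)⟩
    obtain ⟨i, y, hy, hyT⟩ := h.traces_T (Nat.pair z S) (max t₁ n)
      (Encodable.encode (((antichain S (Δ.potential d z (max t₁ n))).filter
        fun σ => decide (σ <+: restrict A (max t₁ n)))[0]'(List.length_pos_of_mem hmem))) (by
      rw [hval, List.getElem?_eq_getElem (List.length_pos_of_mem hmem)]; rfl)
    rw [hval, Option.map_eq_some_iff] at hy
    obtain ⟨ρ, hρ, rfl⟩ := hy
    have hρ' := List.mem_of_getElem? hρ
    rw [List.mem_filter, decide_eq_true_eq] at hρ'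
    have hρS := (antichain_append_prefix S
      (potential_prefix (Δ := Δ) d z (le_max_right t₁ i))).subset hρ'.1
    have hσS := (antichain_append_prefix S
      (potential_prefix (Δ := Δ) d z (le_max_left t₁ i))).subset hS
    have : ρ = restrict A n := by
      have h1 := hρ'.2.trans (restrict_prefix A (le_max_left i n))
      have h2 := restrict_prefix A (le_max_right i n)
      rcases List.prefix_or_prefix_of_prefix h1 h2 with h' | h'
      · exact antichain_isAntichain hρS hσS h'
      · exact (antichain_isAntichain hσS hρS h').symm
    rw [this] at hyT
    exact ((h.mem_T _ _).1 hyT).imp fun r hr _ => hr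
  choose r hr using key
  set t := max (max t₁ m) ((Finset.range (2 ^ Δ.bound d z)).sup r) with ht
  have ht1 : t₁ ≤ t := (le_max_left _ _).trans (le_max_left _ _)
  refine ⟨t, mem_cand_succ.2 ⟨h.tested_mono ((le_max_right _ _).trans (le_max_left _ _)) hσ,
    confirmed_iff.2 ⟨(potential_prefix d z ht1).subset ht₁, fun S hS hσS => ?_⟩⟩⟩
  exact enumBy_restrict_mono ((Finset.le_sup (Finset.mem_range.2 hS)).trans (le_max_right _ _))
    (hr S (mem_antichain_of_prefix (potential_prefix d z ht1) (nodup_potential _ _ _) ht₁ hσS))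

/-- The strings that pass all tests form a system of candidates. -/
theorem exists_candidateSystem (h : Δ.Tests A B l V T d e) (hl : ∀ k s, k ≤ l k s) :
    ∃ L, CandidateSystem A l (fun k t => {x | x ∈ Δ.cand d e (restrict B t) (t + 1) k})
      (fun k => Nat.pair e k + 1) L := by
  -- Below level `0` no true string can be placed, so the lengths of the candidates there are
  -- exempted from the condition on splits.
  obtain ⟨L, hL⟩ := ((h.finite_cand 0).image List.length).bddAbove
  have h₁ : ∀ k s, ∃ t, restrict A (l k s) ∈ Δ.cand d e (restrict B t) (t + 1) k := by
    intro k s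
    obtain ⟨m, hm⟩ := h.basic_mem k s
    exact h.exists_mem_cand_of_mem_tested (List.mem_append_left _ hm)
  refine ⟨L, h.monotone_cand, h.finite_cand, h.widthLE_cand, h₁, fun m hm v hv k hk => ?_⟩
  refine exists_lt_hasExt hl (fun k s => Set.mem_iUnion.2 (h₁ k s)) (fun k x hx => ?_)
    (fun k m v hv hu hv' => ?_) (fun x hx => hL ⟨x, hx, rfl⟩) hm hv hk
  · obtain ⟨t, ht⟩ := Set.mem_iUnion.1 hx
    rcases List.mem_append.1 (mem_cand_succ.1 ht).1 with hb | hs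
    · exact Or.inl (h.basic_length k t x hb)
    · rw [mem_splits, length_restrict] at hs
      exact Or.inr (hs.1.mono fun y hy =>
        Set.mem_iUnion.2 ⟨t, h.cand_mono (Nat.le_succ t) le_rfl hy⟩)
  · obtain ⟨t₁, h₁'⟩ := hasExt_iUnion.1 hu
    obtain ⟨t₂, h₂'⟩ := hasExt_iUnion.1 hv'
    set t := max t₁ t₂ with ht
    -- Testing at `B↾(t + 1)` takes `t + 1` levels above into account, just enough for the
    -- candidates of stage `t`.
    have hsub : {x | x ∈ Δ.cand d e (restrict B t) (t + 1) (k + 1)} ⊆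
        {x | x ∈ Δ.cand d e (restrict B (t + 1)) (t + 1) (k + 1)} := fun x hx =>
      h.cand_mono le_rfl (Nat.le_succ t) hx
    have hmem : restrict A m ∈ Δ.tested d e k (restrict B (t + 1)) := by
      refine List.mem_append_right _ (mem_splits.2 ?_)
      rw [length_restrict]
      exact ⟨(h₁'.mono (h.monotone_cand _ (le_max_left _ _))).mono hsub, v, hv,
        (h₂'.mono (h.monotone_cand _ (le_max_right _ _))).mono hsub⟩
    exact ⟨_, Set.mem_iUnion.2 (h.exists_mem_cand_of_mem_tested hmem), List.prefix_rfl⟩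

end Tests
end TestData

/-- The tests refer to the indices `d` and `e` of the very traces that they use, but no recursion
theorem is needed: `testedFun` receives both indices as part of its input, and `testFun d` receives
`e` inside `z = Nat.pair e k`. The index `d` is fixed first, as the number `2 ^ Δ.bound d z` of
antichains, which governs how slow the bound on the trace of `testFun d` has to be, depends on it.
-/
theorem SJReducible.exists_candidateSystem {A B : Set ℕ} (hA : SJReducible A B)
    (hB : JumpTraceable B) {l : ℕ → ℕ → ℕ} (cl : Computable₂ l) {N : ℕ → ℕ} (hN : Computable N)
    (hlN : ∀ k s, (enumList (fun s => [l k s]) s).length ≤ N k) (hl : ∀ k s, k ≤ l k s) :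
    ∃ (C : ℕ → List ℕ → List (List ℕ)) (e L : ℕ), (Computable fun p : ℕ × List ℕ => C p.1 p.2) ∧
      CandidateSystem A l (fun k t => {x | x ∈ C k (restrict B t)}) (fun k => Nat.pair e k + 1)
        L := by
  obtain ⟨P, b, cP, cb, mP, bP, hP, lP⟩ := hA.exists_candidates cl hN hlN
  obtain ⟨g, Q, V, cg, cQ, hV, mQ, bV, tV⟩ := hB.exists_trace
  -- With `z = Nat.pair e k`: the basic candidates of level `k`, and the square of the width of
  -- level `k + 1` for the splits.
  let size : ℕ → ℕ := fun z => b z.unpair.2 +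
    (Nat.pair z.unpair.1 (z.unpair.2 + 1) + 1) * (Nat.pair z.unpair.1 (z.unpair.2 + 1) + 1)
  let Δ : TestData := ⟨P, Q, size, fun d z =>
    ∑ j ∈ Finset.range (size z), g d (Nat.pair d (Nat.pair z j))⟩
  have csize : Computable size := by
    have h1 : Computable fun z : ℕ => Nat.pair z.unpair.1 (z.unpair.2 + 1) + 1 :=
      Computable.succ.comp (computable_natPair (computable_unpair_fst Computable.id)
        (Computable.succ.comp (computable_unpair_snd Computable.id)))
    exact computable_add (cb.comp (computable_unpair_snd Computable.id)) (computable_mul h1 h1)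
  have cΔ : Δ.IsComputable := by
    refine ⟨cP, cQ, csize, ?_⟩
    have h1 : Computable fun p : (ℕ × ℕ) × ℕ =>
        g p.1.1 (Nat.pair p.1.1 (Nat.pair p.1.2 p.2)) :=
      cg.comp (Computable.fst.comp Computable.fst)
        (computable_natPair (Computable.fst.comp Computable.fst)
          (computable_natPair (Computable.snd.comp Computable.fst) Computable.snd))
    exact computable_sum_range (f := fun p : ℕ × ℕ => size p.2)
      (g := fun p j => g p.1 (Nat.pair p.1 (Nat.pair p.2 j))) (csize.comp Computable.snd) h1
  obtain ⟨d, hd⟩ := tV Δ.testedFun cΔ.testedFun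
  obtain ⟨e, T, hT, bT, tT⟩ := hA.exists_trace (G := fun z => Nat.pair z (2 ^ Δ.bound d z))
    (computable_natPair Computable.id (primrec_two_pow.to_comp.comp
      (cΔ.bound.comp (Computable.const d) Computable.id))) (cΔ.testFun d)
  have hΔ : Δ.Tests A B l (V d) T d e := by
    refine ⟨mP, hP, lP, fun k m => ?_, hV d, mQ d, fun z => Finset.sum_le_sum fun j _ => bV _ _,
      hd, hT, fun z S hS => bT z _ (Nat.pair_lt_pair_right z hS).le, tT⟩
    simp only [Δ, size, Nat.unpair_pair]
    exact Nat.add_le_add_right (bP k m) _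
  obtain ⟨L, hL⟩ := hΔ.exists_candidateSystem hl
  refine ⟨fun k τ => Δ.cand d e τ (τ.length + 1) k, e, L, ?_, ?_⟩
  · exact cΔ.cand (Computable.const d) (Computable.const e) Computable.snd
      (Computable.succ.comp (Computable.list_length.comp Computable.snd)) Computable.fst
  · simpa only [length_restrict] using hL

/-! ### The search for good guesses -/

/-- Decides whether `u` has an extension among the candidates of a level below `k`. -/
def hasExtBelow (C : ℕ → List ℕ → List (List ℕ)) (τ : List ℕ) (k : ℕ) (u : List ℕ) : Bool :=
  (List.range k).any fun j => (C j τ).any fun y => decide (u <+: y)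

/-- Decides whether `u` has an extension among the candidates of a level below `k` unless no sibling
of `u` has an extension among those on level `k`. -/
def siblingTest (C : ℕ → List ℕ → List (List ℕ)) (τ : List ℕ) (k : ℕ) (u : List ℕ) : Bool :=
  (C k τ).all fun x => !decide (Sibling u (x.take u.length)) || hasExtBelow C τ k u

/-- Decides whether `α` is a good guess at stage `s`, where the candidates are given by `C` from the
initial segment `τ` of an oracle and `σ` is the initial segment to start with. -/
def goodGuess (l : ℕ → ℕ → ℕ) (C : ℕ → List ℕ → List (List ℕ)) (σ : List ℕ) (s : ℕ)
    (τ α : List ℕ) : Bool :=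
  (decide (σ <+: α) && decide (s ≤ α.length)) &&
    ((List.range (s + 1)).all fun k =>
      decide (l k s ≤ α.length) && decide (α.take (l k s) ∈ C k τ)) &&
    (List.range (α.length + 1)).all fun n => decide (n ≤ σ.length) ||
      (List.range (s + 1)).all fun k => siblingTest C τ k (α.take n)

theorem hasExtBelow_iff {C : ℕ → List ℕ → List (List ℕ)} {τ : List ℕ} {k : ℕ} {u : List ℕ} :
    hasExtBelow C τ k u = true ↔ ∃ j < k, HasExt {x | x ∈ C j τ} u := by
  simp only [hasExtBelow, List.any_eq_true, List.mem_range, decide_eq_true_eq, HasExt,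
    Set.mem_ofPred_eq]

/-- A sibling of `u` with an extension `x` is the initial segment of `x` of length `u.length`, so it
suffices to run through the candidates `x`. -/
theorem siblingTest_iff {C : ℕ → List ℕ → List (List ℕ)} {τ : List ℕ} {k : ℕ} {u : List ℕ} :
    siblingTest C τ k u = true ↔ ∀ v, Sibling u v → HasExt {x | x ∈ C k τ} v →
      ∃ j < k, HasExt {x | x ∈ C j τ} u := by
  simp only [siblingTest, List.all_eq_true, Bool.or_eq_true, Bool.not_eq_true',
    decide_eq_false_iff_not, ← imp_iff_not_or, hasExtBelow_iff]
  constructor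
  · rintro h v hv ⟨x, hx, hvx⟩
    refine h x hx ?_
    rwa [hv.1, (isPrefix_iff_take v x).1 hvx]
  · exact fun h x hx hv => h _ hv ⟨x, hx, List.take_prefix _ _⟩

theorem goodGuess_iff {A : Set ℕ} {l : ℕ → ℕ → ℕ} {C : ℕ → List ℕ → List (List ℕ)} {L s : ℕ}
    {X : Set ℕ} {t : ℕ} {α : List ℕ} :
    goodGuess l C (restrict A L) s (restrict X t) α = true ↔
      GoodGuess A l (fun k t => {x | x ∈ C k (restrict X t)}) L s t α := by
  simp only [goodGuess, Bool.and_eq_true, decide_eq_true_eq, List.all_eq_true, List.mem_range,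
    Bool.or_eq_true, siblingTest_iff, length_restrict, Nat.lt_succ_iff]
  constructor
  · rintro ⟨⟨⟨h1, h2⟩, h3⟩, h4⟩
    exact ⟨h1, h2, h3, fun n hn hL => (h4 n hn).resolve_left (by omega)⟩
  · rintro ⟨h1, h2, h3, h4⟩
    exact ⟨⟨⟨h1, h2⟩, h3⟩, fun n hn => (le_or_gt n L).imp id fun hL => h4 n hn hL⟩

theorem computable_hasExtBelow {β : Type*} [Primcodable β] {C : ℕ → List ℕ → List (List ℕ)}
    (hC : Computable fun p : ℕ × List ℕ => C p.1 p.2) {τ u : β → List ℕ} {k : β → ℕ}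
    (hτ : Computable τ) (hk : Computable k) (hu : Computable u) :
    Computable fun a => hasExtBelow C (τ a) (k a) (u a) := by
  have h1 : Computable fun p : (β × ℕ) × List ℕ => decide (u p.1.1 <+: p.2) :=
    computable_isPrefix (hu.comp (Computable.fst.comp Computable.fst)) Computable.snd
  have h2 : Computable fun p : β × ℕ => C p.2 (τ p.1) :=
    hC.comp (Computable.snd.pair (hτ.comp Computable.fst))
  have h3 : Computable fun p : β × ℕ => (C p.2 (τ p.1)).any fun y => decide (u p.1 <+: y) :=
    computable_any (g := fun (p : β × ℕ) y => decide (u p.1 <+: y)) h2 h1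
  exact computable_any (g := fun a j => (C j (τ a)).any fun y => decide (u a <+: y))
    (computable_range hk) h3

theorem computable_siblingTest {β : Type*} [Primcodable β] {C : ℕ → List ℕ → List (List ℕ)}
    (hC : Computable fun p : ℕ × List ℕ => C p.1 p.2) {τ u : β → List ℕ} {k : β → ℕ}
    (hτ : Computable τ) (hk : Computable k) (hu : Computable u) :
    Computable fun a => siblingTest C (τ a) (k a) (u a) := by
  have h1 : Computable fun p : β × List ℕ => p.2.take (u p.1).length :=
    computable_take (Computable.list_length.comp (hu.comp Computable.fst)) Computable.snd
  have h2 : Computable fun p : β × List ℕ =>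
      !decide (Sibling (u p.1) (p.2.take (u p.1).length)) :=
    computable_not (computable_sibling (hu.comp Computable.fst) h1)
  have h3 : Computable fun p : β × List ℕ => hasExtBelow C (τ p.1) (k p.1) (u p.1) :=
    (computable_hasExtBelow hC hτ hk hu).comp Computable.fst
  exact computable_all (f := fun a => C (k a) (τ a)) (g := fun a x =>
    !decide (Sibling (u a) (x.take (u a).length)) || hasExtBelow C (τ a) (k a) (u a))
    (hC.comp (hk.pair hτ)) (computable_or h2 h3)

theorem computable_goodGuess {β : Type*} [Primcodable β] {l : ℕ → ℕ → ℕ}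
    {C : ℕ → List ℕ → List (List ℕ)} (hl : Computable₂ l)
    (hC : Computable fun p : ℕ × List ℕ => C p.1 p.2) (σ : List ℕ) {s : β → ℕ} {τ α : β → List ℕ}
    (hs : Computable s) (hτ : Computable τ) (hα : Computable α) :
    Computable fun a => goodGuess l C σ (s a) (τ a) (α a) := by
  have r1 : Computable fun a => List.range (s a + 1) := computable_range (Computable.succ.comp hs)
  have r2 : Computable fun a => List.range ((α a).length + 1) :=
    computable_range (Computable.succ.comp (Computable.list_length.comp hα))
  have h1 : Computable fun a => decide (σ <+: α a) && decide (s a ≤ (α a).length) :=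
    computable_and (computable_isPrefix (Computable.const σ) hα)
      (computable_decide_le hs (Computable.list_length.comp hα))
  have h2 : Computable fun p : β × ℕ => l p.2 (s p.1) :=
    hl.comp Computable.snd (hs.comp Computable.fst)
  have h3 : Computable fun p : β × ℕ => C p.2 (τ p.1) :=
    hC.comp (Computable.snd.pair (hτ.comp Computable.fst))
  have h4 : Computable fun p : β × ℕ => decide (l p.2 (s p.1) ≤ (α p.1).length) &&
      decide ((α p.1).take (l p.2 (s p.1)) ∈ C p.2 (τ p.1)) :=
    computable_and (computable_decide_le h2 (Computable.list_length.comp (hα.comp Computable.fst)))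
      (computable_mem (computable_take h2 (hα.comp Computable.fst)) h3)
  have h5 : Computable fun a => (List.range (s a + 1)).all fun k =>
      decide (l k (s a) ≤ (α a).length) && decide ((α a).take (l k (s a)) ∈ C k (τ a)) :=
    computable_all (g := fun a k => decide (l k (s a) ≤ (α a).length) &&
      decide ((α a).take (l k (s a)) ∈ C k (τ a))) r1 h4
  have h6 : Computable fun p : (β × ℕ) × ℕ =>
      siblingTest C (τ p.1.1) p.2 ((α p.1.1).take p.1.2) :=
    computable_siblingTest hC (hτ.comp (Computable.fst.comp Computable.fst)) Computable.snd
      (computable_take (Computable.snd.comp Computable.fst)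
        (hα.comp (Computable.fst.comp Computable.fst)))
  have h7 : Computable fun p : β × ℕ => (List.range (s p.1 + 1)).all fun k =>
      siblingTest C (τ p.1) k ((α p.1).take p.2) :=
    computable_all (g := fun (p : β × ℕ) k => siblingTest C (τ p.1) k ((α p.1).take p.2))
      (r1.comp Computable.fst) h6
  have h8 : Computable fun p : β × ℕ => decide (p.2 ≤ σ.length) :=
    computable_decide_le Computable.snd (Computable.const _)
  have h9 : Computable fun a => (List.range ((α a).length + 1)).all fun n =>
      decide (n ≤ σ.length) || (List.range (s a + 1)).all fun k =>
        siblingTest C (τ a) k ((α a).take n) :=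
    computable_all (g := fun (a : β) n => decide (n ≤ σ.length) ||
      (List.range (s a + 1)).all fun k => siblingTest C (τ a) k ((α a).take n)) r2
      (computable_or h8 h7)
  exact computable_and (computable_and h1 h5) h9

theorem getElem?_zero_filter_range {p : ℕ → Bool} {n i : ℕ}
    (h : ((List.range n).filter p)[0]? = some i) : p i = true ∧ i < n ∧ ∀ j < i, p j = false := by
  rw [← List.head?_eq_getElem?, List.head?_filter, List.find?_range_eq_some] at h
  exact ⟨h.1, List.mem_range.1 h.2.1, fun j hj => by simpa using h.2.2 j hj⟩

/-- The least `j` bounded by the length of `τ` such that `q s u j` holds of the initial segment of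
`τ` of length `j`. -/
def searchStep (q : ℕ → ℕ → ℕ → List ℕ → Bool) (s u : ℕ) (τ : List ℕ) : Option ℕ :=
  ((List.range (τ.length + 1)).filter fun j => q s u j (τ.take j))[0]?

/-- The iteration of `searchStep`, starting with `0`. -/
def iterSearch (q : ℕ → ℕ → ℕ → List ℕ → Bool) (s : ℕ) (τ : List ℕ) : Option ℕ :=
  Nat.rec (some 0) (fun s o => o.bind fun u => searchStep q s u τ) s

theorem computable_searchStep {q : ℕ → ℕ → ℕ → List ℕ → Bool}
    (hq : Computable fun p : ℕ × ℕ × ℕ × List ℕ => q p.1 p.2.1 p.2.2.1 p.2.2.2) :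
    Computable fun p : ℕ × ℕ × List ℕ => searchStep q p.1 p.2.1 p.2.2 := by
  have hτ : Computable fun p : (ℕ × ℕ × List ℕ) × ℕ => p.1.2.2.take p.2 :=
    computable_take Computable.snd (Computable.snd.comp (Computable.snd.comp Computable.fst))
  have h0 : Computable fun p : (ℕ × ℕ × List ℕ) × ℕ =>
      ((p.1.1, p.1.2.1, p.2, p.1.2.2.take p.2) : ℕ × ℕ × ℕ × List ℕ) :=
    (Computable.fst.comp Computable.fst).pair ((Computable.fst.comp
      (Computable.snd.comp Computable.fst)).pair (Computable.snd.pair hτ))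
  have h1 : Computable fun p : (ℕ × ℕ × List ℕ) × ℕ =>
      q p.1.1 p.1.2.1 p.2 (p.1.2.2.take p.2) := by
    have := hq.comp h0
    exact this
  have h2 : Computable fun p : ℕ × ℕ × List ℕ => List.range (p.2.2.length + 1) :=
    computable_range (Computable.succ.comp (Computable.list_length.comp
      (Computable.snd.comp Computable.snd)))
  have h3 : Computable fun p : ℕ × ℕ × List ℕ => (List.range (p.2.2.length + 1)).filter
      fun j => q p.1 p.2.1 j (p.2.2.take j) :=
    computable_filter (g := fun (p : ℕ × ℕ × List ℕ) j => q p.1 p.2.1 j (p.2.2.take j)) h2 h1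
  exact Computable.list_getElem?.comp h3 (Computable.const 0)

theorem computable_iterSearch {q : ℕ → ℕ → ℕ → List ℕ → Bool}
    (hq : Computable fun p : ℕ × ℕ × ℕ × List ℕ => q p.1 p.2.1 p.2.2.1 p.2.2.2) :
    Computable fun p : ℕ × List ℕ => iterSearch q p.1 p.2 := by
  have h0 : Computable fun p : ((ℕ × List ℕ) × ℕ × Option ℕ) × ℕ =>
      ((p.1.2.1, p.2, p.1.1.2) : ℕ × ℕ × List ℕ) :=
    (Computable.fst.comp (Computable.snd.comp Computable.fst)).pair
      (Computable.snd.pair (Computable.snd.comp (Computable.fst.comp Computable.fst)))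
  have h1 : Computable fun p : ((ℕ × List ℕ) × ℕ × Option ℕ) × ℕ =>
      searchStep q p.1.2.1 p.2 p.1.1.2 := by
    have := (computable_searchStep hq).comp h0
    exact this
  have h2 : Computable fun p : (ℕ × List ℕ) × ℕ × Option ℕ => p.2.2 :=
    Computable.snd.comp Computable.snd
  have h3 : Computable fun p : (ℕ × List ℕ) × ℕ × Option ℕ =>
      p.2.2.bind fun u => searchStep q p.2.1 u p.1.2 :=
    Computable.option_bind (f := fun p : (ℕ × List ℕ) × ℕ × Option ℕ => p.2.2)
      (g := fun p u => searchStep q p.2.1 u p.1.2) h2 h1.to₂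
  exact Computable.nat_rec (f := fun p : ℕ × List ℕ => p.1) (g := fun _ => some 0)
    (h := fun p r => r.2.bind fun u => searchStep q r.1 u p.2) Computable.fst
    (Computable.const (some 0)) h3.to₂

/-- An iterated search that asks an oracle. -/
theorem exists_search {B : Set ℕ} {q : ℕ → ℕ → ℕ → List ℕ → Bool}
    (hq : Computable fun p : ℕ × ℕ × ℕ × List ℕ => q p.1 p.2.1 p.2.2.1 p.2.2.2)
    (hex : ∀ s u, ∃ j, q s u j (restrict B j) = true) :
    ∃ i : ℕ → ℕ, (∀ s, q s (i s) (i (s + 1)) (restrict B (i (s + 1))) = true) ∧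
      ∀ f : ℕ → ℕ, Computable f → ComputableIn (oracle B) fun s => f (i (s + 1)) := by
  classical
  let i : ℕ → ℕ := fun s => Nat.rec 0 (fun s u => Nat.find (hex s u)) s
  have hi : ∀ s, i (s + 1) = Nat.find (hex s (i s)) := fun s => rfl
  refine ⟨i, fun s => by rw [hi]; exact Nat.find_spec (hex s (i s)), fun f hf => ?_⟩
  set step : ℕ → ℕ → List ℕ → Option ℕ := searchStep q with hstep'
  set G : ℕ → List ℕ → Option ℕ := iterSearch q with hG
  -- A segment of `B` that is too short gives no value, but never a wrong one.
  have hstep : ∀ s u m, i s = u → ∀ v, step s u (restrict B m) = some v ↔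
      v = i (s + 1) ∧ v ≤ m := by
    rintro s _ m rfl
    have hlt : ∀ j, j ≤ m → (restrict B m).take j = restrict B j := fun j => take_restrict B
    have hv : ∀ v, step s (i s) (restrict B m) = some v → v = i (s + 1) ∧ v ≤ m := by
      intro v h
      obtain ⟨h1, h2, h3⟩ := getElem?_zero_filter_range h
      rw [length_restrict, Nat.lt_succ_iff] at h2
      rw [hlt v h2] at h1
      refine ⟨?_, h2⟩
      rw [hi, eq_comm, Nat.find_eq_iff]
      refine ⟨h1, fun j hj => ?_⟩
      rw [← hlt j (hj.le.trans h2), h3 j hj]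
      simp
    refine fun v => ⟨hv v, ?_⟩
    rintro ⟨rfl, hm⟩
    have hmem : i (s + 1) ∈ (List.range ((restrict B m).length + 1)).filter
        fun j => q s (i s) j ((restrict B m).take j) := by
      rw [List.mem_filter, List.mem_range, length_restrict, hlt _ hm]
      exact ⟨Nat.lt_succ_of_le hm, by rw [hi]; exact Nat.find_spec (hex s (i s))⟩
    have h0 := List.getElem?_eq_getElem (List.length_pos_of_mem hmem)
    exact h0.trans (congrArg some (hv _ h0).1)
  have hG1 : ∀ s m v, G s (restrict B m) = some v → v = i s := by
    intro s
    induction s with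
    | zero => exact fun m v h => (Option.some.inj h).symm
    | succ s ih =>
      intro m v h
      obtain ⟨u, hu, h⟩ := Option.bind_eq_some_iff.1 h
      exact ((hstep s u m (ih m u hu).symm v).1 h).1
  have hG2 : ∀ s, ∃ n, ∀ m ≥ n, G s (restrict B m) = some (i s) := by
    intro s
    induction s with
    | zero => exact ⟨0, fun _ _ => rfl⟩
    | succ s ih =>
      obtain ⟨n, hn⟩ := ih
      refine ⟨max n (i (s + 1)), fun m hm => Option.bind_eq_some_iff.2
        ⟨i s, hn m ((le_max_left _ _).trans hm), ?_⟩⟩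
      exact (hstep s _ m rfl _).2 ⟨rfl, (le_max_right _ _).trans hm⟩
  have cG : Computable fun p : ℕ × List ℕ => G p.1 p.2 := computable_iterSearch hq
  have cF : Computable fun p : ℕ × List ℕ => (G (p.1 + 1) p.2).map f := by
    have h1 : Computable fun p : ℕ × List ℕ => G (p.1 + 1) p.2 :=
      cG.comp ((Computable.succ.comp Computable.fst).pair Computable.snd)
    exact Computable.option_map h1 (hf.comp Computable.snd).to₂
  refine computableIn_of_computable (F := fun s τ => (G (s + 1) τ).map f) cF
    (fun s m y hy => ?_) fun s => ?_
  · obtain ⟨v, hv, rfl⟩ := Option.map_eq_some_iff.1 hy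
    rw [hG1 _ _ _ hv]
  · obtain ⟨n, hn⟩ := hG2 (s + 1)
    exact ⟨n, by rw [hn n le_rfl]; rfl⟩

/-! ### The enumeration of `A` computed from `B`. -/

theorem computable_canonicalIndex_stringSet :
    Computable fun α : List ℕ => canonicalIndex (stringSet α) := by
  have h1 : Computable fun p : List ℕ × ℕ => decide (p.1[p.2]? = some 1) :=
    computable_beq (Computable.list_getElem?.comp Computable.fst Computable.snd)
      (Computable.const (some 1))
  have h2 : Computable fun p : List ℕ × ℕ => cond (decide (p.1[p.2]? = some 1)) (2 ^ p.2) 0 :=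
    Computable.cond h1 (primrec_two_pow.to_comp.comp Computable.snd) (Computable.const 0)
  refine (computable_sum_range (f := fun α : List ℕ => α.length)
    (g := fun α x => cond (decide (α[x]? = some 1)) (2 ^ x) 0) Computable.list_length h2).of_eq
    fun α => ?_
  rw [canonicalIndex, stringSet, Finset.sum_filter]
  exact Finset.sum_congr rfl fun x _ => by simp [Bool.cond_decide]

theorem mem_stringSet_restrict {A : Set ℕ} {x n : ℕ} (h : x < n) :
    x ∈ stringSet (restrict A n) ↔ x ∈ A := by
  rw [mem_stringSet]
  simp [restrict, h, chi]

/-- Since `Nat.pair e k < (max e k + 1) ^ 2`, the coefficient is at most `(k + e + 1) ^ 5`: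
quadratic widths enter squared, times `k + 1` levels. -/
theorem summable_natPair (e : ℕ) : Summable fun k : ℕ =>
    (((Nat.pair e k + 1) * (Nat.pair e k + 1) * (k + 1) : ℕ) : ℝ) * (2 / 2 ^ k) := by
  have h1 : Summable fun k : ℕ => ((k + (e + 1) : ℕ) : ℝ) ^ 5 * (1 / 2) ^ (k + (e + 1)) :=
    (summable_nat_add_iff (f := fun k : ℕ => (k : ℝ) ^ 5 * (1 / 2) ^ k) (e + 1)).2
      (summable_pow_mul_geometric_of_norm_lt_one 5 (by norm_num))
  refine (h1.mul_right (2 ^ (e + 2))).of_nonneg_of_le (fun k => by positivity) fun k => ?_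
  have h2 : Nat.pair e k + 1 ≤ (k + (e + 1)) ^ 2 :=
    (Nat.pair_lt_max_add_one_sq e k).trans_le (Nat.pow_le_pow_left
      (by have := max_le (Nat.le_add_left e k) (Nat.le_add_right k e); omega) 2)
  have h3 : (Nat.pair e k + 1) * (Nat.pair e k + 1) * (k + 1) ≤ (k + (e + 1)) ^ 5 := by
    calc _ ≤ (k + (e + 1)) ^ 2 * (k + (e + 1)) ^ 2 * (k + (e + 1)) :=
          Nat.mul_le_mul (Nat.mul_le_mul h2 h2) (by omega)
      _ = _ := by ring
  have h4 : ((1 / 2 : ℝ)) ^ (k + (e + 1)) * 2 ^ (e + 2) = 2 / 2 ^ k := by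
    rw [one_div, inv_pow, pow_add, pow_succ (2 : ℝ) (e + 1)]
    field_simp
  rw [mul_assoc _ _ ((2 : ℝ) ^ (e + 2)), h4]
  exact mul_le_mul_of_nonneg_right (by exact_mod_cast h3) (by positivity)

/-- If `A ≤_SJR B` and `B` is jump traceable, then some `B`-computable enumeration of `A` obeys a
given benign cost function. -/
theorem SJReducible.obeysRel {A B : Set ℕ} (hA : SJReducible A B) (hB : JumpTraceable B)
    {c : ℕ → ℕ → ℚ} (hc : IsCostFunction c) (hben : Benign c) : ObeysRel A B c := by
  obtain ⟨b, cb, hb⟩ := hben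
  set l := marker c b with hl
  have cl : Computable₂ l := computable_marker hc cb
  obtain ⟨C, e, L, cC, h⟩ := hA.exists_candidateSystem hB cl
    (N := fun k => b 1 (2 ^ k) + 1)
    (Computable.succ.comp (cb.comp (Computable.const 1) primrec_two_pow.to_comp))
    (length_enumList_marker_le hb hc) (le_marker c b)
  -- The number `j` codes a stage `t ≤ j` and a guess, so `B↾j` suffices for the test. Comparison
  -- with the previous code `u` makes the stages monotone, which the count of changes needs; `s ≤ t`
  -- is needed for convergence.
  let q : ℕ → ℕ → ℕ → List ℕ → Bool := fun s u j τ =>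
    (decide (u.unpair.1 ≤ j.unpair.1) && decide (s ≤ j.unpair.1)) &&
      goodGuess l C (restrict A L) s (τ.take j.unpair.1) (Denumerable.ofNat (List ℕ) j.unpair.2)
  have hq : ∀ s u j, q s u j (restrict B j) = true ↔ (u.unpair.1 ≤ j.unpair.1 ∧
      s ≤ j.unpair.1) ∧ GoodGuess A l (fun k t => {x | x ∈ C k (restrict B t)}) L s j.unpair.1
        (Denumerable.ofNat (List ℕ) j.unpair.2) := by
    intro s u j
    simp only [q, Bool.and_eq_true, decide_eq_true_eq, take_restrict B (Nat.unpair_left_le j),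
      goodGuess_iff]
  have cq : Computable fun p : ℕ × ℕ × ℕ × List ℕ => q p.1 p.2.1 p.2.2.1 p.2.2.2 := by
    have hj : Computable fun p : ℕ × ℕ × ℕ × List ℕ => p.2.2.1 :=
      Computable.fst.comp (Computable.snd.comp Computable.snd)
    have hτ : Computable fun p : ℕ × ℕ × ℕ × List ℕ => p.2.2.2 :=
      Computable.snd.comp (Computable.snd.comp Computable.snd)
    have ht := computable_unpair_fst hj
    have hα : Computable fun p : ℕ × ℕ × ℕ × List ℕ =>
        Denumerable.ofNat (List ℕ) p.2.2.1.unpair.2 :=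
      (Computable.ofNat (List ℕ)).comp (computable_unpair_snd hj)
    exact computable_and (computable_and (computable_decide_le (computable_unpair_fst
      (Computable.fst.comp Computable.snd)) ht) (computable_decide_le Computable.fst ht))
      (computable_goodGuess cl cC _ Computable.fst (computable_take ht hτ) hα)
  obtain ⟨i, hi, hi'⟩ := exists_search cq fun s u => by
    obtain ⟨t, ht, α, hα⟩ := h.exists_goodGuess s (max u.unpair.1 s)
    refine ⟨Nat.pair t (Encodable.encode α), (hq _ _ _).2 ?_⟩
    simp only [Nat.unpair_pair, Denumerable.ofNat_encode]
    exact ⟨max_le_iff.1 ht, hα⟩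
  set t : ℕ → ℕ := fun s => (i (s + 1)).unpair.1 with ht
  set α : ℕ → List ℕ := fun s => Denumerable.ofNat (List ℕ) (i (s + 1)).unpair.2 with hα
  have hg : ∀ s, GoodGuess A l (fun k t => {x | x ∈ C k (restrict B t)}) L s (t s) (α s) :=
    fun s => ((hq _ _ _).1 (hi s)).2
  have mt : Monotone t := monotone_nat_of_le_succ fun s => ((hq _ _ _).1 (hi (s + 1))).1.1
  have st : ∀ s, s ≤ t s := fun s => ((hq _ _ _).1 (hi s)).1.2
  refine ⟨fun s => stringSet (α s), ⟨?_, fun x => ?_⟩, ?_⟩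
  · exact hi' (fun j => canonicalIndex (stringSet (Denumerable.ofNat (List ℕ) j.unpair.2)))
      (computable_canonicalIndex_stringSet.comp
        ((Computable.ofNat (List ℕ)).comp (computable_unpair_snd Computable.id)))
  · filter_upwards [h.eventually_take_eq (le_marker c b) st hg (x + 1)] with s hs
    rw [mem_stringSet_iff_of_take_eq (hs.trans (take_restrict A le_rfl).symm) (Nat.lt_succ_self x),
      mem_stringSet_restrict (Nat.lt_succ_self x)]
  · exact h.obeysCost hc (fun k s x hx => cost_lt_of_marker_le hb hc hx)
      (monotone_marker c b) mt hg (summable_natPair e)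

end SJR

theorem mainTheorem2 (A B : Set ℕ) (hAB : SJR.SJReducible A B) (hB : SJR.JumpTraceable B)
    (c : ℕ → ℕ → ℚ) (hc : SJR.IsCostFunction c) (hben : SJR.Benign c) :
    SJR.ObeysRel A B c := by
  exact hAB.obeysRel hB hc hben
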